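/- **Setting.** Let $d\in\{2,3\}$, $n\ge 0$, $T>0$, $0<\alpha$, $0<\beta$; let $D\subset\mathbb R^d$ be a bounded domain, $Y_1,\dots,Y_n$ copies of the unit cube $Y$, $\mathbf Y=Y_1\times\dots\times Y_n$, $\mathbf Y_i=Y_1\times\dots\times Y_i$, $H=L^2(D)^d$, $H_i=L^2(D\times\mathbf Y_i)^d$; norms of curls are taken in the corresponding $L^2$ spaces (for $d=2$ the curl is scalar). Let $a,b$ be measurable symmetric-matrix valued functions on $D\times\mathbf Y$ ($b$ of size $d\times d$, $a$ of size $3\times3$ if $d=3$ and $1\times 1$ if $d=2$) with $\alpha|\xi|^2\le a\xi\cdot\xi$, $a\xi\cdot\zeta\le\beta|\xi||\zeta|$, and likewise for $b$. Put $W=H_0(\mathrm{curl},D)$ (with $u\times\nu=0$ understood weakly, through Green's formula), $W_i=L^2(D\times\mathbf Y_{i-1},\tilde H_\#(\mathrm{curl},Y_i))$, where $\tilde H_\#(\mathrm{curl},Y_i)$ is $H_\#(\mathrm{curl},Y_i)$ modulo functions with zero curl, $V_i=L^2(D\times\mathbf Y_{i-1},H^1_\#(Y_i)/\mathbb R)$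 and $\mathbf V=W\times W_1\times\dots\times W_n\times V_1\times\dots\times V_n$, with elements $\boldsymbol v=(v_0,\{v_i\},\{\mathfrak v_i\})$. On $\mathbf V$ let $$A(\boldsymbol v,\boldsymbol w)=\int_D\int_{\mathbf Y}a\Big(\mathrm{curl}\,v_0+\sum_i\mathrm{curl}_{y_i}v_i\Big)\cdot\Big(\mathrm{curl}\,w_0+\sum_i\mathrm{curl}_{y_i}w_i\Big),\quad B(\boldsymbol v,\boldsymbol w)=\int_D\int_{\mathbf Y}b\Big(v_0+\sum_i\nabla_{y_i}\mathfrak v_i\Big)\cdot\Big(w_0+\sum_i\nabla_{y_i}\mathfrak w_i\Big).$$ Let $f\in C([0,T];H)$ and let $\boldsymbol u=(u_0,\{u_i\},\{\mathfrak u_i\})\in H^2(0,T;\mathbf V)$ solve the multiscale homogenized Maxwell wave equation: for every $\boldsymbol v\in\mathbf V$, $\frac{d^2}{dt^2}B(\boldsymbol u(t),\boldsymbol v)+A(\boldsymbol u(t),\boldsymbol v)=\int_Df(t)\cdot v_0\,dx$ on $(0,T)$. Let $\mathbf V^L=W^L\times\prod_iW_i^L\times\prod_iV_i^L$, where $W^L\subset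 W$, $W_i^L\subset W_i$, $V_i^L\subset V_i$ are finite dimensional subspaces, each increasing in $L$. Let $\boldsymbol w^L(t)\in\mathbf V^L$ ($t\in[0,T]$) be the elliptic projection, $B(\boldsymbol w^L(t)-\boldsymbol u(t),\boldsymbol v)+A(\boldsymbol w^L(t)-\boldsymbol u(t),\boldsymbol v)=0$ for all $\boldsymbol v\in\mathbf V^L$, and put $\boldsymbol q^L=\boldsymbol w^L-\boldsymbol u$. For an integer $M\ge1$ let $\Delta t=T/M$, $t_m=m\Delta t$, and for a sequence $(r_m)$ (with $r_m=r(t_m)$ for a function $r$) put $r_{m+1/2}=\frac12(r_{m+1}+r_m)$, $r_{m,1/4}=\frac14r_{m+1}+\frac12r_m+\frac14r_{m-1}$, $\partial_tr_{m+1/2}=(r_{m+1}-r_m)/\Delta t$, $\partial_t^2r_m=(r_{m+1}-2r_m+r_{m-1})/(\Delta t)^2$, $\|r\|_{\tilde L^\infty(0,T;X)}=\max_{0\le m<M}\|r_{m+1/2}\|_X$, $\|\partial_tr\|_{\tilde L^\infty(0,T;X)}=\max_{0\le m<M}\|\partial_tr_{m+1/2}\|_X$. A fully discrete solution is $\boldsymbol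 u^L_0,\dots,\boldsymbol u^L_M\in\mathbf V^L$ with $$B(\partial_t^2\boldsymbol u^L_m,\boldsymbol v)+A(\boldsymbol u^L_{m,1/4},\boldsymbol v)=\int_Df_{m,1/4}\cdot v_0\,dx\qquad\forall\,\boldsymbol v\in\mathbf V^L,\ m=1,\dots,M-1 .$$ Put $\boldsymbol p^L_m=\boldsymbol u^L_m-\boldsymbol w^L(t_m)$. For $\boldsymbol r=(r_0,\{r_i\},\{\mathfrak r_i\})$ with $\boldsymbol r_m\in\mathbf V$ write $$\mathcal E(\boldsymbol r)=\|\partial_tr_0\|_{\tilde L^\infty(0,T;H)}+\sum_i\|\partial_t\nabla_{y_i}\mathfrak r_i\|_{\tilde L^\infty(0,T;H_i)}+\|\mathrm{curl}\,r_0\|_{\tilde L^\infty(0,T;H)}+\sum_i\|\mathrm{curl}_{y_i}r_i\|_{\tilde L^\infty(0,T;H_i)},$$ $$\mathcal I=\|\partial_tp^L_{0,1/2}\|_H+\sum_i\|\partial_t\nabla_{y_i}\mathfrak p^L_{i,1/2}\|_{H_i}+\|\mathrm{curl}\,p^L_{0,1/2}\|_H+\sum_i\|\mathrm{curl}_{y_i}p^L_{i,1/2}\|_{H_i},$$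 $$\mathcal Q=\Big\|\tfrac{\partial^2q_0^L}{\partial t^2}\Big\|_{L^2(0,T;H)}+\sum_i\Big\|\tfrac{\partial^2}{\partial t^2}\nabla_{y_i}\mathfrak q_i^L\Big\|_{L^2(0,T;H_i)}+\|q_0^L\|_{L^\infty(0,T;H)}+\sum_i\|\nabla_{y_i}\mathfrak q_i^L\|_{L^\infty(0,T;H_i)} .$$ **Proposition.** There is a constant $c>0$, depending only on $d,n,T,\alpha,\beta$ (in particular not on $\Delta t$, $L$, the subspaces, $f$, $\boldsymbol u$ or the discrete solution), such that the following holds. 1. If $\frac{\partial^3u_0}{\partial t^3}\in L^2(0,T;H)$ and $\frac{\partial^3}{\partial t^3}\nabla_{y_i}\mathfrak u_i\in L^2(0,T;H_i)$ for all $i$, then for all $L$, $M$ and all fully discrete solutions, $q_0^L\in H^2(0,T;H)$, $\nabla_{y_i}\mathfrak q_i^L\in H^2(0,T;H_i)$, and $$\mathcal E(\boldsymbol u^L-\boldsymbol u)\le c\Big[\Delta t\Big\|\tfrac{\partial^3u_0}{\partial t^3}\Big\|_{L^2(0,T;H)}+\Delta t\sum_i\Big\|\tfrac{\partial^3}{\partial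 t^3}\nabla_{y_i}\mathfrak u_i\Big\|_{L^2(0,T;H_i)}+\mathcal Q\Big]+c\,\mathcal I+\mathcal E(\boldsymbol q^L).$$ 2. If $\frac{\partial^4u_0}{\partial t^4}\in L^2(0,T;H)$ and $\frac{\partial^4}{\partial t^4}\nabla_{y_i}\mathfrak u_i\in L^2(0,T;H_i)$ for all $i$, then likewise $$\mathcal E(\boldsymbol u^L-\boldsymbol u)\le c\Big[(\Delta t)^2\Big\|\tfrac{\partial^4u_0}{\partial t^4}\Big\|_{L^2(0,T;H)}+(\Delta t)^2\sum_i\Big\|\tfrac{\partial^4}{\partial t^4}\nabla_{y_i}\mathfrak u_i\Big\|_{L^2(0,T;H_i)}+\mathcal Q\Big]+c\,\mathcal I+\mathcal E(\boldsymbol q^L).$$ 3. Assume the hypothesis of 1 and that $\bigcup_LW^L$, $\bigcup_LW_i^L$, $\bigcup_LV_i^L$ are dense in $W$, $W_i$, $V_i$. If $L\to\infty$ and $\Delta t\to0$ (along any sequence of pairs $(L,M)$ with $L\to\infty$, $M\to\infty$) and the starting values are chosen so that the initial step error $\mathcal I\to0$, then $\mathcal E(\boldsymbol u^L-\boldsymbol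 u)\to0$. -/

import Mathlib

open MeasureTheory Set Filter Topology
open scoped ContDiff

noncomputable section

namespace MaxwellWave

/-! ### Domains and Lebesgue spaces -/

/-- The physical space `ℝ^d`. -/
abbrev Sp (d : ℕ) : Type := EuclideanSpace ℝ (Fin d)

/-- The unit cube `Y`. -/
def cube (d : ℕ) : Set (Sp d) := {y | ∀ p, y p ∈ Ioo (0 : ℝ) 1}

/-- `D × Y_1 × … × Y_k`. A point is `z`, with `z 0 = x` and `z i = y_i` for `i = 1, …, k`. -/
def cellDomain (d : ℕ) (D : Set (Sp d)) (k : ℕ) : Set (Fin (k + 1) → Sp d) :=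
  {z | z 0 ∈ D ∧ ∀ i : Fin k, z i.succ ∈ cube d}

/-- Lebesgue measure on `D × Y_1 × … × Y_k`. -/
def cellMeasure (d : ℕ) (D : Set (Sp d)) (k : ℕ) : Measure (Fin (k + 1) → Sp d) :=
  volume.restrict (cellDomain d D k)

/-- `L²(D)^r`; for `r = d` this is `H`. -/
abbrev L2D (d : ℕ) (D : Set (Sp d)) (r : ℕ) : Type :=
  Lp (EuclideanSpace ℝ (Fin r)) 2 (volume.restrict D)

/-- `L²(D × Y_1 × … × Y_k)^r`; for `r = d` this is `H_k`. -/
abbrev L2Y (d : ℕ) (D : Set (Sp d)) (k r : ℕ) : Type :=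
  Lp (EuclideanSpace ℝ (Fin r)) 2 (cellMeasure d D k)

/-- `L²(D × Y_1 × … × Y_k)`, scalar valued. -/
abbrev L2Ys (d : ℕ) (D : Set (Sp d)) (k : ℕ) : Type := Lp ℝ 2 (cellMeasure d D k)

/-- The projection `(x, y_1, …, y_{k+1}) ↦ (x, y_1, …, y_k)`. -/
def front {d k : ℕ} (z : Fin (k + 2) → Sp d) : Fin (k + 1) → Sp d := fun j => z j.castSucc

/-! ### Curl -/

/-- The number of components of the curl of a vector field on `ℝ^d`: one for `d = 2`, three for
`d = 3`; the other dimensions are not used. -/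
def curlDim : ℕ → ℕ
  | 2 => 1
  | 3 => 3
  | _ => 0

/-- The `k`-th component of `curl u` is `∂_p u_q - ∂_q u_p` with `(p, q) = curlPair d k`. -/
def curlPair : (d : ℕ) → Fin (curlDim d) → Fin d × Fin d
  | 2, _ => (0, 1)
  | 3, k => (Fin.ofNat 3 (k.val + 1), Fin.ofNat 3 (k.val + 2))
  | 0, k => k.elim0
  | 1, k => k.elim0
  | (_ + 4), k => k.elim0

/-- The partial derivative `∂φ/∂x_p`. -/
def pd {d : ℕ} (p : Fin d) (φ : Sp d → ℝ) (x : Sp d) : ℝ :=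
  fderiv ℝ φ x (EuclideanSpace.single p 1)

/-- `w = curl u` on `D` and `u × ν = 0` on `∂D`, in the weak sense: Green's formula
`∫_D curl u · φ = ∫_D u · curl φ` holds without boundary term, componentwise, for all test
functions `φ` that are smooth up to the boundary (restrictions of `C_c^∞(ℝ^d)` functions). -/
def IsCurlZero (d : ℕ) (D : Set (Sp d)) (u : L2D d D d) (w : L2D d D (curlDim d)) : Prop :=
  ∀ φ : Sp d → ℝ, ContDiff ℝ ∞ φ → HasCompactSupport φ → ∀ k : Fin (curlDim d),
    ∫ x in D, w x k * φ x =
      -((∫ x in D, u x (curlPair d k).2 * pd (curlPair d k).1 φ x)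
        - ∫ x in D, u x (curlPair d k).1 * pd (curlPair d k).2 φ x)

/-- Smooth `Y`-periodic functions on `ℝ^d`. -/
def IsPerTest (d : ℕ) (ψ : Sp d → ℝ) : Prop :=
  ContDiff ℝ ∞ ψ ∧ ∀ (y : Sp d) (p : Fin d), ψ (y + EuclideanSpace.single p 1) = ψ y

/-- `G = ∇_{y_{k+1}} v` in the weak `Y_{k+1}`-periodic sense, for functions of
`(x, y_1, …, y_{k+1})`. Since `g` is an arbitrary square integrable function of
`(x, y_1, …, y_k)`, this says that for almost every `(x, y_1, …, y_k)` the slice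
`v(x, y_1, …, y_k, ·)` has the weak periodic gradient `G(x, y_1, …, y_k, ·)`. -/
def IsPerGrad (d : ℕ) (D : Set (Sp d)) (k : ℕ) (v : L2Ys d D (k + 1)) (G : L2Y d D (k + 1) d) :
    Prop :=
  ∀ g : (Fin (k + 1) → Sp d) → ℝ, MemLp g 2 (cellMeasure d D k) →
  ∀ ψ : Sp d → ℝ, IsPerTest d ψ → ∀ p : Fin d,
    ∫ z, G z p * (g (front z) * ψ (z (Fin.last (k + 1)))) ∂cellMeasure d D (k + 1) =
      -∫ z, v z * (g (front z) * pd p ψ (z (Fin.last (k + 1)))) ∂cellMeasure d D (k + 1)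

/-- `w = curl_{y_{k+1}} v` in the weak `Y_{k+1}`-periodic sense, for functions of
`(x, y_1, …, y_{k+1})`. -/
def IsPerCurl (d : ℕ) (D : Set (Sp d)) (k : ℕ) (v : L2Y d D (k + 1) d)
    (w : L2Y d D (k + 1) (curlDim d)) : Prop :=
  ∀ g : (Fin (k + 1) → Sp d) → ℝ, MemLp g 2 (cellMeasure d D k) →
  ∀ ψ : Sp d → ℝ, IsPerTest d ψ → ∀ c : Fin (curlDim d),
    ∫ z, w z c * (g (front z) * ψ (z (Fin.last (k + 1)))) ∂cellMeasure d D (k + 1) =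
      -((∫ z, v z (curlPair d c).2 *
            (g (front z) * pd (curlPair d c).1 ψ (z (Fin.last (k + 1))))
            ∂cellMeasure d D (k + 1))
        - ∫ z, v z (curlPair d c).1 *
            (g (front z) * pd (curlPair d c).2 ψ (z (Fin.last (k + 1))))
            ∂cellMeasure d D (k + 1))

/-! ### Test functionals on `L²` (helper facts) -/

lemma exists_testFunctional {α : Type*} [MeasurableSpace α] {μ : Measure α} {r : ℕ} (p : Fin r)
    {h : α → ℝ} (hh : MemLp h 2 μ) :
    ∃ l : Lp (EuclideanSpace ℝ (Fin r)) 2 μ →L[ℝ] ℝ, ∀ F, ∫ z, F z p * h z ∂μ = l F := by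
  have hm : MemLp (fun z => h z • (EuclideanSpace.single p (1 : ℝ))) 2 μ :=
    MemLp.smul (p := 2) (q := ⊤) (r := 2) (memLp_top_const _) hh
  refine ⟨innerSL ℝ (hm.toLp _), fun F => ?_⟩
  rw [innerSL_apply_apply, MeasureTheory.L2.inner_def]
  refine integral_congr_ae ?_
  filter_upwards [hm.coeFn_toLp] with z hz
  rw [hz]
  simp [inner_smul_left, EuclideanSpace.inner_single_left, mul_comm]

lemma exists_testFunctional_real {α : Type*} [MeasurableSpace α] {μ : Measure α}
    {h : α → ℝ} (hh : MemLp h 2 μ) :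
    ∃ l : Lp ℝ 2 μ →L[ℝ] ℝ, ∀ F, ∫ z, F z * h z ∂μ = l F := by
  refine ⟨innerSL ℝ (hh.toLp _), fun F => ?_⟩
  rw [innerSL_apply_apply, MeasureTheory.L2.inner_def]
  refine integral_congr_ae ?_
  filter_upwards [hh.coeFn_toLp] with z hz
  rw [hz]
  simp

lemma continuous_pd {d : ℕ} (p : Fin d) {φ : Sp d → ℝ} (hφ : ContDiff ℝ ∞ φ) :
    Continuous (pd p φ) :=
  (hφ.continuous_fderiv (by simp)).clm_apply continuous_const

lemma memLp_test {d : ℕ} {D : Set (Sp d)} {φ : Sp d → ℝ} (hφ : Continuous φ)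
    (hc : HasCompactSupport φ) : MemLp φ 2 (volume.restrict D) :=
  (hφ.memLp_of_hasCompactSupport hc).restrict D

lemma memLp_test_pd {d : ℕ} {D : Set (Sp d)} (p : Fin d) {φ : Sp d → ℝ} (hφ : ContDiff ℝ ∞ φ)
    (hc : HasCompactSupport φ) : MemLp (pd p φ) 2 (volume.restrict D) := by
  refine memLp_test (continuous_pd p hφ) ?_
  have := hc.fderiv (𝕜 := ℝ)
  exact this.comp_left (g := fun L : Sp d →L[ℝ] ℝ => L (EuclideanSpace.single p 1)) (by simp)

lemma isBounded_cube (d : ℕ) : Bornology.IsBounded (cube d) := by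
  have h : cube d ⊆ (EuclideanSpace.equiv (Fin d) ℝ) ⁻¹' (Icc 0 1) := by
    intro y hy
    exact ⟨fun p => (hy p).1.le, fun p => (hy p).2.le⟩
  have hK : IsCompact ((EuclideanSpace.equiv (Fin d) ℝ) ⁻¹' (Icc 0 1)) :=
    (EuclideanSpace.equiv (Fin d) ℝ).toHomeomorph.isCompact_preimage.mpr isCompact_Icc
  exact hK.isBounded.subset h

lemma isOpen_cube (d : ℕ) : IsOpen (cube d) := by
  have : cube d = ⋂ p : Fin d, {y : Sp d | y p ∈ Ioo (0 : ℝ) 1} := by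
    ext y; simp [cube]
  rw [this]
  exact isOpen_iInter_of_finite fun p => isOpen_Ioo.preimage (by fun_prop)

lemma volume_cube (d : ℕ) : volume (cube d) = 1 := by
  have h := (EuclideanSpace.volume_preserving_symm_measurableEquiv_toLp (Fin d)).symm
  have e : cube d = (MeasurableEquiv.toLp 2 (Fin d → ℝ)).symm ⁻¹'
      (Set.pi univ fun _ => Ioo (0 : ℝ) 1) := by
    ext y; simp [cube]
  rw [e, (EuclideanSpace.volume_preserving_symm_measurableEquiv_toLp (Fin d)).measure_preimage
    (MeasurableSet.univ_pi fun _ => measurableSet_Ioo).nullMeasurableSet, Real.volume_pi_Ioo]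
  simp

lemma cellDomain_succ (d : ℕ) (D : Set (Sp d)) (k : ℕ) :
    cellDomain d D (k + 1) =
      {z | z (Fin.last (k + 1)) ∈ cube d ∧ front z ∈ cellDomain d D k} := by
  ext z
  simp only [cellDomain, mem_ofPred_eq, Fin.forall_fin_succ']
  constructor
  · rintro ⟨h0, h1, h2⟩
    exact ⟨h2, h0, h1⟩
  · rintro ⟨h2, h0, h1⟩
    exact ⟨h0, h1, h2⟩

lemma measurePreserving_init (d : ℕ) (D : Set (Sp d)) (k : ℕ) :
    MeasurePreserving (front : (Fin (k + 2) → Sp d) → (Fin (k + 1) → Sp d))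
      (cellMeasure d D (k + 1)) (cellMeasure d D k) := by
  have h := volume_preserving_piFinSuccAbove (fun _ : Fin (k + 2) => Sp d) (Fin.last (k + 1))
  have e : cellDomain d D (k + 1) =
      (MeasurableEquiv.piFinSuccAbove (fun _ : Fin (k + 2) => Sp d) (Fin.last (k + 1))) ⁻¹'
        (cube d ×ˢ cellDomain d D k) := by
    rw [cellDomain_succ]
    ext z
    have : Fin.init z = front z := rfl
    simp [MeasurableEquiv.piFinSuccAbove, Fin.insertNthEquiv, this]
  have h2 := h.restrict_preimage_emb (MeasurableEquiv.measurableEmbedding _)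
    (cube d ×ˢ cellDomain d D k)
  rw [← e, Measure.volume_eq_prod, ← Measure.prod_restrict] at h2
  have : IsProbabilityMeasure (volume.restrict (cube d)) :=
    ⟨by rw [Measure.restrict_apply_univ, volume_cube]⟩
  have h3 := (measurePreserving_snd (μ := volume.restrict (cube d))
    (ν := (volume : Measure (Fin (k + 1) → Sp d)).restrict (cellDomain d D k))).comp h2
  have hf : (front : (Fin (k + 2) → Sp d) → (Fin (k + 1) → Sp d)) = Prod.snd ∘
      (MeasurableEquiv.piFinSuccAbove (fun _ : Fin (k + 2) => Sp d) (Fin.last (k + 1))) := by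
    funext z j
    simp [front, MeasurableEquiv.piFinSuccAbove, Fin.insertNthEquiv, Fin.init]
  rw [hf]
  exact h3

lemma memLp_cellTest {d : ℕ} {D : Set (Sp d)} {k : ℕ} {g : (Fin (k + 1) → Sp d) → ℝ}
    (hg : MemLp g 2 (cellMeasure d D k)) {ψ : Sp d → ℝ} (hψ : Continuous ψ) :
    MemLp (fun z : Fin (k + 2) → Sp d => g (front z) * ψ (z (Fin.last (k + 1)))) 2
      (cellMeasure d D (k + 1)) := by
  have h1 := hg.comp_measurePreserving (measurePreserving_init d D k)
  obtain ⟨C, hC⟩ := (isBounded_cube d).isCompact_closure.exists_bound_of_continuousOn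
    hψ.continuousOn
  have hm : Measurable fun z : Fin (k + 2) → Sp d => ψ (z (Fin.last (k + 1))) :=
    hψ.measurable.comp (measurable_pi_apply _)
  have hcube : ∀ᵐ z ∂cellMeasure d D (k + 1), z (Fin.last (k + 1)) ∈ cube d := by
    have hms : MeasurableSet {z : Fin (k + 2) → Sp d | z (Fin.last (k + 1)) ∈ cube d} :=
      (isOpen_cube d).measurableSet.preimage (measurable_pi_apply _)
    refine ae_mono (Measure.restrict_mono_set _ (t :=
      {z : Fin (k + 2) → Sp d | z (Fin.last (k + 1)) ∈ cube d}) ?_) (ae_restrict_mem hms)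
    rw [cellDomain_succ]
    exact fun z hz => hz.1
  refine MemLp.of_le_mul (c := C) h1 (h1.aestronglyMeasurable.mul hm.aestronglyMeasurable) ?_
  filter_upwards [hcube] with z hz
  have := hC _ (subset_closure hz)
  simp only [Function.comp, norm_mul]
  rw [mul_comm]
  gcongr

lemma exists_curlZero_functionals (d : ℕ) (D : Set (Sp d)) (φ : Sp d → ℝ) (h1 : ContDiff ℝ ∞ φ)
    (h2 : HasCompactSupport φ) (k : Fin (curlDim d)) :
    ∃ l : L2D d D d × L2D d D (curlDim d) →L[ℝ] ℝ, ∀ u : L2D d D d × L2D d D (curlDim d),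
      l u = (∫ x in D, u.2 x k * φ x)
        + ((∫ x in D, u.1 x (curlPair d k).2 * pd (curlPair d k).1 φ x)
          - ∫ x in D, u.1 x (curlPair d k).1 * pd (curlPair d k).2 φ x) := by
  obtain ⟨l1, H1⟩ := exists_testFunctional k (memLp_test (D := D) h1.continuous h2)
  obtain ⟨l2, H2⟩ := exists_testFunctional (curlPair d k).2
    (memLp_test_pd (D := D) (curlPair d k).1 h1 h2)
  obtain ⟨l3, H3⟩ := exists_testFunctional (curlPair d k).1
    (memLp_test_pd (D := D) (curlPair d k).2 h1 h2)
  refine ⟨l1.comp (.snd ℝ _ _) + (l2.comp (.fst ℝ _ _) - l3.comp (.fst ℝ _ _)), fun u => ?_⟩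
  rw [H1, H2, H3]
  rfl

lemma exists_perGrad_functionals (d : ℕ) (D : Set (Sp d)) (k : ℕ)
    (g : (Fin (k + 1) → Sp d) → ℝ) (hg : MemLp g 2 (cellMeasure d D k))
    (ψ : Sp d → ℝ) (hψ : IsPerTest d ψ) (p : Fin d) :
    ∃ l : L2Ys d D (k + 1) × L2Y d D (k + 1) d →L[ℝ] ℝ,
      ∀ u : L2Ys d D (k + 1) × L2Y d D (k + 1) d,
      l u = (∫ z, u.2 z p * (g (front z) * ψ (z (Fin.last (k + 1)))) ∂cellMeasure d D (k + 1))
        + ∫ z, u.1 z * (g (front z) * pd p ψ (z (Fin.last (k + 1)))) ∂cellMeasure d D (k + 1) := by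
  obtain ⟨l1, H1⟩ := exists_testFunctional p (memLp_cellTest hg hψ.1.continuous)
  obtain ⟨l2, H2⟩ := exists_testFunctional_real (memLp_cellTest hg (continuous_pd p hψ.1))
  refine ⟨l1.comp (.snd ℝ _ _) + l2.comp (.fst ℝ _ _), fun u => ?_⟩
  rw [H1, H2]
  rfl

lemma exists_perCurl_functionals (d : ℕ) (D : Set (Sp d)) (k : ℕ)
    (g : (Fin (k + 1) → Sp d) → ℝ) (hg : MemLp g 2 (cellMeasure d D k))
    (ψ : Sp d → ℝ) (hψ : IsPerTest d ψ) (c : Fin (curlDim d)) :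
    ∃ l : L2Y d D (k + 1) d × L2Y d D (k + 1) (curlDim d) →L[ℝ] ℝ,
      ∀ u : L2Y d D (k + 1) d × L2Y d D (k + 1) (curlDim d),
      l u = (∫ z, u.2 z c * (g (front z) * ψ (z (Fin.last (k + 1)))) ∂cellMeasure d D (k + 1))
        + ((∫ z, u.1 z (curlPair d c).2 *
              (g (front z) * pd (curlPair d c).1 ψ (z (Fin.last (k + 1))))
              ∂cellMeasure d D (k + 1))
          - ∫ z, u.1 z (curlPair d c).1 *
              (g (front z) * pd (curlPair d c).2 ψ (z (Fin.last (k + 1))))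
              ∂cellMeasure d D (k + 1)) := by
  obtain ⟨l1, H1⟩ := exists_testFunctional c (memLp_cellTest hg hψ.1.continuous)
  obtain ⟨l2, H2⟩ := exists_testFunctional (curlPair d c).2
    (memLp_cellTest hg (continuous_pd (curlPair d c).1 hψ.1))
  obtain ⟨l3, H3⟩ := exists_testFunctional (curlPair d c).1
    (memLp_cellTest hg (continuous_pd (curlPair d c).2 hψ.1))
  refine ⟨l1.comp (.snd ℝ _ _) + (l2.comp (.fst ℝ _ _) - l3.comp (.fst ℝ _ _)), fun u => ?_⟩
  rw [H1, H2, H3]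
  rfl

/-! ### The multiscale space `V` -/

/-- `W = H_0(curl, D)`; an element is a pair `(u, curl u)`, so that the norm is the graph norm. -/
def HcurlZero (d : ℕ) (D : Set (Sp d)) : Submodule ℝ (L2D d D d × L2D d D (curlDim d)) where
  carrier := {u | IsCurlZero d D u.1 u.2}
  zero_mem' := by
    intro φ h1 h2 k
    obtain ⟨l, H⟩ := exists_curlZero_functionals d D φ h1 h2 k
    have := H 0
    rw [map_zero] at this
    linarith
  add_mem' := by
    intro u v hu hv φ h1 h2 k
    obtain ⟨l, H⟩ := exists_curlZero_functionals d D φ h1 h2 k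
    have e := H (u + v)
    rw [map_add, H u, H v] at e
    linarith [hu φ h1 h2 k, hv φ h1 h2 k]
  smul_mem' := by
    intro c u hu φ h1 h2 k
    obtain ⟨l, H⟩ := exists_curlZero_functionals d D φ h1 h2 k
    have e := H (c • u)
    rw [map_smul, H u, hu φ h1 h2 k, neg_add_cancel, smul_zero] at e
    linarith

/-- `L²(D × Y_1 × … × Y_k, H¹_#(Y_{k+1}))`; an element is a pair `(v, ∇_{y_{k+1}} v)`. -/
def CellH1 (d : ℕ) (D : Set (Sp d)) (k : ℕ) :
    Submodule ℝ (L2Ys d D (k + 1) × L2Y d D (k + 1) d) where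
  carrier := {u | IsPerGrad d D k u.1 u.2}
  zero_mem' := by
    intro g hg ψ hψ p
    obtain ⟨l, H⟩ := exists_perGrad_functionals d D k g hg ψ hψ p
    have := H 0
    rw [map_zero] at this
    linarith
  add_mem' := by
    intro u v hu hv g hg ψ hψ p
    obtain ⟨l, H⟩ := exists_perGrad_functionals d D k g hg ψ hψ p
    have e := H (u + v)
    rw [map_add, H u, H v] at e
    linarith [hu g hg ψ hψ p, hv g hg ψ hψ p]
  smul_mem' := by
    intro c u hu g hg ψ hψ p
    obtain ⟨l, H⟩ := exists_perGrad_functionals d D k g hg ψ hψ p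
    have e := H (c • u)
    rw [map_smul, H u, hu g hg ψ hψ p, neg_add_cancel, smul_zero] at e
    linarith

/-- `L²(D × Y_1 × … × Y_k, H_#(curl, Y_{k+1}))`; an element is a pair `(v, curl_{y_{k+1}} v)`. -/
def CellHcurl (d : ℕ) (D : Set (Sp d)) (k : ℕ) :
    Submodule ℝ (L2Y d D (k + 1) d × L2Y d D (k + 1) (curlDim d)) where
  carrier := {u | IsPerCurl d D k u.1 u.2}
  zero_mem' := by
    intro g hg ψ hψ c
    obtain ⟨l, H⟩ := exists_perCurl_functionals d D k g hg ψ hψ c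
    have := H 0
    rw [map_zero] at this
    linarith
  add_mem' := by
    intro u v hu hv g hg ψ hψ c
    obtain ⟨l, H⟩ := exists_perCurl_functionals d D k g hg ψ hψ c
    have e := H (u + v)
    rw [map_add, H u, H v] at e
    linarith [hu g hg ψ hψ c, hv g hg ψ hψ c]
  smul_mem' := by
    intro r u hu g hg ψ hψ c
    obtain ⟨l, H⟩ := exists_perCurl_functionals d D k g hg ψ hψ c
    have e := H (r • u)
    rw [map_smul, H u, hu g hg ψ hψ c, neg_add_cancel, smul_zero] at e
    linarith

lemma isClosed_HcurlZero (d : ℕ) (D : Set (Sp d)) :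
    IsClosed (HcurlZero d D : Set (L2D d D d × L2D d D (curlDim d))) := by
  refine isClosed_of_closure_subset fun u hu φ h1 h2 k => ?_
  obtain ⟨l, H⟩ := exists_curlZero_functionals d D φ h1 h2 k
  have hl : u ∈ {x | l x = 0} := by
    refine closure_minimal (fun x hx => ?_) (isClosed_eq l.continuous continuous_const) hu
    have := hx φ h1 h2 k
    change l x = 0
    rw [H x]
    linarith
  have hl' : l u = 0 := hl
  rw [H u] at hl'
  linarith

lemma isClosed_CellH1 (d : ℕ) (D : Set (Sp d)) (k : ℕ) :
    IsClosed (CellH1 d D k : Set (L2Ys d D (k + 1) × L2Y d D (k + 1) d)) := by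
  refine isClosed_of_closure_subset fun u hu g hg ψ hψ p => ?_
  obtain ⟨l, H⟩ := exists_perGrad_functionals d D k g hg ψ hψ p
  have hl : u ∈ {x | l x = 0} := by
    refine closure_minimal (fun x hx => ?_) (isClosed_eq l.continuous continuous_const) hu
    have := hx g hg ψ hψ p
    change l x = 0
    rw [H x]
    linarith
  have hl' : l u = 0 := hl
  rw [H u] at hl'
  linarith

lemma isClosed_CellHcurl (d : ℕ) (D : Set (Sp d)) (k : ℕ) :
    IsClosed (CellHcurl d D k : Set (L2Y d D (k + 1) d × L2Y d D (k + 1) (curlDim d))) := by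
  refine isClosed_of_closure_subset fun u hu g hg ψ hψ c => ?_
  obtain ⟨l, H⟩ := exists_perCurl_functionals d D k g hg ψ hψ c
  have hl : u ∈ {x | l x = 0} := by
    refine closure_minimal (fun x hx => ?_) (isClosed_eq l.continuous continuous_const) hu
    have := hx g hg ψ hψ c
    change l x = 0
    rw [H x]
    linarith
  have hl' : l u = 0 := hl
  rw [H u] at hl'
  linarith

instance (d : ℕ) (D : Set (Sp d)) : CompleteSpace (HcurlZero d D) :=
  (isClosed_HcurlZero d D).completeSpace_coe

instance (d : ℕ) (D : Set (Sp d)) (k : ℕ) : CompleteSpace (CellH1 d D k) :=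
  (isClosed_CellH1 d D k).completeSpace_coe

instance (d : ℕ) (D : Set (Sp d)) (k : ℕ) : CompleteSpace (CellHcurl d D k) :=
  (isClosed_CellHcurl d D k).completeSpace_coe

/-- `(v, ∇_{y_{k+1}} v) ↦ ∇_{y_{k+1}} v`. -/
def preGrad (d : ℕ) (D : Set (Sp d)) (k : ℕ) : CellH1 d D k →L[ℝ] L2Y d D (k + 1) d :=
  (ContinuousLinearMap.snd ℝ _ _).comp (CellH1 d D k).subtypeL

/-- `(v, curl_{y_{k+1}} v) ↦ curl_{y_{k+1}} v`. -/
def preCurl (d : ℕ) (D : Set (Sp d)) (k : ℕ) :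
    CellHcurl d D k →L[ℝ] L2Y d D (k + 1) (curlDim d) :=
  (ContinuousLinearMap.snd ℝ _ _).comp (CellHcurl d D k).subtypeL

/-- The elements with `∇_{y_{k+1}} v = 0`, i.e. which are constant in `y_{k+1}`. -/
def gradKer (d : ℕ) (D : Set (Sp d)) (k : ℕ) : Submodule ℝ (CellH1 d D k) :=
  LinearMap.ker (preGrad d D k).toLinearMap

/-- The elements with `curl_{y_{k+1}} v = 0`. -/
def curlKer (d : ℕ) (D : Set (Sp d)) (k : ℕ) : Submodule ℝ (CellHcurl d D k) :=
  LinearMap.ker (preCurl d D k).toLinearMap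

instance (d : ℕ) (D : Set (Sp d)) (k : ℕ) : IsClosed (gradKer d D k : Set (CellH1 d D k)) :=
  (preGrad d D k).isClosed_ker

instance (d : ℕ) (D : Set (Sp d)) (k : ℕ) : IsClosed (curlKer d D k : Set (CellHcurl d D k)) :=
  (preCurl d D k).isClosed_ker

/-- `V_{k+1} = L²(D × Y_1 × … × Y_k, H¹_#(Y_{k+1}) / ℝ)`, with the quotient norm. -/
abbrev CellV (d : ℕ) (D : Set (Sp d)) (k : ℕ) : Type := CellH1 d D k ⧸ gradKer d D k

/-- `W_{k+1} = L²(D × Y_1 × … × Y_k, H̃_#(curl, Y_{k+1}))`: classes of functions with equal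
`curl_{y_{k+1}}`, with the quotient norm. -/
abbrev CellW (d : ℕ) (D : Set (Sp d)) (k : ℕ) : Type := CellHcurl d D k ⧸ curlKer d D k

instance (d : ℕ) (D : Set (Sp d)) (k : ℕ) : NormedAddCommGroup (CellV d D k) :=
  Submodule.Quotient.normedAddCommGroup _

instance (d : ℕ) (D : Set (Sp d)) (k : ℕ) : NormedSpace ℝ (CellV d D k) :=
  Submodule.Quotient.normedSpace _ ℝ

instance (d : ℕ) (D : Set (Sp d)) (k : ℕ) : NormedAddCommGroup (CellW d D k) :=
  Submodule.Quotient.normedAddCommGroup _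

instance (d : ℕ) (D : Set (Sp d)) (k : ℕ) : NormedSpace ℝ (CellW d D k) :=
  Submodule.Quotient.normedSpace _ ℝ

/-- `V = W × W_1 × … × W_n × V_1 × … × V_n`. The index `i : Fin n` stands for the scale `i + 1`.
The norm of the product is the maximum of the component norms, which is equivalent to their sum. -/
abbrev MSpace (d : ℕ) (D : Set (Sp d)) (n : ℕ) : Type :=
  HcurlZero d D × (((i : Fin n) → CellW d D i) × ((i : Fin n) → CellV d D i))

section Components

variable {d : ℕ} {D : Set (Sp d)} {n : ℕ}

/-- `v ↦ v_0 ∈ H`. -/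
def val0 : MSpace d D n →ₗ[ℝ] L2D d D d :=
  LinearMap.fst ℝ _ _ ∘ₗ (HcurlZero d D).subtype ∘ₗ LinearMap.fst ℝ _ _

/-- `v ↦ curl v_0`. -/
def curl0 : MSpace d D n →ₗ[ℝ] L2D d D (curlDim d) :=
  LinearMap.snd ℝ _ _ ∘ₗ (HcurlZero d D).subtype ∘ₗ LinearMap.fst ℝ _ _

/-- `v ↦ curl_{y_{i+1}} v_{i+1}`. -/
def curlY (i : Fin n) : MSpace d D n →ₗ[ℝ] L2Y d D (i + 1) (curlDim d) :=
  (curlKer d D i).liftQ (preCurl d D i).toLinearMap le_rfl ∘ₗ LinearMap.proj i ∘ₗ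
    LinearMap.fst ℝ _ _ ∘ₗ LinearMap.snd ℝ _ _

/-- `v ↦ ∇_{y_{i+1}} 𝔳_{i+1}`. -/
def gradY (i : Fin n) : MSpace d D n →ₗ[ℝ] L2Y d D (i + 1) d :=
  (gradKer d D i).liftQ (preGrad d D i).toLinearMap le_rfl ∘ₗ LinearMap.proj i ∘ₗ
    LinearMap.snd ℝ _ _ ∘ₗ LinearMap.snd ℝ _ _

/-- The projection `(x, y_1, …, y_n) ↦ (x, y_1, …, y_{i+1})`. -/
def trunc (i : Fin n) (z : Fin (n + 1) → Sp d) : Fin (i + 1 + 1) → Sp d :=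
  fun j => z ⟨j, by omega⟩

/-- `v_0(x) + ∑_i ∇_{y_i} 𝔳_i(x, y_1, …, y_i)`. -/
def fieldSum (v : MSpace d D n) (z : Fin (n + 1) → Sp d) : Sp d :=
  val0 v (z 0) + ∑ i, gradY i v (trunc i z)

/-- `curl v_0(x) + ∑_i curl_{y_i} v_i(x, y_1, …, y_i)`. -/
def curlSum (v : MSpace d D n) (z : Fin (n + 1) → Sp d) : EuclideanSpace ℝ (Fin (curlDim d)) :=
  curl0 v (z 0) + ∑ i, curlY i v (trunc i z)

/-- `B(v, w) = ∫_D ∫_Y b (v_0 + ∑ ∇_{y_i} 𝔳_i) · (w_0 + ∑ ∇_{y_i} 𝔴_i) dy dx`. -/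
def formB (b : (Fin (n + 1) → Sp d) → Matrix (Fin d) (Fin d) ℝ) (v w : MSpace d D n) : ℝ :=
  ∫ z, ∑ p, ∑ q, b z p q * fieldSum v z q * fieldSum w z p ∂cellMeasure d D n

/-- `A(v, w) = ∫_D ∫_Y a (curl v_0 + ∑ curl_{y_i} v_i) · (curl w_0 + ∑ curl_{y_i} w_i) dy dx`. -/
def formA (a : (Fin (n + 1) → Sp d) → Matrix (Fin (curlDim d)) (Fin (curlDim d)) ℝ)
    (v w : MSpace d D n) : ℝ :=
  ∫ z, ∑ p, ∑ q, a z p q * curlSum v z q * curlSum w z p ∂cellMeasure d D n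

end Components

/-- Symmetric (measurable) coefficient matrices on `D × Y_1 × … × Y_n` that are coercive with
constant `α` and bounded by `β`. -/
def IsCoeff (d : ℕ) (D : Set (Sp d)) (n r : ℕ) (α β : ℝ)
    (a : (Fin (n + 1) → Sp d) → Matrix (Fin r) (Fin r) ℝ) : Prop :=
  (∀ p q, AEStronglyMeasurable (fun z => a z p q) (cellMeasure d D n)) ∧
  (∀ z ∈ cellDomain d D n, (a z).IsSymm) ∧
  (∀ z ∈ cellDomain d D n, ∀ ξ : EuclideanSpace ℝ (Fin r),
    α * ‖ξ‖ ^ 2 ≤ ∑ p, ∑ q, a z p q * ξ p * ξ q) ∧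
  ∀ z ∈ cellDomain d D n, ∀ ξ ζ : EuclideanSpace ℝ (Fin r),
    ∑ p, ∑ q, a z p q * ξ p * ζ q ≤ β * ‖ξ‖ * ‖ζ‖

/-! ### Time-dependent functions -/

section Time

variable {X : Type*} [NormedAddCommGroup X] [NormedSpace ℝ X]

/-- `u ∈ H^k(0, T; X)` with `k`-th time derivative `g`. Functions in `H^k(0, T; X)` with `k ≥ 1`
are represented by their continuous representative on `[0, T]`: `u = U 0`, and each `U j`,
`j < k`, is the integral of its derivative `U (j + 1)`, with `U 0, …, U k ∈ L²(0, T; X)`. -/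
def HasTimeDeriv (T : ℝ) (k : ℕ) (u g : ℝ → X) : Prop :=
  ∃ U : ℕ → ℝ → X, (∀ t ∈ Icc 0 T, U 0 t = u t) ∧ U k = g ∧
    (∀ j ≤ k, MemLp (U j) 2 (volume.restrict (Ioo 0 T))) ∧
    ∀ j < k, ∀ t ∈ Icc 0 T, U j t = U j 0 + ∫ s in (0 : ℝ)..t, U (j + 1) s

/-- `u ∈ H^k(0, T; X)`. -/
def MemHTime (T : ℝ) (k : ℕ) (u : ℝ → X) : Prop := ∃ g, HasTimeDeriv T k u g

open Classical in
/-- `∂^k u / ∂t^k` for `u ∈ H^k(0, T; X)` (unique up to equality almost everywhere on `(0, T)`). -/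
def timeDeriv (T : ℝ) (k : ℕ) (u : ℝ → X) : ℝ → X :=
  if h : MemHTime T k u then h.choose else 0

/-- The norm of `L^p(0, T; X)`. -/
def timeNorm (T : ℝ) (p : ENNReal) (u : ℝ → X) : ℝ :=
  (eLpNorm u p (volume.restrict (Ioo 0 T))).toReal

/-! ### Difference quotients and averages of `r_0, r_1, …, r_M` -/

/-- `r_{m+1/2} = (r_{m+1} + r_m) / 2`. -/
def half (r : ℕ → X) (m : ℕ) : X := (1 / 2 : ℝ) • (r (m + 1) + r m)

/-- `∂_t r_{m+1/2} = (r_{m+1} - r_m) / Δt`. -/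
def dt (τ : ℝ) (r : ℕ → X) (m : ℕ) : X := τ⁻¹ • (r (m + 1) - r m)

/-- `r_{m,θ} = θ r_{m+1} + (1 - 2θ) r_m + θ r_{m-1}`, for `m ≥ 1`. -/
def avg (θ : ℝ) (r : ℕ → X) (m : ℕ) : X :=
  θ • r (m + 1) + (1 - 2 * θ) • r m + θ • r (m - 1)

/-- `∂_t² r_m = (r_{m+1} - 2 r_m + r_{m-1}) / (Δt)²`, for `m ≥ 1`. -/
def dt2 (τ : ℝ) (r : ℕ → X) (m : ℕ) : X :=
  (τ ^ 2)⁻¹ • (r (m + 1) - (2 : ℝ) • r m + r (m - 1))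

/-- `max_{0 ≤ m < M} ‖s_m‖`. Applied to `m ↦ r_{m+1/2}` and `m ↦ ∂_t r_{m+1/2}` it gives the
discrete norms `‖r‖` and `‖∂_t r‖` of `L̃^∞(0, T; X)`. -/
def maxNorm (M : ℕ) (s : ℕ → X) : ℝ := ⨆ m : Fin M, ‖s m‖

end Time

section Scheme

variable {d : ℕ} {D : Set (Sp d)} {n : ℕ}

/-- `u : [0, T] → V` solves the multiscale homogenized equation: for all `v ∈ V`,
`∂²/∂t² B(u(t), v) + A(u(t), v) = ∫_D f(t) · v_0 dx` on `(0, T)`. -/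
def IsSolution (T : ℝ) (a : (Fin (n + 1) → Sp d) → Matrix (Fin (curlDim d)) (Fin (curlDim d)) ℝ)
    (b : (Fin (n + 1) → Sp d) → Matrix (Fin d) (Fin d) ℝ) (f : ℝ → L2D d D d)
    (u : ℝ → MSpace d D n) : Prop :=
  ∀ v : MSpace d D n,
    HasTimeDeriv T 2 (fun t => formB b (u t) v)
      (fun t => (∫ x in D, inner ℝ (f t x) (val0 v x)) - formA a (u t) v)

/-- Hierarchies of finite dimensional subspaces of `W`, `W_i` and `V_i`. -/
structure FEHierarchy (d : ℕ) (D : Set (Sp d)) (n : ℕ) where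
  W0 : ℕ → Submodule ℝ (HcurlZero d D)
  Wc : (i : Fin n) → ℕ → Submodule ℝ (CellW d D i)
  Vc : (i : Fin n) → ℕ → Submodule ℝ (CellV d D i)
  mono_W0 : Monotone W0
  mono_Wc : ∀ i, Monotone (Wc i)
  mono_Vc : ∀ i, Monotone (Vc i)
  fin_W0 : ∀ L, FiniteDimensional ℝ (W0 L)
  fin_Wc : ∀ i L, FiniteDimensional ℝ (Wc i L)
  fin_Vc : ∀ i L, FiniteDimensional ℝ (Vc i L)

/-- `V^L = W^L × W_1^L × … × W_n^L × V_1^L × … × V_n^L`. -/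
def FEHierarchy.VL (S : FEHierarchy d D n) (L : ℕ) : Submodule ℝ (MSpace d D n) :=
  (S.W0 L).prod ((Submodule.pi (φ := fun i : Fin n => CellW d D i) univ fun i => S.Wc i L).prod
    (Submodule.pi (φ := fun i : Fin n => CellV d D i) univ fun i => S.Vc i L))

/-- The unions over `L` of the subspaces are dense in `W`, `W_i` and `V_i`. -/
def FEHierarchy.IsDense (S : FEHierarchy d D n) : Prop :=
  Dense (⋃ L, (S.W0 L : Set (HcurlZero d D))) ∧
    (∀ i : Fin n, Dense (⋃ L, (S.Wc i L : Set (CellW d D i)))) ∧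
    ∀ i : Fin n, Dense (⋃ L, (S.Vc i L : Set (CellV d D i)))

/-- `w(t) ∈ V^L` is the elliptic projection of `u(t)`: `B(w(t) - u(t), v) + A(w(t) - u(t), v) = 0`
for all `v ∈ V^L`. -/
def IsEllipticProj (T : ℝ)
    (a : (Fin (n + 1) → Sp d) → Matrix (Fin (curlDim d)) (Fin (curlDim d)) ℝ)
    (b : (Fin (n + 1) → Sp d) → Matrix (Fin d) (Fin d) ℝ) (VL : Submodule ℝ (MSpace d D n))
    (u w : ℝ → MSpace d D n) : Prop :=
  ∀ t ∈ Icc 0 T, w t ∈ VL ∧ ∀ v ∈ VL, formB b (w t - u t) v + formA a (w t - u t) v = 0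

/-- `U_0, …, U_M ∈ V^L` solve the fully discrete problem with `Δt = T / M` and `t_m = m Δt`:
`B(∂_t² U_m, v) + A(U_{m,1/4}, v) = ∫_D f_{m,1/4} · v_0 dx` for all `v ∈ V^L`,
`m = 1, …, M - 1`. -/
def IsDiscreteSolution (T : ℝ)
    (a : (Fin (n + 1) → Sp d) → Matrix (Fin (curlDim d)) (Fin (curlDim d)) ℝ)
    (b : (Fin (n + 1) → Sp d) → Matrix (Fin d) (Fin d) ℝ) (f : ℝ → L2D d D d)
    (VL : Submodule ℝ (MSpace d D n)) (M : ℕ) (U : ℕ → MSpace d D n) : Prop :=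
  (∀ m ≤ M, U m ∈ VL) ∧
    ∀ m, 1 ≤ m → m < M → ∀ v ∈ VL,
      formB b (dt2 (T / M) U m) v + formA a (avg (1 / 4) U m) v =
        ∫ x in D, inner ℝ ((avg (1 / 4) (fun j => f (j * (T / M))) m : L2D d D d) x) (val0 v x)

/-- `‖∂_t r_{0,1/2}‖_H + ∑ ‖∂_t ∇_{y_i} 𝔯_{i,1/2}‖ + ‖curl r_{0,1/2}‖_H + ∑ ‖curl_{y_i} r_{i,1/2}‖`
for `r_0, r_1 ∈ V`. -/
def initialNorm (τ : ℝ) (r : ℕ → MSpace d D n) : ℝ :=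
  ‖dt τ (fun m => val0 (r m)) 0‖ + ∑ i, ‖dt τ (fun m => gradY i (r m)) 0‖
    + ‖half (fun m => curl0 (r m)) 0‖ + ∑ i, ‖half (fun m => curlY i (r m)) 0‖

/-- The discrete energy norm
`‖∂_t r_0‖_{L̃^∞(H)} + ∑ ‖∂_t ∇_{y_i} 𝔯_i‖_{L̃^∞(H_i)} + ‖curl r_0‖_{L̃^∞(H)}
+ ∑ ‖curl_{y_i} r_i‖_{L̃^∞(H_i)}` of `r_0, …, r_M ∈ V`. -/
def energyNorm (τ : ℝ) (M : ℕ) (r : ℕ → MSpace d D n) : ℝ :=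
  maxNorm M (dt τ fun m => val0 (r m)) + ∑ i, maxNorm M (dt τ fun m => gradY i (r m))
    + maxNorm M (half fun m => curl0 (r m)) + ∑ i, maxNorm M (half fun m => curlY i (r m))

/-- `‖∂_t^k u_0‖_{L²(0,T;H)} + ∑ ‖∂_t^k ∇_{y_i} 𝔲_i‖_{L²(0,T;H_i)}`. -/
def derivNorm (T : ℝ) (k : ℕ) (u : ℝ → MSpace d D n) : ℝ :=
  timeNorm T 2 (timeDeriv T k fun t => val0 (u t))
    + ∑ i, timeNorm T 2 (timeDeriv T k fun t => gradY i (u t))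

/-- `‖q_0‖_{L^∞(0,T;H)} + ∑ ‖∇_{y_i} 𝔮_i‖_{L^∞(0,T;H_i)}`. -/
def supNorm (T : ℝ) (q : ℝ → MSpace d D n) : ℝ :=
  timeNorm T ⊤ (fun t => val0 (q t)) + ∑ i, timeNorm T ⊤ fun t => gradY i (q t)

/-- `u_0 ∈ H^k(0, T; H)` and `∇_{y_i} 𝔲_i ∈ H^k(0, T; H_i)` for all `i`. -/
def MemHFields (T : ℝ) (k : ℕ) (u : ℝ → MSpace d D n) : Prop :=
  MemHTime T k (fun t => val0 (u t)) ∧ ∀ i, MemHTime T k fun t => gradY i (u t)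

end Scheme

end MaxwellWave

end

open MaxwellWave

open MaxwellWave

/-! The forms `A` and `B` see an element of the multiscale space only through the two sums `curlOp
v` and `fieldOp v`, regarded as elements of L² over all the scales. Periodic gradients and curls
have mean zero in their own fast variable, so contributions of different scales are orthogonal
(`norm_scaleSum_sq`), and the norm of a sum controls every component. The problem thus becomes an
abstract one: two symmetric, coercive, bounded forms `b`, `a` on normed spaces and two continuous
linear maps `Φ`, `Ψ` into them, jointly injective.

Write U - u = p + q with p = U - w and q = w - u. At the grid points, subtract the suitably averaged
wave equation from the scheme. The elliptic projection trades the `a`-residual of q for a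
`b`-residual, so p satisfies the scheme with a right-hand side measured in the field norm alone: the
consistency error of the time discretization, the second difference of q and the average of q.
Testing with the central difference of p makes the discrete energy telescope (`stepEnergy_sub`);
estimating at the step of maximal energy gives stability with no exponential factor
(`discrete_energy_estimate`).

The consistency error reduces to second differences of the second time derivative of the field
(`norm_avg_sub_dt2_le`). A third derivative in L² bounds these by integrals over short windows; a
fourth gives one more power of the step. Summing over the grid counts each window at most twice.

The projection onto V^L is one continuous linear map P, independent of time. It therefore commutes
with time integration, and q = (P - 1)u inherits the time regularity of u. Céa's estimate bounds P -
1 uniformly in L in the energy norms, and density makes it tend to zero pointwise. Dominated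
convergence in time then sends all norms of q to zero, which gives the convergence statement. -/

namespace MaxwellWave

/-! ### Chains of time derivatives -/

section TimeChain

variable {X : Type*} [NormedAddCommGroup X] [NormedSpace ℝ X]
  {X' : Type*} [NormedAddCommGroup X'] [NormedSpace ℝ X'] {Z : Type*} [NormedAddCommGroup Z]
  {T : ℝ} {k : ℕ}

/-- `U 0, …, U k ∈ L²(0, T; X)` and each `U j`, `j < k`, is the integral of `U (j + 1)`. -/
structure IsTimeChain (T : ℝ) (k : ℕ) (U : ℕ → ℝ → X) : Prop where
  memLp : ∀ j ≤ k, MemLp (U j) 2 (volume.restrict (Ioo 0 T))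
  integral : ∀ j < k, ∀ t ∈ Icc 0 T, U j t = U j 0 + ∫ s in (0 : ℝ)..t, U (j + 1) s

theorem HasTimeDeriv.exists_chain {u g : ℝ → X} (h : HasTimeDeriv T k u g) :
    ∃ U, IsTimeChain T k U ∧ (∀ t ∈ Icc 0 T, U 0 t = u t) ∧ U k = g := by
  obtain ⟨U, h0, hk, h1, h2⟩ := h
  exact ⟨U, ⟨h1, h2⟩, h0, hk⟩

theorem IsTimeChain.hasTimeDeriv {U : ℕ → ℝ → X} (h : IsTimeChain T k U) {u : ℝ → X}
    (hu : ∀ t ∈ Icc 0 T, U 0 t = u t) : HasTimeDeriv T k u (U k) :=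
  ⟨U, hu, rfl, h.memLp, h.integral⟩

theorem intervalIntegrable_of_memLp {f : ℝ → Z} (h : MemLp f 2 (volume.restrict (Ioo 0 T)))
    {a b : ℝ} (ha : a ∈ Icc 0 T) (hb : b ∈ Icc 0 T) : IntervalIntegrable f volume a b := by
  have h1 : IntegrableOn f (Icc 0 T) := by
    rw [integrableOn_Icc_iff_integrableOn_Ioo]
    exact h.integrable (by norm_num)
  refine IntegrableOn.intervalIntegrable (h1.mono_set ?_)
  exact Set.uIcc_subset_Icc ha hb

namespace IsTimeChain

variable {U : ℕ → ℝ → X}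

theorem mono (h : IsTimeChain T k U) {k' : ℕ} (hk : k' ≤ k) : IsTimeChain T k' U :=
  ⟨fun j hj => h.memLp j (hj.trans hk), fun j hj => h.integral j (hj.trans_le hk)⟩

theorem intervalIntegrable (h : IsTimeChain T k U) {j : ℕ} (hj : j ≤ k) {a b : ℝ}
    (ha : a ∈ Icc 0 T) (hb : b ∈ Icc 0 T) : IntervalIntegrable (U j) volume a b :=
  intervalIntegrable_of_memLp (h.memLp j hj) ha hb

theorem sub_eq (h : IsTimeChain T k U) {j : ℕ} (hj : j < k) {a b : ℝ}
    (ha : a ∈ Icc 0 T) (hb : b ∈ Icc 0 T) : U j b - U j a = ∫ s in a..b, U (j + 1) s := by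
  have h0 : (0 : ℝ) ∈ Icc 0 T := ⟨le_rfl, ha.1.trans ha.2⟩
  rw [h.integral j hj b hb, h.integral j hj a ha, add_sub_add_left_eq_sub]
  exact intervalIntegral.integral_interval_sub_left (h.intervalIntegrable hj h0 hb)
    (h.intervalIntegrable hj h0 ha)

theorem continuousOn (h : IsTimeChain T k U) {j : ℕ} (hj : j < k) :
    ContinuousOn (U j) (Icc 0 T) := by
  rcases le_or_gt 0 T with hT | hT
  · have h1 : IntegrableOn (U (j + 1)) (uIcc 0 T) := by
      rw [uIcc_of_le hT, integrableOn_Icc_iff_integrableOn_Ioo]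
      exact (h.memLp (j + 1) hj).integrable (by norm_num)
    have h2 := intervalIntegral.continuousOn_primitive_interval h1
    rw [uIcc_of_le hT] at h2
    exact (continuousOn_const.add h2).congr fun t ht => h.integral j hj t ht
  · rw [Icc_eq_empty (by linarith)]
    exact continuousOn_empty _

theorem clm_comp [CompleteSpace X] [CompleteSpace X'] (h : IsTimeChain T k U) (L : X →L[ℝ] X') :
    IsTimeChain T k fun j t => L (U j t) := by
  refine ⟨fun j hj => L.comp_memLp' (h.memLp j hj), fun j hj t ht => ?_⟩
  have h0 : (0 : ℝ) ∈ Icc 0 T := ⟨le_rfl, ht.1.trans ht.2⟩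
  rw [L.intervalIntegral_comp_comm (h.intervalIntegrable hj h0 ht), ← map_add,
    ← h.integral j hj t ht]

theorem add {U' : ℕ → ℝ → X} (h : IsTimeChain T k U) (h' : IsTimeChain T k U') :
    IsTimeChain T k fun j t => U j t + U' j t := by
  refine ⟨fun j hj => (h.memLp j hj).add (h'.memLp j hj), fun j hj t ht => ?_⟩
  have h0 : (0 : ℝ) ∈ Icc 0 T := ⟨le_rfl, ht.1.trans ht.2⟩
  rw [intervalIntegral.integral_add (h.intervalIntegrable hj h0 ht)
    (h'.intervalIntegrable hj h0 ht), h.integral j hj t ht, h'.integral j hj t ht]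
  abel

theorem zero : IsTimeChain T k (fun _ _ => (0 : X)) :=
  ⟨fun _ _ => MemLp.zero, fun _ _ _ _ => by simp⟩

theorem sum {ι : Type*} (s : Finset ι) {V : ι → ℕ → ℝ → X} (h : ∀ i, IsTimeChain T k (V i)) :
    IsTimeChain T k fun j t => ∑ i ∈ s, V i j t := by
  classical
  induction s using Finset.induction_on with
  | empty => simpa using zero
  | insert i s hi ih =>
    simp only [Finset.sum_insert hi]
    exact (h i).add ih

end IsTimeChain

/-- By Lebesgue differentiation each integrand is almost everywhere the derivative of its primitive,
and derivatives are unique. -/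
theorem ae_eq_of_primitive_eq [CompleteSpace X] {f g : ℝ → X}
    (hf : MemLp f 2 (volume.restrict (Ioo 0 T))) (hg : MemLp g 2 (volume.restrict (Ioo 0 T)))
    (h : ∀ t ∈ Icc 0 T, ∫ s in (0 : ℝ)..t, f s = ∫ s in (0 : ℝ)..t, g s) :
    f =ᵐ[volume.restrict (Ioo 0 T)] g := by
  rcases le_or_gt T 0 with hT | hT
  · rw [Ioo_eq_empty (by linarith), Measure.restrict_empty, Filter.EventuallyEq, ae_zero]
    exact eventually_bot
  have h0 : (0 : ℝ) ∈ Icc 0 T := ⟨le_rfl, hT.le⟩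
  have h1 : T ∈ Icc 0 T := ⟨hT.le, le_rfl⟩
  have hfi := intervalIntegrable_of_memLp hf h0 h1
  have hgi := intervalIntegrable_of_memLp hg h0 h1
  rw [Filter.EventuallyEq, ae_restrict_iff' measurableSet_Ioo]
  filter_upwards [hfi.ae_hasDerivAt_integral, hgi.ae_hasDerivAt_integral] with x hx hy hxm
  have hxu : x ∈ uIcc 0 T := by rw [uIcc_of_le hT.le]; exact ⟨hxm.1.le, hxm.2.le⟩
  have e1 := hx hxu 0 left_mem_uIcc
  have e2 := hy hxu 0 left_mem_uIcc
  refine e1.unique (e2.congr_of_eventuallyEq ?_)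
  filter_upwards [Ioo_mem_nhds hxm.1 hxm.2] with t ht
  exact h t ⟨ht.1.le, ht.2.le⟩

theorem eqOn_of_ae_eq {f g : ℝ → Z} (hT : 0 < T) (hf : ContinuousOn f (Icc 0 T))
    (hg : ContinuousOn g (Icc 0 T)) (h : f =ᵐ[volume.restrict (Ioo 0 T)] g) :
    EqOn f g (Icc 0 T) := by
  refine Measure.eqOn_Icc_of_ae_eq volume hT.ne ?_ hf hg
  rwa [Measure.restrict_congr_set Ioo_ae_eq_Icc] at h

/-- Induction along the chain: equality on all of [0, T] at level j gives equal primitives, hence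
almost everywhere equality at level j + 1. Below the top level the functions are continuous, so this
upgrades to equality everywhere and the induction continues. -/
theorem IsTimeChain.unique [CompleteSpace X] {U U' : ℕ → ℝ → X} (hT : 0 < T)
    (h : IsTimeChain T k U) (h' : IsTimeChain T k U') (h0 : EqOn (U 0) (U' 0) (Icc 0 T)) :
    ∀ j ≤ k, U j =ᵐ[volume.restrict (Ioo 0 T)] U' j := by
  have key : ∀ j ≤ k, (U j =ᵐ[volume.restrict (Ioo 0 T)] U' j) ∧
      (j < k → EqOn (U j) (U' j) (Icc 0 T)) := by
    intro j
    induction j with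
    | zero =>
      refine fun _ => ⟨?_, fun _ => h0⟩
      filter_upwards [ae_restrict_mem measurableSet_Ioo] with t ht
      exact h0 ⟨ht.1.le, ht.2.le⟩
    | succ j ih =>
      intro hj
      have e := (ih (by omega)).2 (by omega)
      have h1 : U (j + 1) =ᵐ[volume.restrict (Ioo 0 T)] U' (j + 1) := by
        refine ae_eq_of_primitive_eq (h.memLp _ hj) (h'.memLp _ hj) fun t ht => ?_
        have h00 : (0 : ℝ) ∈ Icc 0 T := ⟨le_rfl, hT.le⟩
        rw [← h.sub_eq (by omega) h00 ht, ← h'.sub_eq (by omega) h00 ht, e ht, e h00]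
      exact ⟨h1, fun hk => eqOn_of_ae_eq hT (h.continuousOn hk) (h'.continuousOn hk) h1⟩
  exact fun j hj => (key j hj).1

theorem HasTimeDeriv.unique [CompleteSpace X] {u g g' : ℝ → X} (hT : 0 < T)
    (h : HasTimeDeriv T k u g) (h' : HasTimeDeriv T k u g') :
    g =ᵐ[volume.restrict (Ioo 0 T)] g' := by
  obtain ⟨U, hU, h0, rfl⟩ := h.exists_chain
  obtain ⟨U', hU', h0', rfl⟩ := h'.exists_chain
  exact hU.unique hT hU' (fun t ht => (h0 t ht).trans (h0' t ht).symm) k le_rfl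

theorem MemHTime.hasTimeDeriv {u : ℝ → X} (h : MemHTime T k u) :
    HasTimeDeriv T k u (timeDeriv T k u) := by
  rw [timeDeriv, dif_pos h]
  exact h.choose_spec

/-- `timeDeriv` is an arbitrary choice; this allows its norms to be computed from any chain at hand.
-/
theorem HasTimeDeriv.timeDeriv_ae_eq [CompleteSpace X] {u g : ℝ → X} (hT : 0 < T)
    (h : HasTimeDeriv T k u g) : timeDeriv T k u =ᵐ[volume.restrict (Ioo 0 T)] g :=
  (MemHTime.hasTimeDeriv ⟨g, h⟩).unique hT h

/-! ### Norms in time -/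

theorem timeNorm_nonneg (p : ENNReal) (u : ℝ → Z) : 0 ≤ timeNorm T p u := ENNReal.toReal_nonneg

theorem timeNorm_congr {p : ENNReal} {u v : ℝ → Z} (h : u =ᵐ[volume.restrict (Ioo 0 T)] v) :
    timeNorm T p u = timeNorm T p v := by
  rw [timeNorm, timeNorm, eLpNorm_congr_ae h]

/-- `∫_0^T ‖g‖ ≤ √T ‖g‖_{L²(0, T)}`. -/
theorem integral_norm_le_timeNorm {g : ℝ → Z} (hT : 0 ≤ T)
    (hg : MemLp g 2 (volume.restrict (Ioo 0 T))) :
    ∫ s in (0 : ℝ)..T, ‖g s‖ ≤ √T * timeNorm T 2 g := by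
  have h1 : ∫ s in (0 : ℝ)..T, ‖g s‖ = (eLpNorm g 1 (volume.restrict (Ioo 0 T))).toReal := by
    rw [intervalIntegral.integral_of_le hT, integral_Ioc_eq_integral_Ioo,
      integral_norm_eq_lintegral_enorm hg.aestronglyMeasurable, eLpNorm_one_eq_lintegral_enorm]
  rw [h1]
  -- Hölder's inequality on an interval of length T; the exponent 1 - 1/2 produces the factor √T.
  have h2 := eLpNorm_le_eLpNorm_mul_rpow_measure_univ (p := 1) (q := 2) (by norm_num)
    hg.aestronglyMeasurable
  have h3 := ENNReal.toReal_mono (ENNReal.mul_ne_top hg.eLpNorm_ne_top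
    (ENNReal.rpow_ne_top_of_nonneg (by norm_num) (measure_ne_top _ _))) h2
  refine h3.trans (le_of_eq ?_)
  have h4 : (1 : ℝ) / ENNReal.toReal 1 - 1 / ENNReal.toReal 2 = 1 / 2 := by norm_num
  rw [h4, ENNReal.toReal_mul, mul_comm, ← ENNReal.toReal_rpow, timeNorm, Real.sqrt_eq_rpow]
  rw [Measure.restrict_apply_univ, Real.volume_Ioo, sub_zero, ENNReal.toReal_ofReal hT]

theorem norm_le_timeNorm_top {q : ℝ → Z} (hT : 0 < T) (hq : ContinuousOn q (Icc 0 T)) {t : ℝ}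
    (ht : t ∈ Icc 0 T) : ‖q t‖ ≤ timeNorm T ⊤ q := by
  obtain ⟨C, hC⟩ := isCompact_Icc.exists_bound_of_continuousOn hq
  have hfin : eLpNorm q ⊤ (volume.restrict (Ioo 0 T)) ≠ ⊤ := by
    refine (MemLp.eLpNorm_ne_top (memLp_top_of_bound (C := C) ?_ ?_))
    · exact (hq.mono Ioo_subset_Icc_self).aestronglyMeasurable measurableSet_Ioo
    · filter_upwards [ae_restrict_mem measurableSet_Ioo] with s hs
      exact hC s ⟨hs.1.le, hs.2.le⟩
  have hae : ∀ᵐ s ∂volume.restrict (Ioo 0 T), ‖q s‖ ≤ timeNorm T ⊤ q := by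
    filter_upwards [ae_le_eLpNormEssSup (f := q) (μ := volume.restrict (Ioo 0 T))] with s hs
    rw [← eLpNorm_exponent_top] at hs
    have := ENNReal.toReal_mono hfin hs
    simpa [timeNorm] using this
  -- An almost everywhere inequality between continuous functions is turned into an equality by
  -- taking a maximum, so that `eqOn_of_ae_eq` applies.
  have e : (fun s => max ‖q s‖ (timeNorm T ⊤ q)) =ᵐ[volume.restrict (Ioo 0 T)]
      fun _ => timeNorm T ⊤ q := by
    filter_upwards [hae] with s hs
    exact max_eq_right hs
  have := eqOn_of_ae_eq hT (hq.norm.sup continuousOn_const) continuousOn_const e ht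
  exact max_eq_right_iff.mp this

theorem timeNorm_top_le {q : ℝ → Z} {C : ℝ} (hC : 0 ≤ C) (h : ∀ t ∈ Ioo 0 T, ‖q t‖ ≤ C) :
    timeNorm T ⊤ q ≤ C := by
  refine ENNReal.toReal_le_of_le_ofReal hC ?_
  rw [eLpNorm_exponent_top]
  refine eLpNormEssSup_le_of_ae_bound ?_
  filter_upwards [ae_restrict_mem measurableSet_Ioo] with s hs using h s hs

end TimeChain

/-! ### Second differences in time -/

section SecondDifference

variable {X : Type*} [NormedAddCommGroup X] [NormedSpace ℝ X] {Z : Type*} [NormedAddCommGroup Z]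
  {T : ℝ} {k : ℕ} {U : ℕ → ℝ → X}

theorem intervalIntegrable_comp_add {f : ℝ → Z} {t s : ℝ}
    (h : IntervalIntegrable f volume t (t + s)) :
    IntervalIntegrable (fun x => f (t + x)) volume 0 s := by
  have := h.comp_add_left t
  simpa using this

theorem intervalIntegrable_comp_sub {f : ℝ → Z} {t s : ℝ}
    (h : IntervalIntegrable f volume (t - s) t) :
    IntervalIntegrable (fun x => f (t - x)) volume 0 s := by
  have := h.comp_sub_left t
  simpa using this.symm

namespace IsTimeChain

theorem symm_diff_eq (h : IsTimeChain T k U) {j : ℕ} (hj : j < k) {t s : ℝ} (hs : 0 ≤ s)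
    (h0 : 0 ≤ t - s) (h1 : t + s ≤ T) :
    U j (t + s) - U j (t - s) = ∫ x in (0 : ℝ)..s, (U (j + 1) (t + x) + U (j + 1) (t - x)) := by
  have ma : t - s ∈ Icc 0 T := ⟨h0, by linarith⟩
  have mb : t + s ∈ Icc 0 T := ⟨by linarith, h1⟩
  have mt : t ∈ Icc 0 T := ⟨by linarith, by linarith⟩
  have i1 := h.intervalIntegrable (Nat.succ_le_of_lt hj) mt mb
  have i2 := h.intervalIntegrable (Nat.succ_le_of_lt hj) ma mt
  rw [intervalIntegral.integral_add (intervalIntegrable_comp_add i1)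
    (intervalIntegrable_comp_sub i2), intervalIntegral.integral_comp_add_left (U (j + 1)),
    intervalIntegral.integral_comp_sub_left (U (j + 1))]
  rw [add_zero, sub_zero, ← h.sub_eq hj mt mb, ← h.sub_eq hj ma mt]
  abel

/-- The two one-sided increments are folded onto the same interval [0, s]; their difference is a
symmetric increment of the next derivative. -/
theorem second_diff_eq (h : IsTimeChain T k U) {j : ℕ} (hj : j < k) {t s : ℝ} (hs : 0 ≤ s)
    (h0 : 0 ≤ t - s) (h1 : t + s ≤ T) :
    U j (t + s) - (2 : ℝ) • U j t + U j (t - s) =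
      ∫ x in (0 : ℝ)..s, (U (j + 1) (t + x) - U (j + 1) (t - x)) := by
  have ma : t - s ∈ Icc 0 T := ⟨h0, by linarith⟩
  have mb : t + s ∈ Icc 0 T := ⟨by linarith, h1⟩
  have mt : t ∈ Icc 0 T := ⟨by linarith, by linarith⟩
  have i1 := h.intervalIntegrable (Nat.succ_le_of_lt hj) mt mb
  have i2 := h.intervalIntegrable (Nat.succ_le_of_lt hj) ma mt
  rw [intervalIntegral.integral_sub (intervalIntegrable_comp_add i1)
    (intervalIntegrable_comp_sub i2), intervalIntegral.integral_comp_add_left (U (j + 1)),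
    intervalIntegral.integral_comp_sub_left (U (j + 1))]
  rw [add_zero, sub_zero, ← h.sub_eq hj mt mb, ← h.sub_eq hj ma mt, two_smul]
  abel

theorem norm_sub_le_integral (h : IsTimeChain T k U) {j : ℕ} (hj : j < k) {a b : ℝ}
    (ha : 0 ≤ a) (hab : a ≤ b) (hb : b ≤ T) :
    ‖U j b - U j a‖ ≤ ∫ s in a..b, ‖U (j + 1) s‖ := by
  rw [h.sub_eq hj ⟨ha, hab.trans hb⟩ ⟨ha.trans hab, hb⟩]
  exact intervalIntegral.norm_integral_le_integral_norm hab

theorem integral_norm_mono (h : IsTimeChain T k U) {j : ℕ} (hj : j ≤ k) {a b a' b' : ℝ}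
    (ha' : 0 ≤ a') (ha : a' ≤ a) (hab : a ≤ b) (hb : b ≤ b') (hb' : b' ≤ T) :
    ∫ s in a..b, ‖U j s‖ ≤ ∫ s in a'..b', ‖U j s‖ := by
  refine intervalIntegral.integral_mono_interval ha hab hb ?_ ?_
  · exact Eventually.of_forall fun s => norm_nonneg _
  · exact (h.intervalIntegrable hj ⟨ha', by linarith⟩ ⟨by linarith, hb'⟩).norm

/-- After folding, the integrand is an increment of `U (j + 1)` inside the window. The window has
radius τ rather than s, so that a single bound serves all s ≤ τ. -/
theorem norm_second_diff_le (h : IsTimeChain T k U) {j : ℕ} (hj : j + 1 < k) {t s τ : ℝ}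
    (hs : 0 ≤ s) (hsτ : s ≤ τ) (h0 : 0 ≤ t - τ) (h1 : t + τ ≤ T) :
    ‖U j (t + s) - (2 : ℝ) • U j t + U j (t - s)‖ ≤
      s * ∫ x in (t - τ)..(t + τ), ‖U (j + 2) x‖ := by
  rw [h.second_diff_eq (by omega) hs (by linarith) (by linarith)]
  have := intervalIntegral.norm_integral_le_of_norm_le_const (a := 0) (b := s)
    (f := fun x => U (j + 1) (t + x) - U (j + 1) (t - x))
    (C := ∫ x in (t - τ)..(t + τ), ‖U (j + 2) x‖) ?_
  · rwa [sub_zero, abs_of_nonneg hs, mul_comm] at this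
  · intro x hx
    rw [uIoc_of_le hs] at hx
    refine (h.norm_sub_le_integral hj (by linarith [hx.2]) (by linarith [hx.1]) (by
      linarith [hx.2])).trans ?_
    exact h.integral_norm_mono (by omega) h0 (by linarith [hx.2]) (by linarith [hx.1])
      (by linarith [hx.2]) h1

/-- A central difference `δ²U_j` approximates `s² U_{j+2}` up to the second differences of
`U_{j+2}`. -/
theorem norm_second_diff_sub_le [CompleteSpace X] (h : IsTimeChain T k U) {j : ℕ}
    (hj : j + 1 < k) {t τ K : ℝ}
    (hτ : 0 ≤ τ) (h0 : 0 ≤ t - τ) (h1 : t + τ ≤ T)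
    (hK : ∀ r ∈ Ioc 0 τ, ‖U (j + 2) (t + r) - (2 : ℝ) • U (j + 2) t + U (j + 2) (t - r)‖ ≤ K) :
    ‖U j (t + τ) - (2 : ℝ) • U j t + U j (t - τ) - τ ^ 2 • U (j + 2) t‖ ≤ τ ^ 2 * K := by
  -- For τ = 0 the hypothesis on K is vacuous and gives no sign for K, but the left side vanishes.
  rcases hτ.eq_or_lt with rfl | hτ
  · simp [two_smul]
  have hK0 : 0 ≤ K := (norm_nonneg _).trans (hK τ ⟨hτ, le_rfl⟩)
  set c := U (j + 2) t with hc
  have mt : t ∈ Icc 0 T := ⟨by linarith, by linarith⟩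
  -- Two integrations of the second difference of `U (j + 2)`. The first compares the symmetric
  -- increment of `U (j + 1)` with its linear part 2x c.
  have inner : ∀ x ∈ Ioc 0 τ,
      ‖U (j + 1) (t + x) - U (j + 1) (t - x) - (2 * x) • c‖ ≤ τ * K := by
    intro x hx
    have ma : t - x ∈ Icc 0 T := ⟨by linarith [hx.2], by linarith [hx.1]⟩
    have mb : t + x ∈ Icc 0 T := ⟨by linarith [hx.1], by linarith [hx.2]⟩
    have e1 : (2 * x) • c = ∫ _ in (0 : ℝ)..x, (2 : ℝ) • c := by
      rw [intervalIntegral.integral_const, smul_smul, sub_zero, mul_comm]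
    rw [h.symm_diff_eq hj hx.1.le ma.1 mb.2, e1,
      ← intervalIntegral.integral_sub
        ((intervalIntegrable_comp_add (h.intervalIntegrable (by omega) mt mb)).add
          (intervalIntegrable_comp_sub (h.intervalIntegrable (by omega) ma mt)))
        intervalIntegrable_const]
    have := intervalIntegral.norm_integral_le_of_norm_le_const (a := 0) (b := x)
      (f := fun r => U (j + 2) (t + r) + U (j + 2) (t - r) - (2 : ℝ) • c) (C := K) ?_
    · refine this.trans ?_
      rw [sub_zero, abs_of_pos hx.1, mul_comm]
      gcongr
      exact hx.2
    · intro r hr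
      rw [uIoc_of_le hx.1.le] at hr
      refine le_of_eq_of_le ?_ (hK r ⟨hr.1, hr.2.trans hx.2⟩)
      congr 1
      abel
  have ma : t - τ ∈ Icc 0 T := ⟨h0, by linarith⟩
  have mb : t + τ ∈ Icc 0 T := ⟨by linarith, h1⟩
  -- The second integration: τ² is the integral of 2x over [0, τ].
  have e2 : τ ^ 2 • c = ∫ x in (0 : ℝ)..τ, (2 * x) • c := by
    rw [intervalIntegral.integral_smul_const, intervalIntegral.integral_const_mul, integral_id]
    congr 1
    ring
  rw [h.second_diff_eq (by omega) hτ.le h0 h1, e2, ← intervalIntegral.integral_sub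
    ((intervalIntegrable_comp_add (h.intervalIntegrable (by omega) mt mb)).sub
      (intervalIntegrable_comp_sub (h.intervalIntegrable (by omega) ma mt)))
    (Continuous.intervalIntegrable (by fun_prop) _ _)]
  have := intervalIntegral.norm_integral_le_of_norm_le_const (a := 0) (b := τ)
    (f := fun x => U (j + 1) (t + x) - U (j + 1) (t - x) - (2 * x) • c) (C := τ * K) ?_
  · refine this.trans (le_of_eq ?_)
    rw [sub_zero, abs_of_pos hτ]
    ring
  · intro x hx
    rw [uIoc_of_le hτ.le] at hx
    exact inner x hx

theorem integral_norm_le (h : IsTimeChain T k U) {j : ℕ} (hj : j ≤ k) (hT : 0 ≤ T) :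
    ∫ s in (0 : ℝ)..T, ‖U j s‖ ≤ √T * timeNorm T 2 (U j) :=
  integral_norm_le_timeNorm hT (h.memLp j hj)

end IsTimeChain

/-! ### Sums over the time grid -/

theorem grid_mem {M m : ℕ} (hT : 0 ≤ T) (hM : 0 < M) (hm : m ≤ M) :
    (m : ℝ) * (T / M) ∈ Icc 0 T := by
  have hM' : (0 : ℝ) < M := by exact_mod_cast hM
  refine ⟨by positivity, ?_⟩
  rw [mul_div_left_comm]
  refine mul_le_of_le_one_right hT ?_
  rw [div_le_one hM']
  exact_mod_cast hm

/-- A window of radius one step about a grid point consists of two adjacent grid cells, so every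
cell is counted at most twice. -/
theorem sum_grid_integral_le {h : ℝ → ℝ} (hT : 0 ≤ T) {M : ℕ} (hM : 0 < M)
    (hi : IntervalIntegrable h volume 0 T) (hpos : ∀ s, 0 ≤ h s) :
    ∑ m ∈ Finset.Ico 1 M,
      ∫ s in ((m : ℝ) * (T / M) - T / M)..((m : ℝ) * (T / M) + T / M), h s ≤
        2 * ∫ s in (0 : ℝ)..T, h s := by
  have hM' : (M : ℝ) ≠ 0 := by exact_mod_cast hM.ne'
  set τ := T / (M : ℝ) with hτ
  have hint : ∀ i j : ℕ, i ≤ M → j ≤ M → IntervalIntegrable h volume (i * τ) (j * τ) := by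
    intro i j hi' hj'
    refine hi.mono_set ?_
    rw [uIcc_of_le hT]
    exact uIcc_subset_Icc (grid_mem hT hM hi') (grid_mem hT hM hj')
  have hsum : ∑ m ∈ Finset.range M, ∫ s in ((m : ℝ) * τ)..(((m + 1 : ℕ) : ℝ) * τ), h s =
      ∫ s in (0 : ℝ)..T, h s := by
    rw [intervalIntegral.sum_integral_adjacent_intervals (a := fun m : ℕ => (m : ℝ) * τ)
      fun m hm => hint m (m + 1) hm.le hm]
    rw [hτ, mul_div_cancel₀ _ hM']
    simp
  have hnn : ∀ m : ℕ, 0 ≤ ∫ s in ((m : ℝ) * τ)..(((m + 1 : ℕ) : ℝ) * τ), h s := by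
    intro m
    refine intervalIntegral.integral_nonneg ?_ fun s _ => hpos s
    have : 0 ≤ τ := by positivity
    gcongr
    simp
  have hsplit : ∀ m ∈ Finset.Ico 1 M, ∫ s in ((m : ℝ) * τ - τ)..((m : ℝ) * τ + τ), h s =
      (∫ s in (((m - 1 : ℕ) : ℝ) * τ)..(((m - 1 + 1 : ℕ) : ℝ) * τ), h s) +
        ∫ s in ((m : ℝ) * τ)..(((m + 1 : ℕ) : ℝ) * τ), h s := by
    intro m hm
    rw [Finset.mem_Ico] at hm
    obtain ⟨l, rfl⟩ : ∃ l, m = l + 1 := ⟨m - 1, by omega⟩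
    rw [Nat.add_sub_cancel, intervalIntegral.integral_add_adjacent_intervals
      (hint _ _ (by omega) (by omega)) (hint _ _ (by omega) (by omega))]
    congr 1 <;> push_cast <;> ring
  rw [Finset.sum_congr rfl hsplit, Finset.sum_add_distrib, two_mul]
  refine add_le_add ?_ ?_
  · rw [← hsum, Finset.sum_Ico_eq_sum_range]
    simp only [Nat.add_sub_cancel_left]
    exact Finset.sum_le_sum_of_subset_of_nonneg (Finset.range_subset_range.2 (by omega))
      fun i _ _ => hnn i
  · rw [← hsum]
    refine Finset.sum_le_sum_of_subset_of_nonneg ?_ fun i _ _ => hnn i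
    intro i hi
    simp only [Finset.mem_Ico, Finset.mem_range] at hi ⊢
    omega

end SecondDifference

/-! ### The discrete energy estimate -/

section Energy

/-- A symmetric bilinear form, coercive with constant `α` and bounded by `β`. -/
structure IsEnergyForm {K : Type*} [NormedAddCommGroup K] [NormedSpace ℝ K] (α β : ℝ)
    (b : K →ₗ[ℝ] K →ₗ[ℝ] ℝ) : Prop where
  symm : ∀ x y, b x y = b y x
  coercive : ∀ x, α * ‖x‖ ^ 2 ≤ b x x
  bounded : ∀ x y, b x y ≤ β * ‖x‖ * ‖y‖

variable {K₁ : Type*} [NormedAddCommGroup K₁] [NormedSpace ℝ K₁]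
  {K₂ : Type*} [NormedAddCommGroup K₂] [NormedSpace ℝ K₂] {α β : ℝ}
  {b : K₁ →ₗ[ℝ] K₁ →ₗ[ℝ] ℝ} {a : K₂ →ₗ[ℝ] K₂ →ₗ[ℝ] ℝ}

/-- The discrete energy `b(∂_t x_{m+1/2}, ∂_t x_{m+1/2}) + a(y_{m+1/2}, y_{m+1/2})`. -/
noncomputable def stepEnergy (b : K₁ →ₗ[ℝ] K₁ →ₗ[ℝ] ℝ) (a : K₂ →ₗ[ℝ] K₂ →ₗ[ℝ] ℝ) (τ : ℝ)
    (x : ℕ → K₁) (y : ℕ → K₂) (m : ℕ) : ℝ :=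
  b (dt τ x m) (dt τ x m) + a (half y m) (half y m)

/-- Two differences of squares. The 1/4-average is half the sum of consecutive half-step values, and
the central difference is twice their difference. Likewise, `dt2` is the difference of consecutive
`dt` divided by τ, and the central difference is τ times their sum. Symmetry of the forms cancels
the cross terms. -/
theorem stepEnergy_sub (hb : ∀ x y, b x y = b y x) (ha : ∀ x y, a x y = a y x) {τ : ℝ}
    (hτ : 0 < τ) (x : ℕ → K₁) (y : ℕ → K₂) (m : ℕ) :
    stepEnergy b a τ x y (m + 1) - stepEnergy b a τ x y m =
      b (dt2 τ x (m + 1)) (x (m + 1 + 1) - x m) +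
        a (avg (1 / 4) y (m + 1)) (y (m + 1 + 1) - y m) := by
  simp only [stepEnergy, dt, half, dt2, avg, Nat.add_sub_cancel, map_sub, map_add, map_smul,
    LinearMap.add_apply, LinearMap.sub_apply, LinearMap.smul_apply, smul_eq_mul]
  rw [hb (x m) (x (m + 1)), hb (x (m + 1 + 1)) (x (m + 1)), hb (x (m + 1 + 1)) (x m),
    ha (y m) (y (m + 1)), ha (y (m + 1 + 1)) (y (m + 1)), ha (y (m + 1 + 1)) (y m)]
  field_simp
  ring

theorem dt_add_dt {τ : ℝ} (hτ : 0 < τ) (x : ℕ → K₁) (m : ℕ) :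
    x (m + 1 + 1) - x m = τ • (dt τ x (m + 1) + dt τ x m) := by
  rw [dt, dt, ← smul_add, smul_smul, mul_inv_cancel₀ hτ.ne', one_smul]
  abel

/-- The increments of the energy are linear in `dt τ x`, that is, of the order of the square root of
the energy. Bounding that factor by its value at the step of maximal energy and dividing by it
replaces a Gronwall argument. -/
theorem discrete_energy_estimate (hα : 0 < α) (hβ : 0 < β) (hb : IsEnergyForm α β b)
    (ha : IsEnergyForm α β a) {τ : ℝ} (hτ : 0 < τ) {x : ℕ → K₁} {y : ℕ → K₂} {ρ : ℕ → K₁} {M : ℕ}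
    (h : ∀ m, 1 ≤ m → m < M →
      b (dt2 τ x m) (x (m + 1) - x (m - 1)) + a (avg (1 / 4) y m) (y (m + 1) - y (m - 1)) =
        b (ρ m) (x (m + 1) - x (m - 1))) :
    ∀ m < M, √α * ‖dt τ x m‖ ≤ √β * (‖dt τ x 0‖ + ‖half y 0‖) +
          2 * β / √α * (τ * ∑ j ∈ Finset.Ico 1 M, ‖ρ j‖) ∧
      √α * ‖half y m‖ ≤ √β * (‖dt τ x 0‖ + ‖half y 0‖) +
          2 * β / √α * (τ * ∑ j ∈ Finset.Ico 1 M, ‖ρ j‖) := by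
  set N := stepEnergy b a τ x y with hN
  have hsα : 0 < √α := Real.sqrt_pos.2 hα
  have hNnn : ∀ m, 0 ≤ N m := fun m => add_nonneg
    ((by positivity : 0 ≤ α * ‖dt τ x m‖ ^ 2).trans (hb.coercive _))
    ((by positivity : 0 ≤ α * ‖half y m‖ ^ 2).trans (ha.coercive _))
  have hN1 : ∀ m, √α * ‖dt τ x m‖ ≤ √(N m) := fun m => by
    rw [← Real.sqrt_sq (norm_nonneg (dt τ x m)), ← Real.sqrt_mul hα.le]
    refine Real.sqrt_le_sqrt ?_
    have h1 := hb.coercive (dt τ x m)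
    have h2 := ha.coercive (half y m)
    have h3 : 0 ≤ α * ‖half y m‖ ^ 2 := by positivity
    simp only [hN, stepEnergy]
    linarith
  have hN2 : ∀ m, √α * ‖half y m‖ ≤ √(N m) := fun m => by
    rw [← Real.sqrt_sq (norm_nonneg (half y m)), ← Real.sqrt_mul hα.le]
    refine Real.sqrt_le_sqrt ?_
    have h1 := hb.coercive (dt τ x m)
    have h2 := ha.coercive (half y m)
    have h3 : 0 ≤ α * ‖dt τ x m‖ ^ 2 := by positivity
    simp only [hN, stepEnergy]
    linarith
  have hN0 : √(N 0) ≤ √β * (‖dt τ x 0‖ + ‖half y 0‖) := by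
    rw [← Real.sqrt_sq (by positivity : 0 ≤ ‖dt τ x 0‖ + ‖half y 0‖), ← Real.sqrt_mul hβ.le]
    refine Real.sqrt_le_sqrt ?_
    have h1 := hb.bounded (dt τ x 0) (dt τ x 0)
    have h2 := ha.bounded (half y 0) (half y 0)
    have h3 : 0 ≤ β * (‖dt τ x 0‖ * ‖half y 0‖) := by positivity
    simp only [hN, stepEnergy]
    nlinarith
  intro m hm
  -- The step of maximal energy.
  obtain ⟨l, hl, hlmax⟩ := Finset.exists_max_image (Finset.range M) N ⟨m, Finset.mem_range.2 hm⟩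
  rw [Finset.mem_range] at hl
  set R := τ * ∑ j ∈ Finset.Ico 1 M, ‖ρ j‖ with hR
  have hRnn : 0 ≤ R := by positivity
  have hδ : ∀ j < M, ‖dt τ x j‖ ≤ √(N l) / √α := fun j hj => by
    rw [le_div_iff₀ hsα, mul_comm]
    exact (hN1 j).trans (Real.sqrt_le_sqrt (hlmax j (Finset.mem_range.2 hj)))
  have step : ∀ j, j + 1 < M →
      -- The factor 2 comes from the two difference quotients making up the central difference, each
      -- at most √(N l) / √α.
      N (j + 1) - N j ≤ 2 * β / √α * √(N l) * (τ * ‖ρ (j + 1)‖) := by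
    intro j hj
    have e := h (j + 1) (by omega) hj
    rw [Nat.add_sub_cancel] at e
    rw [hN, stepEnergy_sub hb.symm ha.symm hτ, e, dt_add_dt hτ, map_smul, smul_eq_mul]
    calc τ * b (ρ (j + 1)) (dt τ x (j + 1) + dt τ x j)
        ≤ τ * (β * ‖ρ (j + 1)‖ * (√(N l) / √α + √(N l) / √α)) := by
          gcongr
          refine (hb.bounded _ _).trans ?_
          gcongr
          exact (norm_add_le _ _).trans (add_le_add (hδ _ hj) (hδ _ (by omega)))
      _ = _ := by ring
  have tele : ∀ j < M,
      N j ≤ N 0 + 2 * β / √α * √(N l) * (τ * ∑ i ∈ Finset.Ico 1 (j + 1), ‖ρ i‖) := by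
    intro j
    induction j with
    | zero => simp
    | succ j ih =>
      intro hj
      have h1 := ih (by omega)
      have h2 := step j hj
      rw [Finset.sum_Ico_succ_top (by omega)]
      linarith
  -- By maximality N 0 ≤ √(N 0) √(N l), so both terms on the right contain √(N l), which is divided
  -- out.
  have hmain : √(N l) ≤ √(N 0) + 2 * β / √α * R := by
    have h1 : N l ≤ N 0 + 2 * β / √α * √(N l) * R := by
      refine (tele l hl).trans ?_
      rw [hR]
      gcongr
      exact hl
    rcases (hNnn l).eq_or_lt with h0 | h0
    · rw [← h0, Real.sqrt_zero]
      positivity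
    · have h2 : 0 < √(N l) := Real.sqrt_pos.2 h0
      have h3 : √(N 0) ≤ √(N l) :=
        Real.sqrt_le_sqrt (hlmax 0 (Finset.mem_range.2 (by omega)))
      have h4 := Real.mul_self_sqrt (hNnn l)
      have h5 := Real.mul_self_sqrt (hNnn 0)
      have h6 : √(N 0) * √(N 0) ≤ √(N 0) * √(N l) := by gcongr
      refine le_of_mul_le_mul_right ?_ h2
      linarith
  have hfin : √(N m) ≤ √β * (‖dt τ x 0‖ + ‖half y 0‖) + 2 * β / √α * R :=
    (Real.sqrt_le_sqrt (hlmax m (Finset.mem_range.2 hm))).trans (by linarith)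
  exact ⟨(hN1 m).trans hfin, (hN2 m).trans hfin⟩

end Energy

/-! ### Consistency of the time discretization -/

section Consistency

variable {X : Type*} [NormedAddCommGroup X] [NormedSpace ℝ X] {T : ℝ} {k : ℕ} {U : ℕ → ℝ → X}

theorem grid_bounds {M m : ℕ} (hT : 0 ≤ T) (h1 : 1 ≤ m) (h2 : m < M) :
    0 ≤ (m : ℝ) * (T / M) - T / M ∧ (m : ℝ) * (T / M) + T / M ≤ T := by
  have hM : 0 < M := by omega
  have e1 := (grid_mem hT hM (by omega : m - 1 ≤ M)).1
  have e2 := (grid_mem hT hM (by omega : m + 1 ≤ M)).2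
  rw [Nat.cast_sub h1] at e1
  push_cast at e1 e2
  constructor <;> linarith

theorem dt2_grid (τ : ℝ) (f : ℝ → X) {m : ℕ} (hm : 1 ≤ m) :
    dt2 τ (fun j => f (j * τ)) m =
      (τ ^ 2)⁻¹ • (f (m * τ + τ) - (2 : ℝ) • f (m * τ) + f (m * τ - τ)) := by
  obtain ⟨l, rfl⟩ : ∃ l, m = l + 1 := ⟨m - 1, by omega⟩
  simp only [dt2, Nat.add_sub_cancel]
  congr 6 <;> push_cast <;> ring

theorem avg_grid (τ : ℝ) (f : ℝ → X) {m : ℕ} (hm : 1 ≤ m) :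
    avg (1 / 4) (fun j => f (j * τ)) m =
      f (m * τ) + (1 / 4 : ℝ) • (f (m * τ + τ) - (2 : ℝ) • f (m * τ) + f (m * τ - τ)) := by
  obtain ⟨l, rfl⟩ : ∃ l, m = l + 1 := ⟨m - 1, by omega⟩
  simp only [avg, Nat.add_sub_cancel]
  rw [show ((l + 1 + 1 : ℕ) : ℝ) * τ = ((l + 1 : ℕ) : ℝ) * τ + τ by push_cast; ring,
    show (l : ℝ) * τ = ((l + 1 : ℕ) : ℝ) * τ - τ by push_cast; ring]
  module

theorem norm_avg_le {r : ℕ → X} {C : ℝ} {m : ℕ} (h : ∀ j ≤ m + 1, ‖r j‖ ≤ C) :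
    ‖avg (1 / 4) r m‖ ≤ C := by
  have h1 := h (m + 1) le_rfl
  have h2 := h m (by omega)
  have h3 := h (m - 1) (by omega)
  rw [avg]
  refine norm_add₃_le.trans ?_
  rw [norm_smul, norm_smul, norm_smul]
  norm_num
  linarith

/-- `Δt ∑ ‖∂_t² q_m‖` for `q ∈ H²(0, T)`. -/
theorem IsTimeChain.sum_dt2_le (h : IsTimeChain T k U) (hk : 2 ≤ k) (hT : 0 < T) {M : ℕ}
    (hM : 0 < M) :
    T / M * ∑ m ∈ Finset.Ico 1 M, ‖dt2 (T / M) (fun j => U 0 (j * (T / M))) m‖ ≤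
      2 * (√T * timeNorm T 2 (U 2)) := by
  have hM' : (0 : ℝ) < M := by exact_mod_cast hM
  have hτ : 0 < T / (M : ℝ) := by positivity
  have h0 : (0 : ℝ) ∈ Icc 0 T := ⟨le_rfl, hT.le⟩
  have h1 : T ∈ Icc 0 T := ⟨hT.le, le_rfl⟩
  rw [Finset.mul_sum]
  refine le_trans (Finset.sum_le_sum fun m hm => ?_)
    ((sum_grid_integral_le hT.le hM (h.intervalIntegrable (j := 2) hk h0 h1).norm
      fun _ => norm_nonneg _).trans (by gcongr; exact h.integral_norm_le hk hT.le))
  rw [Finset.mem_Ico] at hm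
  obtain ⟨b0, b1⟩ := grid_bounds hT.le hm.1 hm.2
  rw [dt2_grid _ _ hm.1, norm_smul, Real.norm_of_nonneg (by positivity)]
  have := h.norm_second_diff_le (j := 0) (by omega) hτ.le le_rfl b0 b1
  -- The powers of the step cancel exactly: one from the sum, one from the second difference, and
  -- τ⁻² from the quotient.
  refine (mul_le_mul_of_nonneg_left (mul_le_mul_of_nonneg_left this (by positivity)) hτ.le).trans
    (le_of_eq ?_)
  field_simp

/-- The average exceeds the midpoint value by a quarter of the second difference of `U 2`, and the
quotient `dt2` of `U 0` differs from that midpoint value by at most K. Together this gives 5K/4,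
rounded up to 2K. Both orders of convergence follow by inserting different bounds K. -/
theorem norm_avg_sub_dt2_le [CompleteSpace X] (h : IsTimeChain T k U) (hk : 2 ≤ k) (hT : 0 < T)
    {M m : ℕ} (h1 : 1 ≤ m) (h2 : m < M) {K : ℝ}
    (hK : ∀ r ∈ Ioc 0 (T / M), ‖U 2 (m * (T / M) + r) - (2 : ℝ) • U 2 (m * (T / M))
      + U 2 (m * (T / M) - r)‖ ≤ K) :
    ‖avg (1 / 4) (fun j => U 2 (j * (T / M))) m - dt2 (T / M) (fun j => U 0 (j * (T / M))) m‖ ≤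
      2 * K := by
  have hM' : (0 : ℝ) < M := by exact_mod_cast (by omega : 0 < M)
  have hτ : 0 < T / (M : ℝ) := by positivity
  obtain ⟨b0, b1⟩ := grid_bounds hT.le h1 h2
  have e1 := h.norm_second_diff_sub_le (j := 0) (by omega) hτ.le b0 b1 hK
  have e2 := hK _ ⟨hτ, le_rfl⟩
  rw [avg_grid _ _ h1, dt2_grid _ _ h1]
  set τ := T / (M : ℝ)
  set t := (m : ℝ) * τ
  have e3 : U 2 t + (1 / 4 : ℝ) • (U 2 (t + τ) - (2 : ℝ) • U 2 t + U 2 (t - τ)) -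
      (τ ^ 2)⁻¹ • (U 0 (t + τ) - (2 : ℝ) • U 0 t + U 0 (t - τ)) =
      (1 / 4 : ℝ) • (U 2 (t + τ) - (2 : ℝ) • U 2 t + U 2 (t - τ)) -
      (τ ^ 2)⁻¹ • (U 0 (t + τ) - (2 : ℝ) • U 0 t + U 0 (t - τ) - τ ^ 2 • U 2 t) := by
    rw [smul_sub (τ ^ 2)⁻¹ _ (τ ^ 2 • U 2 t), smul_smul, inv_mul_cancel₀ (by positivity), one_smul]
    abel
  rw [e3]
  refine (norm_sub_le _ _).trans ?_
  rw [norm_smul, norm_smul, Real.norm_of_nonneg (by positivity : (0 : ℝ) ≤ 1 / 4),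
    Real.norm_of_nonneg (by positivity : (0 : ℝ) ≤ (τ ^ 2)⁻¹)]
  have e4 : (τ ^ 2)⁻¹ * ‖U 0 (t + τ) - (2 : ℝ) • U 0 t + U 0 (t - τ) - τ ^ 2 • U 2 t‖ ≤ K := by
    rw [inv_mul_le_iff₀ (by positivity)]
    exact e1
  linarith [norm_nonneg (U 2 (t + τ) - (2 : ℝ) • U 2 t + U 2 (t - τ))]

/-- The consistency error of the scheme is of first order for `u ∈ H³(0, T)`. -/
theorem IsTimeChain.sum_consistency_le_one [CompleteSpace X] (h : IsTimeChain T k U) (hk : 3 ≤ k)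
    (hT : 0 < T) {M : ℕ} (hM : 0 < M) :
    T / M * ∑ m ∈ Finset.Ico 1 M,
      ‖avg (1 / 4) (fun j => U 2 (j * (T / M))) m
        - dt2 (T / M) (fun j => U 0 (j * (T / M))) m‖ ≤
      4 * √T * (T / M * timeNorm T 2 (U 3)) := by
  have hM' : (0 : ℝ) < M := by exact_mod_cast hM
  have hτ : 0 < T / (M : ℝ) := by positivity
  have h0 : (0 : ℝ) ∈ Icc 0 T := ⟨le_rfl, hT.le⟩
  have h1 : T ∈ Icc 0 T := ⟨hT.le, le_rfl⟩
  have key : ∀ m ∈ Finset.Ico 1 M, ‖avg (1 / 4) (fun j => U 2 (j * (T / M))) m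
        - dt2 (T / M) (fun j => U 0 (j * (T / M))) m‖ ≤
      2 * ∫ s in ((m : ℝ) * (T / M) - T / M)..((m : ℝ) * (T / M) + T / M), ‖U 3 s‖ := by
    intro m hm
    rw [Finset.mem_Ico] at hm
    obtain ⟨b0, b1⟩ := grid_bounds hT.le hm.1 hm.2
    refine norm_avg_sub_dt2_le h (by omega) hT hm.1 hm.2 fun r hr => ?_
    set t := (m : ℝ) * (T / M)
    have mt : t ∈ Icc 0 T := ⟨by linarith, by linarith⟩
    have mp : t + r ∈ Icc 0 T := ⟨by linarith [hr.1], by linarith [hr.2]⟩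
    have mm : t - r ∈ Icc 0 T := ⟨by linarith [hr.2], by linarith [hr.1]⟩
    -- With only three derivatives the second difference is estimated as two first differences. No
    -- power of the step is gained here; the single power in the result is the factor in front of
    -- the sum.
    have e : U 2 (t + r) - (2 : ℝ) • U 2 t + U 2 (t - r) =
        (U 2 (t + r) - U 2 t) - (U 2 t - U 2 (t - r)) := by
      rw [two_smul]
      abel
    rw [e]
    refine (norm_sub_le _ _).trans ((add_le_add
      (h.norm_sub_le_integral (j := 2) (by omega) mt.1 (by linarith [hr.1]) mp.2)
      (h.norm_sub_le_integral (j := 2) (by omega) mm.1 (by linarith [hr.1]) mt.2)).trans ?_)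
    rw [add_comm, intervalIntegral.integral_add_adjacent_intervals
      (h.intervalIntegrable (j := 3) hk mm mt).norm (h.intervalIntegrable (j := 3) hk mt mp).norm]
    exact h.integral_norm_mono (j := 3) hk b0 (by linarith [hr.2]) (by linarith [hr.1])
      (by linarith [hr.2]) b1
  have h2 := sum_grid_integral_le hT.le hM (h.intervalIntegrable (j := 3) hk h0 h1).norm
    fun _ => norm_nonneg _
  have h3 := h.integral_norm_le (j := 3) hk hT.le
  have h4 := Finset.sum_le_sum key
  rw [← Finset.mul_sum] at h4
  calc _ ≤ T / M * (2 * (2 * (√T * timeNorm T 2 (U 3)))) := by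
        gcongr
        linarith
    _ = _ := by ring

/-- The consistency error of the scheme is of second order for `u ∈ H⁴(0, T)`. -/
theorem IsTimeChain.sum_consistency_le_two [CompleteSpace X] (h : IsTimeChain T k U) (hk : 4 ≤ k)
    (hT : 0 < T) {M : ℕ} (hM : 0 < M) :
    T / M * ∑ m ∈ Finset.Ico 1 M,
      ‖avg (1 / 4) (fun j => U 2 (j * (T / M))) m
        - dt2 (T / M) (fun j => U 0 (j * (T / M))) m‖ ≤
      4 * √T * ((T / M) ^ 2 * timeNorm T 2 (U 4)) := by
  have hM' : (0 : ℝ) < M := by exact_mod_cast hM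
  have hτ : 0 < T / (M : ℝ) := by positivity
  have h0 : (0 : ℝ) ∈ Icc 0 T := ⟨le_rfl, hT.le⟩
  have h1 : T ∈ Icc 0 T := ⟨hT.le, le_rfl⟩
  have key : ∀ m ∈ Finset.Ico 1 M, ‖avg (1 / 4) (fun j => U 2 (j * (T / M))) m
        - dt2 (T / M) (fun j => U 0 (j * (T / M))) m‖ ≤
      2 * (T / M * ∫ s in ((m : ℝ) * (T / M) - T / M)..((m : ℝ) * (T / M) + T / M), ‖U 4 s‖) := by
    intro m hm
    rw [Finset.mem_Ico] at hm
    obtain ⟨b0, b1⟩ := grid_bounds hT.le hm.1 hm.2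
    refine norm_avg_sub_dt2_le h (by omega) hT hm.1 hm.2 fun r hr => ?_
    -- The fourth derivative allows a genuine second-difference bound, whose factor r ≤ τ supplies
    -- the additional power of the step.
    refine (h.norm_second_diff_le (j := 2) (by omega) hr.1.le hr.2 b0 b1).trans ?_
    refine mul_le_mul_of_nonneg_right hr.2 (intervalIntegral.integral_nonneg (by linarith)
      fun _ _ => norm_nonneg _)
  have h2 := sum_grid_integral_le hT.le hM (h.intervalIntegrable (j := 4) hk h0 h1).norm
    fun _ => norm_nonneg _
  have h3 := h.integral_norm_le (j := 4) hk hT.le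
  have h4 := Finset.sum_le_sum key
  rw [← Finset.mul_sum, ← Finset.mul_sum] at h4
  calc _ ≤ T / M * (2 * (T / M * (2 * (√T * timeNorm T 2 (U 4))))) := by
        gcongr
        refine h4.trans ?_
        gcongr
        linarith
    _ = _ := by ring

end Consistency

/-! ### Sums of functions of the successive scales -/

section Scales

variable {d : ℕ} {D : Set (Sp d)} {n r : ℕ}

/-- The projection `(x, y_1, …, y_n) ↦ (x, y_1, …, y_k)`, for `k ≤ n`. -/
def truncLE {k : ℕ} (hk : k ≤ n) (z : Fin (n + 1) → Sp d) : Fin (k + 1) → Sp d :=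
  fun j => z ⟨j, by omega⟩

/-- The cells have measure one, so fast variables can be dropped one at a time. This is what makes
the embeddings of coarser scales isometric. -/
theorem measurePreserving_truncLE (D : Set (Sp d)) {k : ℕ} (hk : k ≤ n) :
    MeasurePreserving (truncLE hk) (cellMeasure d D n) (cellMeasure d D k) := by
  induction n, hk using Nat.le_induction with
  | base => exact MeasurePreserving.id _
  | succ n hk ih => exact ih.comp (measurePreserving_init d D n)

theorem measurePreserving_eval_zero (D : Set (Sp d)) :
    MeasurePreserving (fun z : Fin (n + 1) → Sp d => z 0) (cellMeasure d D n)
      (volume.restrict D) := by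
  have h0 : MeasurePreserving (fun z : Fin (0 + 1) → Sp d => z 0) (cellMeasure d D 0)
      (volume.restrict D) := by
    have h := (volume_preserving_funUnique (Fin 1) (Sp d)).restrict_preimage_emb
      (MeasurableEquiv.measurableEmbedding _) D
    have e : (MeasurableEquiv.funUnique (Fin 1) (Sp d)) ⁻¹' D = cellDomain d D 0 := by
      ext z
      simp [cellDomain, MeasurableEquiv.funUnique]
    rw [e] at h
    exact h
  exact h0.comp (measurePreserving_truncLE D (Nat.zero_le n))

/-- Functions of `(x, y_1, …, y_k)` as functions of `(x, y_1, …, y_n)`. -/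
noncomputable def scaleEmb (D : Set (Sp d)) (r : ℕ) {k : ℕ} (hk : k ≤ n) :
    L2Y d D k r →ₗᵢ[ℝ] L2Y d D n r :=
  Lp.compMeasurePreservingₗᵢ ℝ (truncLE hk) (measurePreserving_truncLE D hk)

/-- Functions of `x` as functions of `(x, y_1, …, y_n)`. -/
noncomputable def baseEmb (D : Set (Sp d)) (n r : ℕ) : L2D d D r →ₗᵢ[ℝ] L2Y d D n r :=
  Lp.compMeasurePreservingₗᵢ ℝ (fun z : Fin (n + 1) → Sp d => z 0) (measurePreserving_eval_zero D)

theorem scaleEmb_coeFn {k : ℕ} (hk : k ≤ n) (F : L2Y d D k r) :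
    scaleEmb D r hk F =ᵐ[cellMeasure d D n] fun z => F (truncLE hk z) :=
  Lp.coeFn_compMeasurePreserving F (measurePreserving_truncLE D hk)

theorem baseEmb_coeFn (F : L2D d D r) :
    baseEmb D n r F =ᵐ[cellMeasure d D n] fun z => F (z 0) :=
  Lp.coeFn_compMeasurePreserving F (measurePreserving_eval_zero D)

theorem scaleEmb_scaleEmb {k l : ℕ} (hk : k ≤ l) (hl : l ≤ n) (F : L2Y d D k r) :
    scaleEmb D r hl (scaleEmb D r hk F) = scaleEmb D r (hk.trans hl) F :=
  (Lp.compMeasurePreserving_comp_apply F (measurePreserving_truncLE D hk)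
    (measurePreserving_truncLE D hl)).symm

theorem scaleEmb_baseEmb {l : ℕ} (hl : l ≤ n) (F : L2D d D r) :
    scaleEmb D r hl (baseEmb D l r F) = baseEmb D n r F :=
  (Lp.compMeasurePreserving_comp_apply F (measurePreserving_eval_zero D)
    (measurePreserving_truncLE D hl)).symm

/-- `G(x, y_1, …, y_{k+1})` has mean zero in `y_{k+1}`. -/
def IsMeanZero {k : ℕ} (G : L2Y d D (k + 1) r) : Prop :=
  ∀ g : (Fin (k + 1) → Sp d) → ℝ, MemLp g 2 (cellMeasure d D k) → ∀ p,
    ∫ z, G z p * g (front z) ∂cellMeasure d D (k + 1) = 0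

theorem memLp_apply {μ : Measure (Fin (n + 1) → Sp d)} (F : Lp (EuclideanSpace ℝ (Fin r)) 2 μ)
    (p : Fin r) : MemLp (fun z => F z p) 2 μ :=
  (EuclideanSpace.proj (𝕜 := ℝ) p : EuclideanSpace ℝ (Fin r) →L[ℝ] ℝ).comp_memLp' (Lp.memLp F)

/-- The components of F do not depend on the last variable, so they serve as the weights g in the
mean-zero condition. -/
theorem IsMeanZero.inner_eq_zero {k : ℕ} {G : L2Y d D (k + 1) r} (hG : IsMeanZero G)
    (F : L2Y d D k r) : inner ℝ (scaleEmb D r k.le_succ F) G = 0 := by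
  rw [MeasureTheory.L2.inner_def]
  have e : ∀ᵐ z ∂cellMeasure d D (k + 1), inner ℝ (scaleEmb D r k.le_succ F z) (G z) =
      ∑ p, G z p * F (front z) p := by
    filter_upwards [scaleEmb_coeFn k.le_succ F] with z hz
    rw [hz, PiLp.inner_apply]
    rfl
  rw [integral_congr_ae e, integral_finsetSum]
  · exact Finset.sum_eq_zero fun p _ => hG (fun y => F y p) (memLp_apply F p) p
  · intro p _
    exact (memLp_apply G p).integrable_mul
      ((memLp_apply F p).comp_measurePreserving (measurePreserving_init d D k))

/-- Both functions are already defined over the first l + 1 fast variables. The orthogonality holds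
there, and the isometry into all the variables transports it. -/
theorem IsMeanZero.inner_scaleEmb {k l : ℕ} (hl : l + 1 ≤ n) (hk : k ≤ l)
    {G : L2Y d D (l + 1) r} (hG : IsMeanZero G) (F : L2Y d D k r) :
    inner ℝ (scaleEmb D r (by omega : k ≤ n) F) (scaleEmb D r hl G) = 0 := by
  have e := (scaleEmb_scaleEmb l.le_succ hl (scaleEmb D r hk F)).trans
    (scaleEmb_scaleEmb hk (l.le_succ.trans hl) F)
  rw [← e, LinearIsometry.inner_map_map]
  exact hG.inner_eq_zero _

/-- `v_0(x) + ∑_i G_i(x, y_1, …, y_i)`. -/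
noncomputable def scaleSum (v : L2D d D r) (G : (i : Fin n) → L2Y d D (i + 1) r) : L2Y d D n r :=
  baseEmb D n r v + ∑ i : Fin n, scaleEmb D r i.2 (G i)

theorem scaleSum_coeFn (v : L2D d D r) (G : (i : Fin n) → L2Y d D (i + 1) r) :
    scaleSum v G =ᵐ[cellMeasure d D n] fun z => v (z 0) + ∑ i : Fin n, G i (trunc i z) := by
  have h1 : ∀ᵐ z ∂cellMeasure d D n, ∀ i : Fin n, scaleEmb D r i.2 (G i) z = G i (trunc i z) :=
    ae_all_iff.2 fun i => scaleEmb_coeFn _ _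
  have h2 : ∀ s : Finset (Fin n), ∀ᵐ z ∂cellMeasure d D n,
      (∑ i ∈ s, scaleEmb D r i.2 (G i) : L2Y d D n r) z = ∑ i ∈ s, scaleEmb D r i.2 (G i) z := by
    intro s
    induction s using Finset.induction_on with
    | empty =>
      filter_upwards [Lp.coeFn_zero (EuclideanSpace ℝ (Fin r)) 2 (cellMeasure d D n)] with z hz
      simpa using hz
    | insert i s hi ih =>
      rw [Finset.sum_insert hi]
      filter_upwards [ih, Lp.coeFn_add (scaleEmb D r i.2 (G i))
        (∑ i ∈ s, scaleEmb D r i.2 (G i))] with z hz hz'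
      rw [hz', Pi.add_apply, hz, Finset.sum_insert hi]
  filter_upwards [h1, h2 Finset.univ, baseEmb_coeFn (n := n) v, Lp.coeFn_add (baseEmb D n r v)
    (∑ i : Fin n, scaleEmb D r i.2 (G i))] with z e1 e2 e3 e4
  rw [scaleSum, e4, Pi.add_apply, e2, e3]
  simp only [e1]

theorem norm_scaleSum_le (v : L2D d D r) (G : (i : Fin n) → L2Y d D (i + 1) r) :
    ‖scaleSum v G‖ ≤ ‖v‖ + ∑ i, ‖G i‖ := by
  refine (norm_add_le _ _).trans ?_
  rw [LinearIsometry.norm_map]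
  gcongr
  refine (norm_sum_le _ _).trans (le_of_eq ?_)
  simp only [LinearIsometry.norm_map]

/-- Pythagoras: of two contributions, the one at the finer scale has mean zero in a variable on
which the other does not depend. Coercivity of the forms on the sums thereby becomes control of each
component. -/
theorem norm_scaleSum_sq (v : L2D d D r) {G : (i : Fin n) → L2Y d D (i + 1) r}
    (hG : ∀ i, IsMeanZero (G i)) : ‖scaleSum v G‖ ^ 2 = ‖v‖ ^ 2 + ∑ i, ‖G i‖ ^ 2 := by
  have h0 : ∀ i : Fin n, inner ℝ (baseEmb D n r v) (scaleEmb D r i.2 (G i)) = 0 := by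
    intro i
    -- A function of x alone is treated as a function at scale zero.
    rw [← scaleEmb_baseEmb (Nat.zero_le n) v]
    exact (hG i).inner_scaleEmb i.2 (Nat.zero_le _) _
  have hlt : ∀ i j : Fin n, i < j →
      inner ℝ (scaleEmb D r i.2 (G i)) (scaleEmb D r j.2 (G j)) = 0 := fun i j hij =>
    (hG j).inner_scaleEmb (k := i + 1) j.2 hij (G i)
  have hne : ∀ i j : Fin n, j ≠ i →
      inner ℝ (scaleEmb D r i.2 (G i)) (scaleEmb D r j.2 (G j)) = 0 := by
    intro i j hij
    rcases lt_or_gt_of_ne hij with h | h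
    · rw [real_inner_comm]
      exact hlt j i h
    · exact hlt i j h
  rw [scaleSum, norm_add_sq_real, inner_sum, Finset.sum_eq_zero fun i _ => h0 i,
    LinearIsometry.norm_map, ← real_inner_self_eq_norm_sq (∑ i : Fin n, scaleEmb D r i.2 (G i)),
    sum_inner]
  simp only [inner_sum]
  rw [mul_zero, add_zero]
  congr 1
  refine Finset.sum_congr rfl fun i _ => ?_
  rw [Finset.sum_eq_single i (fun j _ hj => hne i j hj) (by simp), real_inner_self_eq_norm_sq,
    LinearIsometry.norm_map]

theorem norm_le_norm_scaleSum (v : L2D d D r) {G : (i : Fin n) → L2Y d D (i + 1) r}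
    (hG : ∀ i, IsMeanZero (G i)) : ‖v‖ ≤ ‖scaleSum v G‖ := by
  refine (sq_le_sq₀ (norm_nonneg _) (norm_nonneg _)).1 ?_
  rw [norm_scaleSum_sq v hG]
  exact le_add_of_nonneg_right (Finset.sum_nonneg fun i _ => sq_nonneg _)

theorem norm_apply_le_norm_scaleSum (v : L2D d D r) {G : (i : Fin n) → L2Y d D (i + 1) r}
    (hG : ∀ i, IsMeanZero (G i)) (i : Fin n) : ‖G i‖ ≤ ‖scaleSum v G‖ := by
  refine (sq_le_sq₀ (norm_nonneg _) (norm_nonneg _)).1 ?_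
  rw [norm_scaleSum_sq v hG]
  have := Finset.single_le_sum (f := fun i => ‖G i‖ ^ 2) (fun i _ => sq_nonneg _)
    (Finset.mem_univ i)
  linarith [sq_nonneg ‖v‖]

end Scales

/-! ### The bilinear forms -/

section Forms

variable {d : ℕ} {D : Set (Sp d)} {n r : ℕ} {α β : ℝ}
  {c : (Fin (n + 1) → Sp d) → Matrix (Fin r) (Fin r) ℝ}

theorem measurableSet_cellDomain (hD : IsOpen D) (n : ℕ) : MeasurableSet (cellDomain d D n) := by
  have e : cellDomain d D n = (fun z : Fin (n + 1) → Sp d => z 0) ⁻¹' D ∩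
      ⋂ i : Fin n, (fun z : Fin (n + 1) → Sp d => z i.succ) ⁻¹' cube d := by
    ext z
    simp [cellDomain]
  rw [e]
  have h : ∀ j, Measurable fun z : Fin (n + 1) → Sp d => z j := fun j => measurable_pi_apply j
  exact (h 0 hD.measurableSet).inter
    (MeasurableSet.iInter fun i : Fin n => h i.succ (isOpen_cube d).measurableSet)

/-- The coefficient bounds are assumed only at points of the cell domain; openness of D makes this
set measurable, so they hold almost everywhere. -/
theorem ae_mem_cellDomain (hD : IsOpen D) :
    ∀ᵐ z ∂cellMeasure d D n, z ∈ cellDomain d D n :=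
  ae_restrict_mem (measurableSet_cellDomain hD n)

/-- The upper bound is one-sided in `IsCoeff`; replacing one vector by its negative gives the
absolute value. -/
theorem IsCoeff.abs_le (hc : IsCoeff d D n r α β c) {z : Fin (n + 1) → Sp d}
    (hz : z ∈ cellDomain d D n) (ξ ζ : EuclideanSpace ℝ (Fin r)) :
    |∑ p, ∑ q, c z p q * ξ q * ζ p| ≤ β * ‖ξ‖ * ‖ζ‖ := by
  have e : ∀ ξ ζ : EuclideanSpace ℝ (Fin r),
      ∑ p, ∑ q, c z p q * ξ q * ζ p = ∑ p, ∑ q, c z p q * ζ p * ξ q := fun ξ ζ =>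
    Finset.sum_congr rfl fun p _ => Finset.sum_congr rfl fun q _ => by ring
  rw [abs_le']
  constructor
  · rw [e, mul_right_comm]
    exact hc.2.2.2 z hz ζ ξ
  · rw [e, mul_right_comm]
    have := hc.2.2.2 z hz (-ζ) ξ
    rw [norm_neg] at this
    refine le_of_eq_of_le ?_ this
    simp [Finset.sum_neg_distrib]

theorem IsCoeff.integrable (hD : IsOpen D) (hc : IsCoeff d D n r α β c) (F G : L2Y d D n r) :
    Integrable (fun z => ∑ p, ∑ q, c z p q * F z q * G z p) (cellMeasure d D n) := by
  refine Integrable.mono' (g := fun z => β * (‖F z‖ * ‖G z‖))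
    (((Lp.memLp F).norm.integrable_mul (Lp.memLp G).norm).const_mul β) ?_ ?_
  · refine Finset.aestronglyMeasurable_fun_sum _ fun p _ =>
      Finset.aestronglyMeasurable_fun_sum _ fun q _ => ?_
    exact ((hc.1 p q).mul (memLp_apply F q).1).mul (memLp_apply G p).1
  · filter_upwards [ae_mem_cellDomain hD] with z hz
    rw [Real.norm_eq_abs, ← mul_assoc]
    exact hc.abs_le hz _ _

/-- `(F, G) ↦ ∫_D ∫_Y c F · G`. -/
noncomputable def coeffForm (hD : IsOpen D) (hc : IsCoeff d D n r α β c) :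
    L2Y d D n r →ₗ[ℝ] L2Y d D n r →ₗ[ℝ] ℝ :=
  LinearMap.mk₂ ℝ (fun F G => ∫ z, ∑ p, ∑ q, c z p q * F z q * G z p ∂cellMeasure d D n)
    (fun F F' G => by
      rw [← integral_add (hc.integrable hD F G) (hc.integrable hD F' G)]
      refine integral_congr_ae ?_
      filter_upwards [Lp.coeFn_add F F'] with z hz
      simp only [hz, Pi.add_apply, PiLp.add_apply, mul_add, add_mul, Finset.sum_add_distrib])
    (fun s F G => by
      rw [smul_eq_mul, ← integral_const_mul]
      refine integral_congr_ae ?_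
      filter_upwards [Lp.coeFn_smul s F] with z hz
      simp only [hz, Pi.smul_apply, PiLp.smul_apply, smul_eq_mul, Finset.mul_sum]
      exact Finset.sum_congr rfl fun p _ => Finset.sum_congr rfl fun q _ => by ring)
    (fun F G G' => by
      rw [← integral_add (hc.integrable hD F G) (hc.integrable hD F G')]
      refine integral_congr_ae ?_
      filter_upwards [Lp.coeFn_add G G'] with z hz
      simp only [hz, Pi.add_apply, PiLp.add_apply, mul_add, Finset.sum_add_distrib])
    (fun s F G => by
      rw [smul_eq_mul, ← integral_const_mul]
      refine integral_congr_ae ?_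
      filter_upwards [Lp.coeFn_smul s G] with z hz
      simp only [hz, Pi.smul_apply, PiLp.smul_apply, smul_eq_mul, Finset.mul_sum]
      exact Finset.sum_congr rfl fun p _ => Finset.sum_congr rfl fun q _ => by ring)

theorem coeffForm_apply (hD : IsOpen D) (hc : IsCoeff d D n r α β c) (F G : L2Y d D n r) :
    coeffForm hD hc F G = ∫ z, ∑ p, ∑ q, c z p q * F z q * G z p ∂cellMeasure d D n := rfl

theorem coeffForm_isEnergyForm (hD : IsOpen D) (hβ : 0 < β) (hc : IsCoeff d D n r α β c) :
    IsEnergyForm α β (coeffForm hD hc) where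
  symm F G := by
    rw [coeffForm_apply, coeffForm_apply]
    refine integral_congr_ae ?_
    filter_upwards [ae_mem_cellDomain hD] with z hz
    rw [Finset.sum_comm]
    refine Finset.sum_congr rfl fun p _ => Finset.sum_congr rfl fun q _ => ?_
    rw [(hc.2.1 z hz).apply p q]
    ring
  coercive F := by
    rw [coeffForm_apply, ← real_inner_self_eq_norm_sq, MeasureTheory.L2.inner_def,
      ← integral_const_mul]
    refine integral_mono_ae ((MeasureTheory.L2.integrable_inner F F).const_mul α)
      (hc.integrable hD F F) ?_
    filter_upwards [ae_mem_cellDomain hD] with z hz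
    rw [real_inner_self_eq_norm_sq]
    refine (hc.2.2.1 z hz (F z)).trans (le_of_eq ?_)
    exact Finset.sum_congr rfl fun p _ => Finset.sum_congr rfl fun q _ => by ring
  bounded F G := by
    have hi := (Lp.memLp F).norm.integrable_mul (Lp.memLp G).norm
    have h1 : coeffForm hD hc F G ≤ β * ∫ z, ‖F z‖ * ‖G z‖ ∂cellMeasure d D n := by
      rw [coeffForm_apply, ← integral_const_mul]
      refine integral_mono_ae (hc.integrable hD F G) (hi.const_mul β) ?_
      filter_upwards [ae_mem_cellDomain hD] with z hz
      change _ ≤ β * (‖F z‖ * ‖G z‖)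
      rw [← mul_assoc]
      exact (le_abs_self _).trans (hc.abs_le hz _ _)
    refine h1.trans ?_
    rw [mul_assoc]
    gcongr
    have hF := (Lp.memLp F).norm
    have hG := (Lp.memLp G).norm
    -- Cauchy–Schwarz for the scalar functions z ↦ ‖F z‖ and z ↦ ‖G z‖.
    have h2 := real_inner_le_norm (hF.toLp _) (hG.toLp _)
    rw [MeasureTheory.L2.inner_def, Lp.norm_toLp, Lp.norm_toLp, eLpNorm_norm, eLpNorm_norm,
      ← Lp.norm_def, ← Lp.norm_def] at h2
    refine le_of_eq_of_le (integral_congr_ae ?_) h2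
    filter_upwards [hF.coeFn_toLp, hG.coeFn_toLp] with z h3 h4
    rw [h3, h4]
    simp [mul_comm]

end Forms

/-! ### Elliptic projections -/

section Galerkin

variable {E : Type*} [NormedAddCommGroup E] [NormedSpace ℝ E]
  {K₁ : Type*} [NormedAddCommGroup K₁] [NormedSpace ℝ K₁]
  {K₂ : Type*} [NormedAddCommGroup K₂] [NormedSpace ℝ K₂] {α β : ℝ}
  {b : K₁ →ₗ[ℝ] K₁ →ₗ[ℝ] ℝ} {a : K₂ →ₗ[ℝ] K₂ →ₗ[ℝ] ℝ} {Φ : E →L[ℝ] K₁} {Ψ : E →L[ℝ] K₂}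

/-- Coercivity bounds the left side below by α(‖x₁‖² + ‖x₂‖²), which is at least α/2 times the
squared sum; boundedness bounds the right side by β times the product of the two sums. Dividing by
‖x₁‖ + ‖x₂‖ gives the constant 2β/α. -/
theorem IsEnergyForm.galerkin_bound (hα : 0 < α) (hβ : 0 < β) (hb : IsEnergyForm α β b)
    (ha : IsEnergyForm α β a) {x₁ y₁ : K₁} {x₂ y₂ : K₂}
    (h : b x₁ x₁ + a x₂ x₂ = b x₁ y₁ + a x₂ y₂) :
    ‖x₁‖ + ‖x₂‖ ≤ 2 * β / α * (‖y₁‖ + ‖y₂‖) := by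
  have h1 := hb.coercive x₁
  have h2 := ha.coercive x₂
  have h3 := hb.bounded x₁ y₁
  have h4 := ha.bounded x₂ y₂
  rcases (by positivity : 0 ≤ ‖x₁‖ + ‖x₂‖).eq_or_lt with h0 | h0
  · rw [← h0]
    positivity
  · refine le_of_mul_le_mul_right ?_ h0
    rw [div_mul_eq_mul_div, div_mul_eq_mul_div, le_div_iff₀ hα]
    have h5 : 0 ≤ α * (‖x₁‖ - ‖x₂‖) ^ 2 := by positivity
    have h6 : 0 ≤ β * (‖x₁‖ * ‖y₂‖) := by positivity
    have h7 : 0 ≤ β * (‖x₂‖ * ‖y₁‖) := by positivity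
    linarith

/-- `w` is a Galerkin approximation of `x` in `V`. -/
def IsGalerkin (b : K₁ →ₗ[ℝ] K₁ →ₗ[ℝ] ℝ) (a : K₂ →ₗ[ℝ] K₂ →ₗ[ℝ] ℝ) (Φ : E →L[ℝ] K₁)
    (Ψ : E →L[ℝ] K₂) (V : Submodule ℝ E) (x w : E) : Prop :=
  w ∈ V ∧ ∀ v ∈ V, b (Φ (w - x)) (Φ v) + a (Ψ (w - x)) (Ψ v) = 0

/-- Céa's argument: since v - w lies in V, the error w - x may be tested with v - x in place of
itself. -/
theorem IsGalerkin.cea (hα : 0 < α) (hβ : 0 < β) (hb : IsEnergyForm α β b)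
    (ha : IsEnergyForm α β a) {V : Submodule ℝ E} {x w : E} (h : IsGalerkin b a Φ Ψ V x w) {v : E}
    (hv : v ∈ V) :
    ‖Φ (w - x)‖ + ‖Ψ (w - x)‖ ≤ 2 * β / α * (‖Φ (v - x)‖ + ‖Ψ (v - x)‖) := by
  refine hb.galerkin_bound hα hβ ha ?_
  have := h.2 (v - w) (V.sub_mem hv h.1)
  rw [show v - x = (v - w) + (w - x) by abel, map_add Φ (v - w), map_add Ψ (v - w), map_add,
    map_add]
  linarith

theorem IsGalerkin.eq (hα : 0 < α) (hβ : 0 < β) (hb : IsEnergyForm α β b)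
    (ha : IsEnergyForm α β a) (hinj : ∀ v, Φ v = 0 → Ψ v = 0 → v = 0) {V : Submodule ℝ E}
    {x w w' : E} (h : IsGalerkin b a Φ Ψ V x w) (h' : IsGalerkin b a Φ Ψ V x w') : w = w' := by
  have hm := V.sub_mem h.1 h'.1
  have e1 := h.2 _ hm
  have e2 := h'.2 _ hm
  have e3 : b (Φ (w - w')) (Φ (w - w')) + a (Ψ (w - w')) (Ψ (w - w')) =
      b (Φ (w - w')) 0 + a (Ψ (w - w')) 0 := by
    rw [map_zero, map_zero]
    simp only [map_sub, LinearMap.sub_apply] at e1 e2 ⊢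
    linarith
  have := hb.galerkin_bound hα hβ ha e3
  rw [norm_zero, norm_zero, add_zero, mul_zero] at this
  have h1 := norm_nonneg (Φ (w - w'))
  have h2 := norm_nonneg (Ψ (w - w'))
  exact sub_eq_zero.1 (hinj _ (norm_eq_zero.1 (by linarith)) (norm_eq_zero.1 (by linarith)))

/-- The elliptic projection onto a finite dimensional subspace is a continuous linear map. -/
theorem exists_galerkin_projection (hα : 0 < α) (hβ : 0 < β) (hb : IsEnergyForm α β b)
    (ha : IsEnergyForm α β a) (hinj : ∀ v, Φ v = 0 → Ψ v = 0 → v = 0) (V : Submodule ℝ E)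
    [FiniteDimensional ℝ V] :
    ∃ P : E →L[ℝ] E, ∀ x, IsGalerkin b a Φ Ψ V x (P x) := by
  let C : E →ₗ[ℝ] E →ₗ[ℝ] ℝ :=
    b.compl₁₂ (Φ : E →ₗ[ℝ] K₁) (Φ : E →ₗ[ℝ] K₁) + a.compl₁₂ (Ψ : E →ₗ[ℝ] K₂) (Ψ : E →ₗ[ℝ] K₂)
  have hC : ∀ x y, C x y = b (Φ x) (Φ y) + a (Ψ x) (Ψ y) := fun x y => rfl
  let R : E →ₗ[ℝ] Module.Dual ℝ V := C.domRestrict₂ V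
  have hR : ∀ x (v : V), R x v = C x v := fun x v => rfl
  let S : V →ₗ[ℝ] Module.Dual ℝ V := R ∘ₗ V.subtype
  -- The operator from V to its dual is injective by coercivity, hence bijective by equality of
  -- dimensions.
  have hSinj : Function.Injective S := by
    rw [injective_iff_map_eq_zero]
    intro v hv
    have e : C v v = 0 := by
      rw [← hR]
      exact LinearMap.congr_fun hv v
    rw [hC] at e
    have := hb.galerkin_bound hα hβ ha (y₁ := 0) (y₂ := 0)
      (e.trans (by rw [map_zero, map_zero, add_zero]))
    rw [norm_zero, norm_zero, add_zero, mul_zero] at this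
    have h1 := norm_nonneg (Φ v)
    have h2 := norm_nonneg (Ψ v)
    exact Subtype.ext
      (hinj _ (norm_eq_zero.1 (by linarith)) (norm_eq_zero.1 (by linarith)))
  have hSsurj : Function.Surjective S :=
    (LinearMap.injective_iff_surjective_of_finrank_eq_finrank
      Subspace.dual_finrank_eq.symm).1 hSinj
  let e := LinearEquiv.ofBijective S ⟨hSinj, hSsurj⟩
  let P : E →ₗ[ℝ] V := e.symm.toLinearMap ∘ₗ R
  have hP : ∀ x, IsGalerkin b a Φ Ψ V x (P x) := by
    intro x
    refine ⟨(P x).2, fun v hv => ?_⟩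
    rw [← hC, map_sub, LinearMap.sub_apply]
    have h1 : S (P x) = R x := e.apply_symm_apply (R x)
    exact sub_eq_zero.2 (LinearMap.congr_fun h1 ⟨v, hv⟩)
  let J : V →ₗ[ℝ] K₁ × K₂ := (Φ.prod Ψ : E →L[ℝ] K₁ × K₂).toLinearMap ∘ₗ V.subtype
  have hJ : LinearMap.ker J = ⊥ := by
    rw [LinearMap.ker_eq_bot']
    intro v hv
    have hv' : (Φ v, Ψ v) = (0 : K₁ × K₂) := hv
    exact Subtype.ext (hinj _ (congrArg Prod.fst hv') (congrArg Prod.snd hv'))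
  -- On the finite dimensional V the injective map (Φ, Ψ) is bounded below. The constant κ depends
  -- on V, but it serves only to make P continuous; the error bounds come from Céa's estimate.
  obtain ⟨κ, -, hκ⟩ := J.exists_antilipschitzWith hJ
  have hbound : ∀ x, ‖(V.subtype ∘ₗ P) x‖ ≤ κ * ((2 * β / α + 1) * (‖Φ‖ + ‖Ψ‖)) * ‖x‖ := by
    intro x
    have h1 : ‖P x‖ ≤ κ * ‖J (P x)‖ := by
      simpa using hκ.le_mul_dist (P x) 0
    have h2 : ‖J (P x)‖ ≤ ‖Φ (P x)‖ + ‖Ψ (P x)‖ := by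
      change ‖(Φ (P x), Ψ (P x))‖ ≤ _
      rw [Prod.norm_mk]
      exact max_le_add_of_nonneg (norm_nonneg _) (norm_nonneg _)
    have h3 := (hP x).cea hα hβ hb ha V.zero_mem
    rw [zero_sub, map_neg, map_neg, norm_neg, norm_neg] at h3
    have h4 : ‖Φ (P x)‖ ≤ ‖Φ (P x - x)‖ + ‖Φ x‖ := by
      rw [map_sub]
      exact norm_le_norm_sub_add _ _
    have h5 : ‖Ψ (P x)‖ ≤ ‖Ψ (P x - x)‖ + ‖Ψ x‖ := by
      rw [map_sub]
      exact norm_le_norm_sub_add _ _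
    have h6 : ‖J (P x)‖ ≤ (2 * β / α + 1) * (‖Φ x‖ + ‖Ψ x‖) := by linarith
    have h7 : ‖Φ x‖ + ‖Ψ x‖ ≤ (‖Φ‖ + ‖Ψ‖) * ‖x‖ := by
      rw [add_mul]
      exact add_le_add (Φ.le_opNorm x) (Ψ.le_opNorm x)
    calc ‖(V.subtype ∘ₗ P) x‖ = ‖P x‖ := rfl
      _ ≤ κ * ((2 * β / α + 1) * ((‖Φ‖ + ‖Ψ‖) * ‖x‖)) := by
        refine h1.trans ?_
        gcongr
        refine h6.trans ?_
        gcongr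
      _ = _ := by ring
  exact ⟨(V.subtype ∘ₗ P).mkContinuous _ hbound, hP⟩

end Galerkin

/-! ### Strongly convergent operators acting on functions of time -/

section StrongLimit

variable {E : Type*} [NormedAddCommGroup E] [NormedSpace ℝ E]
  {K : Type*} [NormedAddCommGroup K] [NormedSpace ℝ K] {T : ℝ} {k : ℕ}

theorem timeNorm_two_eq {Z : Type*} [NormedAddCommGroup Z] {g : ℝ → Z}
    (hg : MemLp g 2 (volume.restrict (Ioo 0 T))) :
    timeNorm T 2 g = √(∫ s in Ioo 0 T, ‖g s‖ ^ 2) := by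
  rw [timeNorm, hg.eLpNorm_eq_integral_rpow_norm (by norm_num) (by norm_num),
    ENNReal.toReal_ofReal (by positivity), Real.sqrt_eq_rpow]
  norm_num

/-- Dominated convergence: pointwise in time the integrand tends to zero, and it is dominated by
C²‖g‖². -/
theorem tendsto_timeNorm_zero {R : ℕ → E →L[ℝ] K} {C : ℝ} (hC : ∀ L x, ‖R L x‖ ≤ C * ‖x‖)
    (hR : ∀ x, Tendsto (fun L => R L x) atTop (𝓝 0)) {g : ℝ → E}
    (hg : MemLp g 2 (volume.restrict (Ioo 0 T))) :
    Tendsto (fun L => timeNorm T 2 fun s => R L (g s)) atTop (𝓝 0) := by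
  have h1 : ∀ L, MemLp (fun s => R L (g s)) 2 (volume.restrict (Ioo 0 T)) :=
    fun L => (R L).comp_memLp' hg
  have h2 : Tendsto (fun L => ∫ s in Ioo 0 T, ‖R L (g s)‖ ^ 2) atTop
      (𝓝 (∫ s in Ioo 0 T, (0 : ℝ))) := by
    refine tendsto_integral_of_dominated_convergence (fun s => C ^ 2 * ‖g s‖ ^ 2)
      (fun L => (h1 L).1.norm.pow 2) (hg.norm.integrable_sq.const_mul _) (fun L => ?_) ?_
    · refine Eventually.of_forall fun s => ?_
      rw [Real.norm_of_nonneg (by positivity), ← mul_pow]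
      exact pow_le_pow_left₀ (norm_nonneg _) (hC L _) 2
    · refine Eventually.of_forall fun s => ?_
      simpa using (hR (g s)).norm.pow 2
  rw [integral_zero] at h2
  have h3 := h2.sqrt
  rw [Real.sqrt_zero] at h3
  exact h3.congr fun L => (timeNorm_two_eq (h1 L)).symm

/-- Allows convergence that is uniform in time to be deduced from convergence at t = 0 and L²
convergence of the next derivative. -/
theorem IsTimeChain.norm_le {V : ℕ → ℝ → K} (h : IsTimeChain T k V) {j : ℕ} (hj : j < k) {t : ℝ}
    (ht : t ∈ Icc 0 T) : ‖V j t‖ ≤ ‖V j 0‖ + √T * timeNorm T 2 (V (j + 1)) := by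
  have hT : 0 ≤ T := ht.1.trans ht.2
  have h1 := h.norm_sub_le_integral hj le_rfl ht.1 ht.2
  have h2 := h.integral_norm_mono (j := j + 1) hj le_rfl le_rfl ht.1 ht.2 le_rfl
  have h3 := h.integral_norm_le (j := j + 1) hj hT
  have h4 := norm_le_norm_sub_add (V j t) (V j 0)
  linarith

theorem norm_dt_le {V : ℕ → ℝ → K} (h : IsTimeChain T k V) (hk : 2 ≤ k) {C : ℝ}
    (hC : ∀ t ∈ Icc 0 T, ‖V 1 t‖ ≤ C) (hT : 0 < T) {M m : ℕ} (hm : m < M) :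
    ‖dt (T / M) (fun j => V 0 (j * (T / M))) m‖ ≤ C := by
  have hM : (0 : ℝ) < M := by exact_mod_cast (by omega : 0 < M)
  have hτ : 0 < T / (M : ℝ) := by positivity
  have m0 := grid_mem hT.le (by omega) hm.le
  have m1 := grid_mem (m := m + 1) hT.le (by omega) hm
  rw [dt, norm_smul, Real.norm_of_nonneg (by positivity), inv_mul_le_iff₀ hτ,
    h.sub_eq (by omega) m0 m1]
  have := intervalIntegral.norm_integral_le_of_norm_le_const (f := V 1) (C := C)
    (a := m * (T / M)) (b := (m + 1 : ℕ) * (T / M)) ?_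
  · refine this.trans (le_of_eq ?_)
    rw [show ((m + 1 : ℕ) : ℝ) * (T / M) - m * (T / M) = T / M by push_cast; ring,
      abs_of_pos hτ, mul_comm]
  · intro s hs
    rw [uIoc_of_le (by push_cast; nlinarith)] at hs
    exact hC s ⟨m0.1.trans hs.1.le, hs.2.trans m1.2⟩

end StrongLimit

/-! ### Error of the fully discrete scheme -/

section SchemeError

variable {E : Type*} [NormedAddCommGroup E] [NormedSpace ℝ E]
  {K₁ : Type*} [NormedAddCommGroup K₁] [NormedSpace ℝ K₁]
  {K₂ : Type*} [NormedAddCommGroup K₂] [NormedSpace ℝ K₂] {α β : ℝ}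
  {b : K₁ →ₗ[ℝ] K₁ →ₗ[ℝ] ℝ} {a : K₂ →ₗ[ℝ] K₂ →ₗ[ℝ] ℝ} {Φ : E →L[ℝ] K₁} {Ψ : E →L[ℝ] K₂}

/-- The discrete energy of `U_m - w(t_m)` is controlled by its initial value, the consistency error
of the scheme and the projection error `w - u`. -/
theorem scheme_estimate (hα : 0 < α) (hβ : 0 < β) (hb : IsEnergyForm α β b)
    (ha : IsEnergyForm α β a) {T : ℝ} (hT : 0 < T) {V : Submodule ℝ E} {u w : ℝ → E}
    {ℓ : ℝ → E → ℝ} {F : ℕ → ℝ → K₁} (hF : ∀ t ∈ Icc 0 T, F 0 t = Φ (u t))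
    (heq : ∀ t ∈ Icc 0 T, ∀ v ∈ V, b (F 2 t) (Φ v) + a (Ψ (u t)) (Ψ v) = ℓ t v)
    (hw : ∀ t ∈ Icc 0 T, IsGalerkin b a Φ Ψ V (u t) (w t)) {M : ℕ} (hM : 0 < M) {U : ℕ → E}
    (hUV : ∀ m ≤ M, U m ∈ V)
    (hU : ∀ m, 1 ≤ m → m < M → ∀ v ∈ V,
      b (Φ (dt2 (T / M) U m)) (Φ v) + a (Ψ (avg (1 / 4) U m)) (Ψ v) =
        avg (1 / 4) (fun j => ℓ (j * (T / M)) v) m) :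
    let τ := T / M
    let x := fun m => Φ (U m - w (m * τ))
    let y := fun m => Ψ (U m - w (m * τ))
    let R := τ * ∑ m ∈ Finset.Ico 1 M,
          ‖avg (1 / 4) (fun j => F 2 (j * τ)) m - dt2 τ (fun j => F 0 (j * τ)) m‖
        + τ * ∑ m ∈ Finset.Ico 1 M, ‖dt2 τ (fun j => Φ (w (j * τ) - u (j * τ))) m‖
        + τ * ∑ m ∈ Finset.Ico 1 M, ‖avg (1 / 4) (fun j => Φ (w (j * τ) - u (j * τ))) m‖
    ∀ m < M, √α * ‖dt τ x m‖ ≤ √β * (‖dt τ x 0‖ + ‖half y 0‖) + 2 * β / √α * R ∧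
      √α * ‖half y m‖ ≤ √β * (‖dt τ x 0‖ + ‖half y 0‖) + 2 * β / √α * R := by
  intro τ x y R m hm
  have hM' : (0 : ℝ) < M := by exact_mod_cast hM
  have hτ : 0 < τ := by positivity
  let q : ℕ → K₁ := fun j => Φ (w (j * τ) - u (j * τ))
  -- The consistency error of the field of u, minus the second difference of the projection error,
  -- plus its average. The last term is the `a`-residual rewritten by means of the elliptic
  -- projection.
  let ρ : ℕ → K₁ := fun m => avg (1 / 4) (fun j => F 2 (j * τ)) m
    - dt2 τ (fun j => F 0 (j * τ)) m - dt2 τ q m + avg (1 / 4) q m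
  have hρ : τ * ∑ j ∈ Finset.Ico 1 M, ‖ρ j‖ ≤ R := by
    simp only [R]
    rw [← mul_add, ← mul_add, ← Finset.sum_add_distrib, ← Finset.sum_add_distrib]
    refine mul_le_mul_of_nonneg_left (Finset.sum_le_sum fun j _ => ?_) hτ.le
    exact (norm_add_le _ _).trans (add_le_add_left (norm_sub_le _ _) _)
  have key : ∀ m, 1 ≤ m → m < M →
      b (dt2 τ x m) (x (m + 1) - x (m - 1)) + a (avg (1 / 4) y m) (y (m + 1) - y (m - 1)) =
        b (ρ m) (x (m + 1) - x (m - 1)) := by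
    intro m h1 h2
    obtain ⟨l, rfl⟩ : ∃ l, m = l + 1 := ⟨m - 1, by omega⟩
    have g : ∀ j : ℕ, j ≤ M → (j : ℝ) * τ ∈ Icc 0 T := fun j hj => grid_mem hT.le hM hj
    have hp : ∀ j ≤ M, U j - w (j * τ) ∈ V := fun j hj => V.sub_mem (hUV j hj) (hw _ (g j hj)).1
    set v := U (l + 1 + 1) - w ((l + 1 + 1 : ℕ) * τ) - (U l - w (l * τ)) with hv
    have hvV : v ∈ V := V.sub_mem (hp _ h2) (hp _ (by omega))
    have ex : x (l + 1 + 1) - x (l + 1 - 1) = Φ v := by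
      rw [hv, map_sub Φ (_ - _)]
      rfl
    have ey : y (l + 1 + 1) - y (l + 1 - 1) = Ψ v := by
      rw [hv, map_sub Ψ (_ - _)]
      rfl
    rw [ex, ey]
    have e0 := hU (l + 1) h1 h2 v hvV
    have w0 := (hw _ (g l (by omega))).2 v hvV
    have w1 := (hw _ (g (l + 1) (by omega))).2 v hvV
    have w2 := (hw _ (g (l + 1 + 1) h2)).2 v hvV
    have q0 := heq _ (g l (by omega)) v hvV
    have q1 := heq _ (g (l + 1) (by omega)) v hvV
    have q2 := heq _ (g (l + 1 + 1) h2) v hvV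
    have f0 := hF _ (g l (by omega))
    have f1 := hF _ (g (l + 1) (by omega))
    have f2 := hF _ (g (l + 1 + 1) h2)
    simp only [x, y, ρ, q, dt2, avg, Nat.add_sub_cancel, map_sub, map_add, map_smul,
      LinearMap.add_apply, LinearMap.sub_apply, LinearMap.smul_apply, smul_eq_mul, f0, f1, f2]
      at e0 w0 w1 w2 ⊢
    rw [← q0, ← q1, ← q2] at e0
    -- The scheme, minus the projection identities at the three grid times with the weights 1/4,
    -- 1/2, 1/4 of the average.
    linear_combination e0 - 1 / 4 * w0 - 1 / 2 * w1 - 1 / 4 * w2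
  have := discrete_energy_estimate hα hβ hb ha hτ key m hm
  have hs : 2 * β / √α * (τ * ∑ j ∈ Finset.Ico 1 M, ‖ρ j‖) ≤ 2 * β / √α * R := by gcongr
  exact ⟨this.1.trans (add_le_add_right hs _), this.2.trans (add_le_add_right hs _)⟩

end SchemeError

/-! ### The multiscale space -/

section Multiscale

variable {d : ℕ} {D : Set (Sp d)} {n : ℕ}

theorem pd_const (p : Fin d) (s : ℝ) : pd p (fun _ => s) = 0 := by
  funext y
  simp [pd]

theorem isPerTest_one : IsPerTest d fun _ => 1 := ⟨contDiff_const, fun _ _ => rfl⟩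

/-- The constant 1 is a periodic test function with vanishing gradient. -/
theorem IsPerGrad.isMeanZero {k : ℕ} {v : L2Ys d D (k + 1)} {G : L2Y d D (k + 1) d}
    (h : IsPerGrad d D k v G) : IsMeanZero G := by
  intro g hg p
  have := h g hg _ isPerTest_one p
  simpa [pd_const] using this

theorem IsPerCurl.isMeanZero {k : ℕ} {v : L2Y d D (k + 1) d} {G : L2Y d D (k + 1) (curlDim d)}
    (h : IsPerCurl d D k v G) : IsMeanZero G := by
  intro g hg p
  have := h g hg _ isPerTest_one p
  simpa [pd_const] using this

theorem gradY_isMeanZero (v : MSpace d D n) (i : Fin n) : IsMeanZero (gradY i v) := by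
  obtain ⟨x, hx⟩ := Submodule.Quotient.mk_surjective _ (v.2.2 i)
  have e : gradY i v = x.1.2 := by
    change (gradKer d D i).liftQ (preGrad d D i).toLinearMap le_rfl (v.2.2 i) = _
    rw [← hx]
    rfl
  rw [e]
  exact IsPerGrad.isMeanZero x.2

theorem curlY_isMeanZero (v : MSpace d D n) (i : Fin n) : IsMeanZero (curlY i v) := by
  obtain ⟨x, hx⟩ := Submodule.Quotient.mk_surjective _ (v.2.1 i)
  have e : curlY i v = x.1.2 := by
    change (curlKer d D i).liftQ (preCurl d D i).toLinearMap le_rfl (v.2.1 i) = _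
    rw [← hx]
    rfl
  rw [e]
  exact IsPerCurl.isMeanZero x.2

theorem MSpace.ext_of_eq_zero (v : MSpace d D n) (h0 : val0 v = 0) (h1 : curl0 v = 0)
    (h2 : ∀ i, gradY i v = 0) (h3 : ∀ i, curlY i v = 0) : v = 0 := by
  refine Prod.ext (Subtype.ext (Prod.ext h0 h1)) (Prod.ext (funext fun i => ?_)
    (funext fun i => ?_))
  · have h := h3 i
    obtain ⟨x, hx⟩ := Submodule.Quotient.mk_surjective _ (v.2.1 i)
    change (curlKer d D i).liftQ (preCurl d D i).toLinearMap le_rfl (v.2.1 i) = 0 at h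
    change v.2.1 i = 0
    rw [← hx] at h ⊢
    exact (Submodule.Quotient.mk_eq_zero _).2 h
  · have h := h2 i
    obtain ⟨x, hx⟩ := Submodule.Quotient.mk_surjective _ (v.2.2 i)
    change (gradKer d D i).liftQ (preGrad d D i).toLinearMap le_rfl (v.2.2 i) = 0 at h
    change v.2.2 i = 0
    rw [← hx] at h ⊢
    exact (Submodule.Quotient.mk_eq_zero _).2 h

theorem continuous_val0 : Continuous (val0 : MSpace d D n → L2D d D d) :=
  continuous_fst.comp (continuous_subtype_val.comp continuous_fst)

theorem continuous_curl0 : Continuous (curl0 : MSpace d D n → L2D d D (curlDim d)) :=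
  continuous_snd.comp (continuous_subtype_val.comp continuous_fst)

theorem continuous_liftQ {X Y : Type*} [NormedAddCommGroup X] [NormedSpace ℝ X]
    [NormedAddCommGroup Y] [NormedSpace ℝ Y] (S : Submodule ℝ X) (f : X →L[ℝ] Y)
    (h : S ≤ LinearMap.ker f.toLinearMap) : Continuous (S.liftQ f.toLinearMap h) :=
  continuous_quot_lift _ f.continuous

theorem continuous_gradY (i : Fin n) : Continuous (gradY i : MSpace d D n → L2Y d D (i + 1) d) :=
  (continuous_liftQ _ _ le_rfl).comp
    ((continuous_apply i).comp (continuous_snd.comp continuous_snd))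

theorem continuous_curlY (i : Fin n) :
    Continuous (curlY i : MSpace d D n → L2Y d D (i + 1) (curlDim d)) :=
  (continuous_liftQ _ _ le_rfl).comp
    ((continuous_apply i).comp (continuous_fst.comp continuous_snd))

/-- `v ↦ v_0` as a continuous linear map. -/
noncomputable def val0L : MSpace d D n →L[ℝ] L2D d D d := ⟨val0, continuous_val0⟩

/-- `v ↦ ∇_{y_i} 𝔳_i` as a continuous linear map. -/
noncomputable def gradYL (i : Fin n) : MSpace d D n →L[ℝ] L2Y d D (i + 1) d :=
  ⟨gradY i, continuous_gradY i⟩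

/-- `v ↦ curl v_0` as a continuous linear map. -/
noncomputable def curl0L : MSpace d D n →L[ℝ] L2D d D (curlDim d) := ⟨curl0, continuous_curl0⟩

/-- `v ↦ curl_{y_i} v_i` as a continuous linear map. -/
noncomputable def curlYL (i : Fin n) : MSpace d D n →L[ℝ] L2Y d D (i + 1) (curlDim d) :=
  ⟨curlY i, continuous_curlY i⟩

/-- `v ↦ v_0 + ∑_i ∇_{y_i} 𝔳_i ∈ L²(D × Y_1 × … × Y_n)^d`. -/
noncomputable def fieldOp (d : ℕ) (D : Set (Sp d)) (n : ℕ) : MSpace d D n →L[ℝ] L2Y d D n d :=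
  (baseEmb D n d).toContinuousLinearMap ∘L (val0L : MSpace d D n →L[ℝ] _) +
    ∑ i : Fin n, (scaleEmb D d i.2).toContinuousLinearMap ∘L gradYL i

/-- `v ↦ curl v_0 + ∑_i curl_{y_i} v_i`. -/
noncomputable def curlOp (d : ℕ) (D : Set (Sp d)) (n : ℕ) :
    MSpace d D n →L[ℝ] L2Y d D n (curlDim d) :=
  (baseEmb D n (curlDim d)).toContinuousLinearMap ∘L (curl0L : MSpace d D n →L[ℝ] _) +
    ∑ i : Fin n, (scaleEmb D (curlDim d) i.2).toContinuousLinearMap ∘L curlYL i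

theorem fieldOp_apply (v : MSpace d D n) :
    fieldOp d D n v = scaleSum (val0 v) fun i => gradY i v := by
  simp [fieldOp, scaleSum]
  rfl

theorem curlOp_apply (v : MSpace d D n) :
    curlOp d D n v = scaleSum (curl0 v) fun i => curlY i v := by
  simp [curlOp, scaleSum]
  rfl

theorem norm_val0_le (v : MSpace d D n) : ‖val0 v‖ ≤ ‖fieldOp d D n v‖ := by
  rw [fieldOp_apply]
  exact norm_le_norm_scaleSum _ (gradY_isMeanZero v)

theorem norm_gradY_le (v : MSpace d D n) (i : Fin n) : ‖gradY i v‖ ≤ ‖fieldOp d D n v‖ := by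
  rw [fieldOp_apply]
  exact norm_apply_le_norm_scaleSum _ (gradY_isMeanZero v) i

theorem norm_curl0_le (v : MSpace d D n) : ‖curl0 v‖ ≤ ‖curlOp d D n v‖ := by
  rw [curlOp_apply]
  exact norm_le_norm_scaleSum _ (curlY_isMeanZero v)

theorem norm_curlY_le (v : MSpace d D n) (i : Fin n) : ‖curlY i v‖ ≤ ‖curlOp d D n v‖ := by
  rw [curlOp_apply]
  exact norm_apply_le_norm_scaleSum _ (curlY_isMeanZero v) i

theorem norm_fieldOp_le (v : MSpace d D n) :
    ‖fieldOp d D n v‖ ≤ ‖val0 v‖ + ∑ i, ‖gradY i v‖ := by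
  rw [fieldOp_apply]
  exact norm_scaleSum_le _ _

theorem norm_curlOp_le (v : MSpace d D n) :
    ‖curlOp d D n v‖ ≤ ‖curl0 v‖ + ∑ i, ‖curlY i v‖ := by
  rw [curlOp_apply]
  exact norm_scaleSum_le _ _

/-- Passing to the quotients by the kernels of gradient and curl is what makes this true; it is the
injectivity required for the Galerkin projection. -/
theorem eq_zero_of_fieldOp_curlOp (v : MSpace d D n) (h1 : fieldOp d D n v = 0)
    (h2 : curlOp d D n v = 0) : v = 0 := by
  have e1 : ‖fieldOp d D n v‖ = 0 := by rw [h1, norm_zero]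
  have e2 : ‖curlOp d D n v‖ = 0 := by rw [h2, norm_zero]
  exact v.ext_of_eq_zero (norm_le_zero_iff.1 (e1 ▸ norm_val0_le v))
    (norm_le_zero_iff.1 (e2 ▸ norm_curl0_le v))
    (fun i => norm_le_zero_iff.1 (e1 ▸ norm_gradY_le v i))
    fun i => norm_le_zero_iff.1 (e2 ▸ norm_curlY_le v i)

theorem formB_eq {α β : ℝ} {b : (Fin (n + 1) → Sp d) → Matrix (Fin d) (Fin d) ℝ} (hD : IsOpen D)
    (hb : IsCoeff d D n d α β b) (v w : MSpace d D n) :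
    formB b v w = coeffForm hD hb (fieldOp d D n v) (fieldOp d D n w) := by
  rw [coeffForm_apply, formB, fieldOp_apply, fieldOp_apply]
  refine integral_congr_ae ?_
  filter_upwards [scaleSum_coeFn (val0 v) fun i => gradY i v,
    scaleSum_coeFn (val0 w) fun i => gradY i w] with z h1 h2
  rw [h1, h2]
  rfl

theorem formA_eq {α β : ℝ}
    {a : (Fin (n + 1) → Sp d) → Matrix (Fin (curlDim d)) (Fin (curlDim d)) ℝ} (hD : IsOpen D)
    (ha : IsCoeff d D n (curlDim d) α β a) (v w : MSpace d D n) :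
    formA a v w = coeffForm hD ha (curlOp d D n v) (curlOp d D n w) := by
  rw [coeffForm_apply, formA, curlOp_apply, curlOp_apply]
  refine integral_congr_ae ?_
  filter_upwards [scaleSum_coeFn (curl0 v) fun i => curlY i v,
    scaleSum_coeFn (curl0 w) fun i => curlY i w] with z h1 h2
  rw [h1, h2]
  rfl

end Multiscale

/-! ### Linear combinations of sequences -/

section Sequences

variable {X : Type*} [NormedAddCommGroup X] [NormedSpace ℝ X]
  {Y : Type*} [NormedAddCommGroup Y] [NormedSpace ℝ Y] {Z : Type*} [NormedAddCommGroup Z]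

theorem map_dt (L : X →ₗ[ℝ] Y) (τ : ℝ) (r : ℕ → X) (m : ℕ) :
    dt τ (fun j => L (r j)) m = L (dt τ r m) := by
  simp [dt]

theorem map_half (L : X →ₗ[ℝ] Y) (r : ℕ → X) (m : ℕ) :
    half (fun j => L (r j)) m = L (half r m) := by
  simp [half]

theorem dt_add (τ : ℝ) (r s : ℕ → X) (m : ℕ) :
    dt τ (fun j => r j + s j) m = dt τ r m + dt τ s m := by
  simp only [dt]
  module

theorem half_add (r s : ℕ → X) (m : ℕ) :
    half (fun j => r j + s j) m = half r m + half s m := by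
  simp only [half]
  module

theorem norm_half_le {r : ℕ → X} {C : ℝ} {m : ℕ} (h : ∀ j ≤ m + 1, ‖r j‖ ≤ C) :
    ‖half r m‖ ≤ C := by
  have h1 := h (m + 1) le_rfl
  have h2 := h m (by omega)
  rw [half, norm_smul]
  norm_num
  linarith [norm_add_le (r (m + 1)) (r m)]

theorem maxNorm_nonneg (M : ℕ) (s : ℕ → Z) : 0 ≤ maxNorm M s :=
  Real.iSup_nonneg fun _ => norm_nonneg _

theorem le_maxNorm {M : ℕ} (s : ℕ → Z) {m : ℕ} (hm : m < M) : ‖s m‖ ≤ maxNorm M s :=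
  le_ciSup (f := fun m : Fin M => ‖s m‖) (finite_range _).bddAbove ⟨m, hm⟩

theorem maxNorm_le {M : ℕ} {s : ℕ → Z} {C : ℝ} (hM : 0 < M) (h : ∀ m < M, ‖s m‖ ≤ C) :
    maxNorm M s ≤ C := by
  have : Nonempty (Fin M) := ⟨⟨0, hM⟩⟩
  exact ciSup_le fun m => h m m.2

theorem maxNorm_le_add {M : ℕ} {s s₁ s₂ : ℕ → Z} (hM : 0 < M)
    (h : ∀ m < M, s m = s₁ m + s₂ m) : maxNorm M s ≤ maxNorm M s₁ + maxNorm M s₂ :=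
  maxNorm_le hM fun m hm => by
    rw [h m hm]
    exact (norm_add_le _ _).trans (add_le_add (le_maxNorm _ hm) (le_maxNorm _ hm))

end Sequences

/-! ### The homogenized equation pointwise in time -/

section Equation

variable {E : Type*} [NormedAddCommGroup E] [NormedSpace ℝ E]
  {K₁ : Type*} [NormedAddCommGroup K₁] [NormedSpace ℝ K₁] [CompleteSpace K₁]
  {K₂ : Type*} [NormedAddCommGroup K₂] [NormedSpace ℝ K₂] {α β : ℝ}

theorem IsEnergyForm.exists_clm {K : Type*} [NormedAddCommGroup K] [NormedSpace ℝ K]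
    {b : K →ₗ[ℝ] K →ₗ[ℝ] ℝ} (hb : IsEnergyForm α β b) (y : K) :
    ∃ l : K →L[ℝ] ℝ, ∀ x, l x = b x y := by
  refine ⟨(b.flip y).mkContinuous (β * ‖y‖) fun x => ?_, fun x => rfl⟩
  rw [Real.norm_eq_abs, abs_le']
  have h1 := hb.bounded x y
  have h2 := hb.bounded (-x) y
  rw [norm_neg, map_neg, LinearMap.neg_apply] at h2
  rw [LinearMap.flip_apply, mul_right_comm]
  exact ⟨h1, h2⟩

/-- The weak equation identifies second derivatives only almost everywhere. A third derivative makes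
`F 2` continuous, and the other terms are continuous as well, so the equation holds at every time,
in particular at the grid points sampled by the scheme. -/
theorem equation_pointwise {b : K₁ →ₗ[ℝ] K₁ →ₗ[ℝ] ℝ} {a : K₂ →ₗ[ℝ] K₂ →ₗ[ℝ] ℝ}
    {Φ : E →L[ℝ] K₁} {Ψ : E →L[ℝ] K₂} {T : ℝ} {k : ℕ} (hT : 0 < T) (hk : 3 ≤ k)
    (hb : IsEnergyForm α β b) (ha : IsEnergyForm α β a) {F : ℕ → ℝ → K₁} (hF : IsTimeChain T k F)
    {u : ℝ → E} (hF0 : ∀ t ∈ Icc 0 T, F 0 t = Φ (u t)) (hu : ContinuousOn u (Icc 0 T)) {v : E}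
    {ℓ : ℝ → ℝ} (hℓ : ContinuousOn ℓ (Icc 0 T))
    (h : HasTimeDeriv T 2 (fun t => b (Φ (u t)) (Φ v)) fun t => ℓ t - a (Ψ (u t)) (Ψ v)) :
    ∀ t ∈ Icc 0 T, b (F 2 t) (Φ v) + a (Ψ (u t)) (Ψ v) = ℓ t := by
  obtain ⟨lb, hlb⟩ := hb.exists_clm (Φ v)
  obtain ⟨la, hla⟩ := ha.exists_clm (Ψ v)
  have h1 : HasTimeDeriv T 2 (fun t => b (Φ (u t)) (Φ v)) fun t => lb (F 2 t) :=
    ((hF.mono (by omega : 2 ≤ k)).clm_comp lb).hasTimeDeriv fun t ht => by rw [hF0 t ht, hlb]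
  have h2 := h1.unique hT h
  have h3 : ContinuousOn (fun t => lb (F 2 t)) (Icc 0 T) :=
    lb.continuous.comp_continuousOn (hF.continuousOn (by omega))
  have h4 : ContinuousOn (fun t => ℓ t - a (Ψ (u t)) (Ψ v)) (Icc 0 T) := by
    refine hℓ.sub ?_
    have := (la.continuous.comp Ψ.continuous).comp_continuousOn hu
    exact this.congr fun t _ => (hla _).symm
  intro t ht
  have h5 : lb (F 2 t) = ℓ t - a (Ψ (u t)) (Ψ v) := eqOn_of_ae_eq hT h3 h4 h2 ht
  rw [← hlb, h5]
  ring

end Equation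

/-! ### Convergence of Galerkin projections -/

section GalerkinLimit

variable {E : Type*} [NormedAddCommGroup E] [NormedSpace ℝ E]
  {K : Type*} [NormedAddCommGroup K] [NormedSpace ℝ K] {T : ℝ} {k : ℕ}

/-- The operators do not depend on time, so R L maps the chain U to a chain. Its supremum is bounded
by its initial value, which converges pointwise, and the L² norm of its derivative, which converges
by domination. -/
theorem exists_sup_bound_tendsto [CompleteSpace E] [CompleteSpace K] {R : ℕ → E →L[ℝ] K} {C : ℝ}
    (hC : ∀ L x, ‖R L x‖ ≤ C * ‖x‖)
    (hR : ∀ x, Tendsto (fun L => R L x) atTop (𝓝 0)) {U : ℕ → ℝ → E} (hU : IsTimeChain T k U)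
    {j : ℕ} (hj : j < k) :
    ∃ s : ℕ → ℝ, Tendsto s atTop (𝓝 0) ∧ ∀ L, ∀ t ∈ Icc 0 T, ‖R L (U j t)‖ ≤ s L := by
  refine ⟨fun L => ‖R L (U j 0)‖ + √T * timeNorm T 2 fun t => R L (U (j + 1) t), ?_,
    fun L t ht => (hU.clm_comp (R L)).norm_le hj ht⟩
  simpa using (hR (U j 0)).norm.add
    ((tendsto_timeNorm_zero hC hR (hU.memLp (j + 1) hj)).const_mul (√T))

variable {K₁ : Type*} [NormedAddCommGroup K₁] [NormedSpace ℝ K₁]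
  {K₂ : Type*} [NormedAddCommGroup K₂] [NormedSpace ℝ K₂] {α β : ℝ}
  {b : K₁ →ₗ[ℝ] K₁ →ₗ[ℝ] ℝ} {a : K₂ →ₗ[ℝ] K₂ →ₗ[ℝ] ℝ} {Φ : E →L[ℝ] K₁} {Ψ : E →L[ℝ] K₂}

theorem galerkin_error_bound (hα : 0 < α) (hβ : 0 < β) (hb : IsEnergyForm α β b)
    (ha : IsEnergyForm α β a) {V : Submodule ℝ E} {x w v : E} (h : IsGalerkin b a Φ Ψ V x w)
    (hv : v ∈ V) :
    ‖Φ (w - x)‖ + ‖Ψ (w - x)‖ ≤ 2 * β / α * (‖Φ‖ + ‖Ψ‖) * ‖v - x‖ := by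
  refine (h.cea hα hβ hb ha hv).trans ?_
  rw [mul_assoc]
  gcongr
  rw [add_mul]
  exact add_le_add (Φ.le_opNorm _) (Ψ.le_opNorm _)

theorem tendsto_galerkin_error (hα : 0 < α) (hβ : 0 < β) (hb : IsEnergyForm α β b)
    (ha : IsEnergyForm α β a) {V : ℕ → Submodule ℝ E}
    (hV : ∀ x, ∀ ε > 0, ∃ L₀, ∀ L ≥ L₀, ∃ v ∈ V L, ‖v - x‖ < ε) {P : ℕ → E → E}
    (hP : ∀ L x, IsGalerkin b a Φ Ψ (V L) x (P L x)) (x : E) :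
    Tendsto (fun L => ‖Φ (P L x - x)‖ + ‖Ψ (P L x - x)‖) atTop (𝓝 0) := by
  rw [Metric.tendsto_atTop]
  intro ε hε
  set C := 2 * β / α * (‖Φ‖ + ‖Ψ‖) with hC
  have hC0 : 0 ≤ C := by positivity
  -- C may vanish, hence C + 1 in the denominator.
  obtain ⟨L₀, hL⟩ := hV x (ε / (C + 1)) (by positivity)
  refine ⟨L₀, fun L hL' => ?_⟩
  obtain ⟨v, hv, hvx⟩ := hL L hL'
  rw [Real.dist_0_eq_abs, abs_of_nonneg (by positivity)]
  have h1 := galerkin_error_bound hα hβ hb ha (hP L x) hv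
  rw [lt_div_iff₀ (by positivity)] at hvx
  have h2 := norm_nonneg (v - x)
  nlinarith

end GalerkinLimit

/-! ### Norms in time of sums -/

section TimeNormSum

variable {X : Type*} [NormedAddCommGroup X] {Y : Type*} [NormedAddCommGroup Y] {T : ℝ}

theorem timeNorm_add_le {f g : ℝ → X} (hf : MemLp f 2 (volume.restrict (Ioo 0 T)))
    (hg : MemLp g 2 (volume.restrict (Ioo 0 T))) :
    timeNorm T 2 (fun t => f t + g t) ≤ timeNorm T 2 f + timeNorm T 2 g := by
  rw [timeNorm, timeNorm, timeNorm, ← ENNReal.toReal_add hf.eLpNorm_ne_top hg.eLpNorm_ne_top]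
  exact ENNReal.toReal_mono (ENNReal.add_ne_top.2 ⟨hf.eLpNorm_ne_top, hg.eLpNorm_ne_top⟩)
    (eLpNorm_add_le hf.1 hg.1 (by norm_num))

theorem timeNorm_sum_le {ι : Type*} (s : Finset ι) {f : ι → ℝ → X}
    (hf : ∀ i, MemLp (f i) 2 (volume.restrict (Ioo 0 T))) :
    timeNorm T 2 (fun t => ∑ i ∈ s, f i t) ≤ ∑ i ∈ s, timeNorm T 2 (f i) := by
  classical
  induction s using Finset.induction_on with
  | empty => simp [timeNorm]
  | insert i s hi ih =>
    simp only [Finset.sum_insert hi]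
    exact (timeNorm_add_le (hf i) (memLp_finsetSum s fun j _ => hf j)).trans
      (add_le_add_right ih _)

theorem timeNorm_mono {p : ENNReal} {f : ℝ → X} {g : ℝ → Y}
    (hg : MemLp g p (volume.restrict (Ioo 0 T))) (h : ∀ t, ‖f t‖ ≤ ‖g t‖) :
    timeNorm T p f ≤ timeNorm T p g :=
  ENNReal.toReal_mono hg.eLpNorm_ne_top (eLpNorm_mono h)

end TimeNormSum

/-! ### Norms on the multiscale space -/

section MultiscaleNorms

variable {d : ℕ} {D : Set (Sp d)} {n : ℕ} {T : ℝ} {k : ℕ}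

theorem sum_le_card_mul {x : Fin n → ℝ} {C : ℝ} (h : ∀ i, x i ≤ C) : ∑ i, x i ≤ n * C := by
  have := Finset.sum_le_card_nsmul Finset.univ x C fun i _ => h i
  simpa using this

/-- The regularity assumptions concern the separate components, while the scheme is estimated
through their sum; the isometric embeddings carry the component chains to a chain of the sum. -/
theorem exists_field_chain {r : ℝ → MSpace d D n} (h : MemHFields T k r) :
    ∃ F : ℕ → ℝ → L2Y d D n d, IsTimeChain T k F ∧ (∀ t ∈ Icc 0 T, F 0 t = fieldOp d D n (r t)) ∧
      timeNorm T 2 (F k) ≤ derivNorm T k r := by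
  obtain ⟨U, hU, hU0, hUk⟩ := h.1.hasTimeDeriv.exists_chain
  choose G hG hG0 hGk using fun i => (h.2 i).hasTimeDeriv.exists_chain
  have h1 := hU.clm_comp (baseEmb D n d).toContinuousLinearMap
  have h2 := fun i : Fin n => (hG i).clm_comp (scaleEmb D d i.2).toContinuousLinearMap
  refine ⟨_, h1.add (IsTimeChain.sum Finset.univ h2), fun t ht => ?_, ?_⟩
  · rw [fieldOp_apply, hU0 t ht]
    simp only [fun i => hG0 i t ht]
    rfl
  · refine (timeNorm_add_le (h1.memLp k le_rfl)
      ((IsTimeChain.sum Finset.univ h2).memLp k le_rfl)).trans (add_le_add ?_ ?_)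
    · rw [hUk]
      refine timeNorm_mono (hUk ▸ hU.memLp k le_rfl) fun t => le_of_eq ?_
      exact (baseEmb D n d).norm_map _
    · refine (timeNorm_sum_le _ fun i => (h2 i).memLp k le_rfl).trans
        (Finset.sum_le_sum fun i _ => ?_)
      rw [hGk]
      refine timeNorm_mono (hGk i ▸ (hG i).memLp k le_rfl) fun t => le_of_eq ?_
      exact (scaleEmb D d i.2).norm_map _

/-- The converse passage from the sum to its n + 1 components, each bounded by the sum through
orthogonality of the scales. -/
theorem memHFields_of_chain {U : ℕ → ℝ → MSpace d D n} (hU : IsTimeChain T k U)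
    {r : ℝ → MSpace d D n} (hr : ∀ t ∈ Icc 0 T, U 0 t = r t) (hT : 0 < T) :
    MemHFields T k r ∧
      derivNorm T k r ≤ (n + 1) * timeNorm T 2 fun t => fieldOp d D n (U k t) := by
  have h1 : HasTimeDeriv T k (fun t => val0 (r t)) fun t => val0 (U k t) :=
    (hU.clm_comp val0L).hasTimeDeriv fun t ht => by rw [hr t ht]; rfl
  have h2 : ∀ i, HasTimeDeriv T k (fun t => gradY i (r t)) fun t => gradY i (U k t) := fun i =>
    (hU.clm_comp (gradYL i)).hasTimeDeriv fun t ht => by rw [hr t ht]; rfl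
  have hm : MemLp (fun t => fieldOp d D n (U k t)) 2 (volume.restrict (Ioo 0 T)) :=
    (fieldOp d D n).comp_memLp' (hU.memLp k le_rfl)
  refine ⟨⟨⟨_, h1⟩, fun i => ⟨_, h2 i⟩⟩, ?_⟩
  rw [derivNorm, timeNorm_congr (h1.timeDeriv_ae_eq hT), add_mul, one_mul, add_comm]
  refine add_le_add (sum_le_card_mul fun i => ?_) (timeNorm_mono hm fun t => norm_val0_le _)
  rw [timeNorm_congr ((h2 i).timeDeriv_ae_eq hT)]
  exact timeNorm_mono hm fun t => norm_gradY_le _ i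

theorem norm_fieldOp_le_supNorm {r : ℝ → MSpace d D n} (hT : 0 < T)
    (hr : ContinuousOn r (Icc 0 T)) {t : ℝ} (ht : t ∈ Icc 0 T) :
    ‖fieldOp d D n (r t)‖ ≤ supNorm T r := by
  refine (norm_fieldOp_le _).trans (add_le_add ?_ (Finset.sum_le_sum fun i _ => ?_))
  · exact norm_le_timeNorm_top (q := fun t => val0 (r t)) hT
      (continuous_val0.comp_continuousOn hr) ht
  · exact norm_le_timeNorm_top (q := fun t => gradY i (r t)) hT
      ((continuous_gradY i).comp_continuousOn hr) ht

theorem supNorm_le {r : ℝ → MSpace d D n} {C : ℝ} (hC : 0 ≤ C)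
    (h : ∀ t ∈ Icc 0 T, ‖fieldOp d D n (r t)‖ ≤ C) : supNorm T r ≤ (n + 1) * C := by
  rw [supNorm, add_mul, one_mul, add_comm]
  refine add_le_add (sum_le_card_mul fun i => ?_) ?_
  · exact timeNorm_top_le hC fun t ht =>
      (norm_gradY_le _ i).trans (h t ⟨ht.1.le, ht.2.le⟩)
  · exact timeNorm_top_le hC fun t ht => (norm_val0_le _).trans (h t ⟨ht.1.le, ht.2.le⟩)

theorem energyNorm_le {τ : ℝ} {M : ℕ} (hM : 0 < M) {r : ℕ → MSpace d D n} {C₁ C₂ : ℝ}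
    (h1 : ∀ m < M, ‖dt τ (fun j => fieldOp d D n (r j)) m‖ ≤ C₁)
    (h2 : ∀ m < M, ‖half (fun j => curlOp d D n (r j)) m‖ ≤ C₂) :
    energyNorm τ M r ≤ (n + 1) * (C₁ + C₂) := by
  have e1 : ∀ m < M, ‖fieldOp d D n (dt τ r m)‖ ≤ C₁ := fun m hm =>
    (congrArg norm (map_dt (fieldOp d D n).toLinearMap τ r m)).symm.trans_le (h1 m hm)
  have e2 : ∀ m < M, ‖curlOp d D n (half r m)‖ ≤ C₂ := fun m hm =>
    (congrArg norm (map_half (curlOp d D n).toLinearMap r m)).symm.trans_le (h2 m hm)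
  have a1 : maxNorm M (dt τ fun m => val0 (r m)) ≤ C₁ := maxNorm_le hM fun m hm => by
    rw [map_dt]
    exact (norm_val0_le _).trans (e1 m hm)
  have a2 : ∑ i, maxNorm M (dt τ fun m => gradY i (r m)) ≤ n * C₁ :=
    sum_le_card_mul fun i => maxNorm_le hM fun m hm => by
      rw [map_dt]
      exact (norm_gradY_le _ i).trans (e1 m hm)
  have a3 : maxNorm M (half fun m => curl0 (r m)) ≤ C₂ := maxNorm_le hM fun m hm => by
    rw [map_half]
    exact (norm_curl0_le _).trans (e2 m hm)
  have a4 : ∑ i, maxNorm M (half fun m => curlY i (r m)) ≤ n * C₂ :=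
    sum_le_card_mul fun i => maxNorm_le hM fun m hm => by
      rw [map_half]
      exact (norm_curlY_le _ i).trans (e2 m hm)
  rw [energyNorm]
  linarith

theorem energyNorm_nonneg (τ : ℝ) (M : ℕ) (r : ℕ → MSpace d D n) : 0 ≤ energyNorm τ M r :=
  add_nonneg (add_nonneg (add_nonneg (maxNorm_nonneg _ _)
    (Finset.sum_nonneg fun _ _ => maxNorm_nonneg _ _)) (maxNorm_nonneg _ _))
    (Finset.sum_nonneg fun _ _ => maxNorm_nonneg _ _)

theorem energyNorm_le_add {τ : ℝ} {M : ℕ} (hM : 0 < M) {r s₁ s₂ : ℕ → MSpace d D n}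
    (h : ∀ j, r j = s₁ j + s₂ j) :
    energyNorm τ M r ≤ energyNorm τ M s₁ + energyNorm τ M s₂ := by
  have a1 : maxNorm M (dt τ fun m => val0 (r m)) ≤ maxNorm M (dt τ fun m => val0 (s₁ m)) +
      maxNorm M (dt τ fun m => val0 (s₂ m)) := maxNorm_le_add hM fun m _ => by
    rw [← dt_add]
    simp only [h, map_add]
  have a2 : ∑ i, maxNorm M (dt τ fun m => gradY i (r m)) ≤
      ∑ i, maxNorm M (dt τ fun m => gradY i (s₁ m)) +
        ∑ i, maxNorm M (dt τ fun m => gradY i (s₂ m)) := by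
    rw [← Finset.sum_add_distrib]
    refine Finset.sum_le_sum fun i _ => maxNorm_le_add hM fun m _ => ?_
    rw [← dt_add]
    simp only [h, map_add]
  have a3 : maxNorm M (half fun m => curl0 (r m)) ≤ maxNorm M (half fun m => curl0 (s₁ m)) +
      maxNorm M (half fun m => curl0 (s₂ m)) := maxNorm_le_add hM fun m _ => by
    rw [← half_add]
    simp only [h, map_add]
  have a4 : ∑ i, maxNorm M (half fun m => curlY i (r m)) ≤
      ∑ i, maxNorm M (half fun m => curlY i (s₁ m)) +
        ∑ i, maxNorm M (half fun m => curlY i (s₂ m)) := by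
    rw [← Finset.sum_add_distrib]
    refine Finset.sum_le_sum fun i _ => maxNorm_le_add hM fun m _ => ?_
    rw [← half_add]
    simp only [h, map_add]
  rw [energyNorm, energyNorm, energyNorm]
  linarith

theorem le_initialNorm (τ : ℝ) (r : ℕ → MSpace d D n) :
    ‖dt τ (fun j => fieldOp d D n (r j)) 0‖ + ‖half (fun j => curlOp d D n (r j)) 0‖ ≤
      initialNorm τ r := by
  have e1 := norm_fieldOp_le (dt τ r 0)
  have e2 := norm_curlOp_le (half r 0)
  simp only [← map_dt, ← map_half] at e1 e2
  have e3 : dt τ (fun j => fieldOp d D n (r j)) 0 = fieldOp d D n (dt τ r 0) :=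
    map_dt (fieldOp d D n).toLinearMap τ r 0
  have e4 : half (fun j => curlOp d D n (r j)) 0 = curlOp d D n (half r 0) :=
    map_half (curlOp d D n).toLinearMap r 0
  rw [initialNorm, e3, e4]
  linarith

end MultiscaleNorms

/-! ### Finite element hierarchies -/

section Hierarchy

variable {d : ℕ} {D : Set (Sp d)} {n : ℕ}

theorem FEHierarchy.mem_VL (S : FEHierarchy d D n) (L : ℕ) (v : MSpace d D n) :
    v ∈ S.VL L ↔ v.1 ∈ S.W0 L ∧ (∀ i, v.2.1 i ∈ S.Wc i L) ∧ ∀ i, v.2.2 i ∈ S.Vc i L := by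
  simp [FEHierarchy.VL, Submodule.mem_prod, Submodule.mem_pi]

theorem FEHierarchy.finiteDimensional_VL (S : FEHierarchy d D n) (L : ℕ) :
    FiniteDimensional ℝ (S.VL L) := by
  have := S.fin_W0 L
  have := fun i => S.fin_Wc i L
  have := fun i => S.fin_Vc i L
  let g : (S.W0 L × (((i : Fin n) → S.Wc i L) × ((i : Fin n) → S.Vc i L))) →ₗ[ℝ] MSpace d D n :=
    (S.W0 L).subtype.prodMap
      ((LinearMap.pi fun i => (S.Wc i L).subtype ∘ₗ LinearMap.proj i).prodMap
        (LinearMap.pi fun i => (S.Vc i L).subtype ∘ₗ LinearMap.proj i))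
  have h : S.VL L ≤ LinearMap.range g := by
    intro v hv
    obtain ⟨h0, h1, h2⟩ := (S.mem_VL L v).1 hv
    exact ⟨(⟨v.1, h0⟩, (fun i => ⟨v.2.1 i, h1 i⟩, fun i => ⟨v.2.2 i, h2 i⟩)), rfl⟩
  exact Submodule.finiteDimensional_of_le h

/-- By monotonicity one approximant lies in all later subspaces, so finitely many components can be
approximated at a common level. -/
theorem exists_mem_norm_sub_lt {X : Type*} [NormedAddCommGroup X] [NormedSpace ℝ X]
    {S : ℕ → Submodule ℝ X} (hS : Monotone S) (hd : Dense (⋃ L, (S L : Set X))) (x : X) {ε : ℝ}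
    (hε : 0 < ε) : ∃ L₀, ∃ v, (∀ L ≥ L₀, v ∈ S L) ∧ ‖v - x‖ < ε := by
  obtain ⟨v, hv, hvx⟩ := Metric.dense_iff.1 hd x ε hε
  obtain ⟨L₀, hL⟩ := mem_iUnion.1 hvx
  exact ⟨L₀, v, fun L h => hS h hL, by rwa [← dist_eq_norm]⟩

theorem FEHierarchy.exists_approx (S : FEHierarchy d D n) (hS : S.IsDense) (x : MSpace d D n)
    (ε : ℝ) (hε : 0 < ε) : ∃ L₀, ∀ L ≥ L₀, ∃ v ∈ S.VL L, ‖v - x‖ < ε := by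
  obtain ⟨L0, v0, h0, e0⟩ := exists_mem_norm_sub_lt S.mono_W0 hS.1 x.1 hε
  choose L1 v1 h1 e1 using fun i => exists_mem_norm_sub_lt (S.mono_Wc i) (hS.2.1 i) (x.2.1 i) hε
  choose L2 v2 h2 e2 using fun i => exists_mem_norm_sub_lt (S.mono_Vc i) (hS.2.2 i) (x.2.2 i) hε
  refine ⟨max L0 (max (Finset.univ.sup L1) (Finset.univ.sup L2)), fun L hL => ?_⟩
  have l1 : ∀ i, L1 i ≤ L := fun i => (Finset.le_sup (Finset.mem_univ i)).trans
    ((le_max_left _ _).trans ((le_max_right _ _).trans hL))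
  have l2 : ∀ i, L2 i ≤ L := fun i => (Finset.le_sup (Finset.mem_univ i)).trans
    ((le_max_right _ _).trans ((le_max_right _ _).trans hL))
  refine ⟨(v0, (v1, v2)), (S.mem_VL L _).2 ⟨h0 L ((le_max_left _ _).trans hL),
    fun i => h1 i L (l1 i), fun i => h2 i L (l2 i)⟩, ?_⟩
  rw [Prod.norm_def, Prod.norm_def]
  exact max_lt e0 (max_lt ((pi_norm_lt_iff hε).2 e1) ((pi_norm_lt_iff hε).2 e2))

end Hierarchy

/-! ### The projection error in time -/

section Residual

variable {E : Type*} [NormedAddCommGroup E] [NormedSpace ℝ E]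
  {K₁ : Type*} [NormedAddCommGroup K₁] [NormedSpace ℝ K₁]
  {K₂ : Type*} [NormedAddCommGroup K₂] [NormedSpace ℝ K₂] {T α β : ℝ}
  {b : K₁ →ₗ[ℝ] K₁ →ₗ[ℝ] ℝ} {a : K₂ →ₗ[ℝ] K₂ →ₗ[ℝ] ℝ} {Φ : E →L[ℝ] K₁} {Ψ : E →L[ℝ] K₂}

/-- The projection error as a continuous linear map. -/
noncomputable def residual (P : E →L[ℝ] E) :
    E →L[ℝ] E :=
  P - ContinuousLinearMap.id ℝ E

theorem residual_apply (P : E →L[ℝ] E)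
    (x : E) : residual P x = P x - x := rfl

theorem residual_chain [CompleteSpace E]
    {U : ℕ → ℝ → E} {u w : ℝ → E} {k : ℕ} (hU : IsTimeChain T k U)
    (hU0 : ∀ t ∈ Icc 0 T, U 0 t = u t) {P : E →L[ℝ] E} (hw : ∀ t ∈ Icc 0 T, w t = P (u t)) :
    IsTimeChain T k (fun j t => residual P (U j t)) ∧
      ∀ t ∈ Icc 0 T, residual P (U 0 t) = w t - u t :=
  ⟨hU.clm_comp _, fun t ht => by rw [hU0 t ht, hw t ht, residual_apply]⟩

/-- Céa's estimate with the competitor 0 bounds Φ(P - 1) and Ψ(P - 1) uniformly in L; density makes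
them tend to zero pointwise. A single sequence, the sum of the separate bounds, controls all the
quantities. -/
theorem exists_residual_bound_tendsto [CompleteSpace E] [CompleteSpace K₁] [CompleteSpace K₂]
    (hα : 0 < α) (hβ : 0 < β) (hb : IsEnergyForm α β b) (ha : IsEnergyForm α β a)
    {V : ℕ → Submodule ℝ E} (hV : ∀ x, ∀ ε > 0, ∃ L₀, ∀ L ≥ L₀, ∃ v ∈ V L, ‖v - x‖ < ε)
    {P : ℕ → E →L[ℝ] E} (hP : ∀ L x, IsGalerkin b a Φ Ψ (V L) x (P L x)) {U : ℕ → ℝ → E}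
    (hU : IsTimeChain T 2 U) (hT : 0 < T) :
    ∃ s : ℕ → ℝ, Tendsto s atTop (𝓝 0) ∧ ∀ L,
      (∀ t ∈ Icc 0 T, ‖Φ (residual (P L) (U 0 t))‖ ≤ s L) ∧
      (∀ t ∈ Icc 0 T, ‖Φ (residual (P L) (U 1 t))‖ ≤ s L) ∧
      (∀ t ∈ Icc 0 T, ‖Ψ (residual (P L) (U 0 t))‖ ≤ s L) ∧
      timeNorm T 2 (fun t => Φ (residual (P L) (U 2 t))) ≤ s L := by
  have hlim := tendsto_galerkin_error hα hβ hb ha hV hP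
  set C := 2 * β / α * (‖Φ‖ + ‖Ψ‖)
  have hbd : ∀ L x, ‖Φ (P L x - x)‖ + ‖Ψ (P L x - x)‖ ≤ C * ‖x‖ := fun L x => by
    have := galerkin_error_bound hα hβ hb ha (hP L x) (V L).zero_mem
    rwa [zero_sub, norm_neg] at this
  have hC1 : ∀ L x, ‖(Φ ∘L residual (P L)) x‖ ≤ C * ‖x‖ := fun L x =>
    (le_add_of_nonneg_right (norm_nonneg _)).trans (hbd L x)
  have hC2 : ∀ L x, ‖(Ψ ∘L residual (P L)) x‖ ≤ C * ‖x‖ := fun L x =>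
    (le_add_of_nonneg_left (norm_nonneg _)).trans (hbd L x)
  have hR1 : ∀ x, Tendsto (fun L => (Φ ∘L residual (P L)) x) atTop (𝓝 0) := fun x =>
    squeeze_zero_norm (fun L => le_add_of_nonneg_right (norm_nonneg _)) (hlim x)
  have hR2 : ∀ x, Tendsto (fun L => (Ψ ∘L residual (P L)) x) atTop (𝓝 0) := fun x =>
    squeeze_zero_norm (fun L => le_add_of_nonneg_left (norm_nonneg _)) (hlim x)
  obtain ⟨s0, hs0, b0⟩ := exists_sup_bound_tendsto hC1 hR1 hU two_pos
  obtain ⟨s1, hs1, b1⟩ := exists_sup_bound_tendsto hC1 hR1 hU one_lt_two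
  obtain ⟨s2, hs2, b2⟩ := exists_sup_bound_tendsto hC2 hR2 hU two_pos
  have hs := tendsto_timeNorm_zero hC1 hR1 (hU.memLp 2 le_rfl)
  have m0 : (0 : ℝ) ∈ Icc 0 T := ⟨le_rfl, hT.le⟩
  refine ⟨fun L => s0 L + s1 L + s2 L + timeNorm T 2 fun t => (Φ ∘L residual (P L)) (U 2 t),
    by simpa using ((hs0.add hs1).add hs2).add hs, fun L => ?_⟩
  have p0 := (norm_nonneg _).trans (b0 L 0 m0)
  have p1 := (norm_nonneg _).trans (b1 L 0 m0)
  have p2 := (norm_nonneg _).trans (b2 L 0 m0)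
  have p3 := timeNorm_nonneg (T := T) 2 fun t => (Φ ∘L residual (P L)) (U 2 t)
  refine ⟨fun t ht => (b0 L t ht).trans ?_, fun t ht => (b1 L t ht).trans ?_,
    fun t ht => (b2 L t ht).trans ?_, le_add_of_nonneg_left (by positivity)⟩
  all_goals linarith

theorem sum_avg_le {q : ℕ → E} {M : ℕ} {C : ℝ} (hT : 0 < T) (hM : 0 < M)
    (h : ∀ j ≤ M, ‖q j‖ ≤ C) :
    T / M * ∑ m ∈ Finset.Ico 1 M, ‖avg (1 / 4) q m‖ ≤ T * C := by
  have hM' : (0 : ℝ) < M := by exact_mod_cast hM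
  have h0 : 0 ≤ C := (norm_nonneg _).trans (h 0 hM.le)
  have hs : ∑ m ∈ Finset.Ico 1 M, ‖avg (1 / 4) q m‖ ≤ M * C := by
    refine (Finset.sum_le_card_nsmul _ _ C fun m hm => ?_).trans ?_
    · rw [Finset.mem_Ico] at hm
      exact norm_avg_le fun j hj => h j (by omega)
    · rw [nsmul_eq_mul, Nat.card_Ico]
      gcongr
      omega
  calc _ ≤ T / M * (M * C) := by gcongr
    _ = _ := by field_simp

theorem sum_dt2_congr {q r : ℕ → E} {τ : ℝ} {M : ℕ} (h : ∀ j ≤ M, q j = r j) :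
    ∑ m ∈ Finset.Ico 1 M, ‖dt2 τ q m‖ = ∑ m ∈ Finset.Ico 1 M, ‖dt2 τ r m‖ := by
  refine Finset.sum_congr rfl fun m hm => ?_
  rw [Finset.mem_Ico] at hm
  simp only [dt2]
  rw [h _ (by omega), h _ (by omega), h _ (by omega)]

end Residual

/-- The constant of the error estimates. -/
noncomputable def errorConst (n : ℕ) (T α β : ℝ) : ℝ :=
  (n + 1) * (2 / √α) * (√β + 2 * β / √α * (4 * √T + T)) + 1

theorem errorConst_pos (n : ℕ) {T α β : ℝ} (hT : 0 < T) (hα : 0 < α) (hβ : 0 < β) :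
    0 < errorConst n T α β := by
  rw [errorConst]
  positivity

/-- The three weights 4√T, 2√T and T are all at most 4√T + T. The factor n + 1 counts components,
and 2/√α comes from bounding the field and curl parts separately. -/
theorem stability_le_errorConst (n : ℕ) {T α β : ℝ} (hT : 0 < T) (hα : 0 < α) (hβ : 0 < β)
    {I A B C : ℝ} (hI : 0 ≤ I) (hA : 0 ≤ A) (hB : 0 ≤ B) (hC : 0 ≤ C) :
    (n + 1) * ((√β * I + 2 * β / √α * (4 * √T * A + 2 * (√T * B) + T * C)) / √α +
      (√β * I + 2 * β / √α * (4 * √T * A + 2 * (√T * B) + T * C)) / √α) ≤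
      errorConst n T α β * (A + B + C) + errorConst n T α β * I := by
  set Q := A + B + C with hQ
  have hQ0 : 0 ≤ Q := by positivity
  have hR : 4 * √T * A + 2 * (√T * B) + T * C ≤ (4 * √T + T) * Q := by
    have p1 : 0 ≤ √T * B := by positivity
    have p2 : 0 ≤ √T * C := by positivity
    have p3 : 0 ≤ T * A := by positivity
    have p4 : 0 ≤ T * B := by positivity
    rw [hQ]
    linarith
  have h1 : (n + 1) * ((√β * I + 2 * β / √α * (4 * √T * A + 2 * (√T * B) + T * C)) / √α +
      (√β * I + 2 * β / √α * (4 * √T * A + 2 * (√T * B) + T * C)) / √α) ≤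
      (n + 1) * ((√β * I + 2 * β / √α * ((4 * √T + T) * Q)) / √α +
      (√β * I + 2 * β / √α * ((4 * √T + T) * Q)) / √α) := by gcongr
  refine h1.trans ?_
  rw [errorConst, ← mul_add]
  have p1 : 0 ≤ (n + 1) * (2 / √α) * (√β * Q) := by positivity
  have p2 : 0 ≤ (n + 1) * (2 / √α) * (2 * β / √α * (4 * √T + T) * I) := by positivity
  have e : ∀ X : ℝ, (n + 1 : ℝ) * (X / √α + X / √α) = (n + 1) * (2 / √α) * X := fun X => by ring
  rw [e]
  linarith

theorem continuousOn_of_memHTime {X : Type*} [NormedAddCommGroup X] [NormedSpace ℝ X] {T : ℝ}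
    {k : ℕ} (hk : 0 < k) {u : ℝ → X} (h : MemHTime T k u) : ContinuousOn u (Icc 0 T) := by
  obtain ⟨g, hg⟩ := h
  obtain ⟨U, hU, hU0, -⟩ := hg.exists_chain
  exact (hU.continuousOn hk).congr fun t ht => (hU0 t ht).symm

/-! ### Error estimates for the multiscale Maxwell wave equation -/

section Main

variable {d : ℕ} {D : Set (Sp d)} {n : ℕ} {T α β : ℝ}
  {a : (Fin (n + 1) → Sp d) → Matrix (Fin (curlDim d)) (Fin (curlDim d)) ℝ}
  {b : (Fin (n + 1) → Sp d) → Matrix (Fin d) (Fin d) ℝ}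

theorem derivNorm_nonneg (T : ℝ) (k : ℕ) (r : ℝ → MSpace d D n) : 0 ≤ derivNorm T k r :=
  add_nonneg (timeNorm_nonneg _ _) (Finset.sum_nonneg fun _ _ => timeNorm_nonneg _ _)

theorem supNorm_nonneg (T : ℝ) (r : ℝ → MSpace d D n) : 0 ≤ supNorm T r :=
  add_nonneg (timeNorm_nonneg _ _) (Finset.sum_nonneg fun _ _ => timeNorm_nonneg _ _)

theorem IsEllipticProj.isGalerkin (hD : IsOpen D) (ha : IsCoeff d D n (curlDim d) α β a)
    (hb : IsCoeff d D n d α β b) {V : Submodule ℝ (MSpace d D n)} {u w : ℝ → MSpace d D n}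
    (h : IsEllipticProj T a b V u w) {t : ℝ} (ht : t ∈ Icc 0 T) :
    IsGalerkin (coeffForm hD hb) (coeffForm hD ha) (fieldOp d D n) (curlOp d D n) V (u t)
      (w t) := by
  refine ⟨(h t ht).1, fun v hv => ?_⟩
  rw [← formB_eq, ← formA_eq]
  exact (h t ht).2 v hv

/-- The elliptic projection is given, at all times, by a continuous linear map. -/
theorem IsEllipticProj.exists_clm (hα : 0 < α) (hβ : 0 < β) (hD : IsOpen D)
    (ha : IsCoeff d D n (curlDim d) α β a) (hb : IsCoeff d D n d α β b)
    (V : Submodule ℝ (MSpace d D n)) [FiniteDimensional ℝ V] :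
    ∃ P : MSpace d D n →L[ℝ] MSpace d D n,
      (∀ x, IsGalerkin (coeffForm hD hb) (coeffForm hD ha) (fieldOp d D n) (curlOp d D n) V x
        (P x)) ∧
      ∀ u w : ℝ → MSpace d D n, IsEllipticProj T a b V u w → ∀ t ∈ Icc 0 T, w t = P (u t) := by
  have hB := coeffForm_isEnergyForm hD hβ hb
  have hA := coeffForm_isEnergyForm hD hβ ha
  obtain ⟨P, hP⟩ := exists_galerkin_projection hα hβ hB hA eq_zero_of_fieldOp_curlOp V
  exact ⟨P, hP, fun u w h t ht =>
    (h.isGalerkin hD ha hb ht).eq hα hβ hB hA eq_zero_of_fieldOp_curlOp (hP (u t))⟩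

theorem IsSolution.pointwise (hT : 0 < T) (hβ : 0 < β) (hD : IsOpen D)
    (ha : IsCoeff d D n (curlDim d) α β a) (hb : IsCoeff d D n d α β b) {f : ℝ → L2D d D d}
    (hf : ContinuousOn f (Icc 0 T)) {u : ℝ → MSpace d D n} (hu : MemHTime T 2 u)
    (hsol : IsSolution T a b f u) {k : ℕ} (hk : 3 ≤ k) {F : ℕ → ℝ → L2Y d D n d}
    (hF : IsTimeChain T k F) (hF0 : ∀ t ∈ Icc 0 T, F 0 t = fieldOp d D n (u t)) {t : ℝ}
    (ht : t ∈ Icc 0 T) (v : MSpace d D n) :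
    coeffForm hD hb (F 2 t) (fieldOp d D n v)
      + coeffForm hD ha (curlOp d D n (u t)) (curlOp d D n v) = inner ℝ (f t) (val0 v) := by
  have hc : ContinuousOn (fun t => (inner ℝ (f t) (val0 v) : ℝ)) (Icc 0 T) :=
    ContinuousOn.inner (𝕜 := ℝ) hf continuousOn_const
  refine equation_pointwise hT hk (coeffForm_isEnergyForm hD hβ hb)
    (coeffForm_isEnergyForm hD hβ ha) hF hF0 (continuousOn_of_memHTime two_pos hu) hc ?_ t ht
  have := hsol v
  simp only [formB_eq hD hb, formA_eq hD ha] at this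
  exact this

theorem IsDiscreteSolution.equation (hD : IsOpen D)
    (ha : IsCoeff d D n (curlDim d) α β a) (hb : IsCoeff d D n d α β b) {f : ℝ → L2D d D d}
    {V : Submodule ℝ (MSpace d D n)} {M : ℕ} {U : ℕ → MSpace d D n}
    (hU : IsDiscreteSolution T a b f V M U) {m : ℕ} (h1 : 1 ≤ m) (h2 : m < M)
    {v : MSpace d D n} (hv : v ∈ V) :
    coeffForm hD hb (fieldOp d D n (dt2 (T / M) U m)) (fieldOp d D n v)
      + coeffForm hD ha (curlOp d D n (avg (1 / 4) U m)) (curlOp d D n v) =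
      avg (1 / 4) (fun j => (inner ℝ (f (j * (T / M))) (val0 v) : ℝ)) m := by
  have := hU.2 m h1 h2 v hv
  rw [formB_eq hD hb, formA_eq hD ha, ← MeasureTheory.L2.inner_def] at this
  rw [this]
  simp only [avg, inner_add_left, real_inner_smul_left, smul_eq_mul]

/-- The first and second order estimates differ only in the consistency bound, so this bound enters
as a hypothesis with order factor δ. -/
theorem error_estimate (hT : 0 < T) (hα : 0 < α) (hβ : 0 < β) (hD : IsOpen D)
    (ha : IsCoeff d D n (curlDim d) α β a) (hb : IsCoeff d D n d α β b)
    {V : Submodule ℝ (MSpace d D n)} [FiniteDimensional ℝ V] {f : ℝ → L2D d D d}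
    (hf : ContinuousOn f (Icc 0 T)) {u : ℝ → MSpace d D n} (hu : MemHTime T 2 u)
    (hsol : IsSolution T a b f u) {w : ℝ → MSpace d D n} (hw : IsEllipticProj T a b V u w)
    {k : ℕ} (hk : 3 ≤ k) (huk : MemHFields T k u) {M : ℕ} (hM : 0 < M) {δ : ℝ}
    (hδ : 0 ≤ δ)
    (hcons : ∀ F : ℕ → ℝ → L2Y d D n d, IsTimeChain T k F →
      T / M * ∑ m ∈ Finset.Ico 1 M, ‖avg (1 / 4) (fun j => F 2 (j * (T / M))) m
        - dt2 (T / M) (fun j => F 0 (j * (T / M))) m‖ ≤ 4 * √T * (δ * timeNorm T 2 (F k)))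
    {U : ℕ → MSpace d D n} (hU : IsDiscreteSolution T a b f V M U) :
    MemHFields T 2 (fun t => w t - u t) ∧
      energyNorm (T / M) M (fun m => U m - u (m * (T / M))) ≤
        errorConst n T α β * (δ * derivNorm T k u + derivNorm T 2 (fun t => w t - u t)
            + supNorm T (fun t => w t - u t))
          + errorConst n T α β * initialNorm (T / M) (fun m => U m - w (m * (T / M)))
          + energyNorm (T / M) M (fun m => w (m * (T / M)) - u (m * (T / M))) := by
  have huc := continuousOn_of_memHTime two_pos hu
  obtain ⟨P, -, hP⟩ := IsEllipticProj.exists_clm (T := T) hα hβ hD ha hb V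
  obtain ⟨g, hg⟩ := id hu
  obtain ⟨U', hU', hU0', -⟩ := hg.exists_chain
  -- The projection error is the image of the chain of u under the fixed operator P - 1; this yields
  -- its two time derivatives.
  obtain ⟨hQ, hQ0⟩ := residual_chain hU' hU0' (hP u w hw)
  have hqc : ContinuousOn (fun t => w t - u t) (Icc 0 T) :=
    (hQ.continuousOn two_pos).congr fun t ht => (hQ0 t ht).symm
  have hq2 := (memHFields_of_chain hQ hQ0 hT).1
  refine ⟨hq2, ?_⟩
  obtain ⟨F, hF, hF0, hFk⟩ := exists_field_chain huk
  obtain ⟨G, hG, hG0, hGk⟩ := exists_field_chain hq2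
  have main := scheme_estimate (ℓ := fun t v => inner ℝ (f t) (val0 v)) hα hβ
    (coeffForm_isEnergyForm hD hβ hb) (coeffForm_isEnergyForm hD hβ ha) hT hF0
    (fun t ht v _ => hsol.pointwise hT hβ hD ha hb hf hu hk hF hF0 ht v)
    (fun t ht => hw.isGalerkin hD ha hb ht) hM hU.1
    fun m h1 h2 v hv => hU.equation hD ha hb h1 h2 hv
  have r1 := (hcons F hF).trans (by gcongr : 4 * √T * (δ * timeNorm T 2 (F k)) ≤
    4 * √T * (δ * derivNorm T k u))
  have r2 : T / M * ∑ m ∈ Finset.Ico 1 M,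
      ‖dt2 (T / M) (fun j => fieldOp d D n (w (j * (T / M)) - u (j * (T / M)))) m‖ ≤
        2 * (√T * derivNorm T 2 fun t => w t - u t) := by
    -- The chain G agrees with the field of w - u only on [0, T], which contains all grid points
    -- involved.
    rw [← sum_dt2_congr fun j hj => hG0 _ (grid_mem hT.le hM hj)]
    exact (hG.sum_dt2_le le_rfl hT hM).trans (by gcongr)
  have r3 := sum_avg_le hT hM fun j (hj : j ≤ M) =>
    norm_fieldOp_le_supNorm hT hqc (grid_mem hT.le hM hj)
  have hsα : 0 < √α := Real.sqrt_pos.2 hα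
  have hI0 := le_initialNorm (T / M) fun m => U m - w (m * (T / M))
  have hI00 := (by positivity : (0 : ℝ) ≤ _ + _).trans hI0
  have bound : ∀ ⦃z I I' R R' : ℝ⦄, √α * z ≤ √β * I' + 2 * β / √α * R → I' ≤ I → R ≤ R' →
      z ≤ (√β * I + 2 * β / √α * R') / √α := by
    intro z I I' R R' h1 h2 h3
    rw [le_div_iff₀ hsα, mul_comm]
    refine h1.trans ?_
    gcongr
  have hRR := add_le_add (add_le_add r1 r2) r3
  have hp := energyNorm_le hM (fun m hm => bound (main m hm).1 hI0 hRR)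
    fun m hm => bound (main m hm).2 hI0 hRR
  have htri := energyNorm_le_add (τ := T / M) (r := fun m => U m - u (m * (T / M)))
    (s₁ := fun m => U m - w (m * (T / M))) (s₂ := fun m => w (m * (T / M)) - u (m * (T / M))) hM
    fun j => (sub_add_sub_cancel _ _ _).symm
  refine htri.trans (add_le_add_left (hp.trans ?_) _)
  exact stability_le_errorConst n hT hα hβ hI00 (mul_nonneg hδ (derivNorm_nonneg _ _ _))
    (derivNorm_nonneg _ _ _) (supNorm_nonneg _ _)

/-- Needs only u ∈ H²(0, T; V). The bound is uniform in M because difference quotients are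
controlled by the supremum of the first derivative and averages by the supremum of the function. -/
theorem projectionError_tendsto (hT : 0 < T) (hα : 0 < α) (hβ : 0 < β) (hD : IsOpen D)
    (ha : IsCoeff d D n (curlDim d) α β a) (hb : IsCoeff d D n d α β b)
    {S : FEHierarchy d D n} (hS : S.IsDense) {u : ℝ → MSpace d D n} (hu : MemHTime T 2 u)
    {w : ℕ → ℝ → MSpace d D n} (hw : ∀ L, IsEllipticProj T a b (S.VL L) u (w L)) :
    ∃ e : ℕ → ℝ, Tendsto e atTop (𝓝 0) ∧ ∀ L,
      derivNorm T 2 (fun t => w L t - u t) + supNorm T (fun t => w L t - u t) ≤ e L ∧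
      ∀ M : ℕ, 0 < M →
        energyNorm (T / M) M (fun m => w L (m * (T / M)) - u (m * (T / M))) ≤ e L := by
  obtain ⟨g, hg⟩ := hu
  obtain ⟨U, hU, hU0, -⟩ := hg.exists_chain
  have hfin := S.finiteDimensional_VL
  choose P hP hPw using fun L => IsEllipticProj.exists_clm (T := T) hα hβ hD ha hb (S.VL L)
  obtain ⟨s, hs, hsL⟩ := exists_residual_bound_tendsto hα hβ (coeffForm_isEnergyForm hD hβ hb)
    (coeffForm_isEnergyForm hD hβ ha) (S.exists_approx hS) hP hU hT
  refine ⟨fun L => (n + 1) * (s L + s L), by simpa using (hs.add hs).const_mul ((n : ℝ) + 1),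
    fun L => ?_⟩
  obtain ⟨b0, b1, b2, b3⟩ := hsL L
  obtain ⟨hQ, hQ0⟩ := residual_chain hU hU0 (hPw L u (w L) (hw L))
  have p0 : 0 ≤ s L := (norm_nonneg _).trans (b0 0 ⟨le_rfl, hT.le⟩)
  refine ⟨?_, fun M hM => ?_⟩
  · refine le_of_le_of_eq ?_ (mul_add _ _ _).symm
    refine add_le_add ((memHFields_of_chain hQ hQ0 hT).2.trans (by gcongr)) (supNorm_le p0 ?_)
    intro t ht
    rw [← hQ0 t ht]
    exact b0 t ht
  · have hgrid : ∀ j ≤ M, w L (j * (T / M)) - u (j * (T / M)) =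
        residual (P L) (U 0 (j * (T / M))) := fun j hj => (hQ0 _ (grid_mem hT.le hM hj)).symm
    refine energyNorm_le hM (fun m hm => ?_) fun m hm => ?_
    · have := norm_dt_le (hQ.clm_comp (fieldOp d D n)) le_rfl b1 hT hm
      refine le_of_eq_of_le ?_ this
      simp only [dt]
      rw [hgrid _ hm, hgrid _ hm.le]
    · refine norm_half_le fun j hj => ?_
      rw [hgrid j (by omega)]
      exact b2 _ (grid_mem hT.le hM (by omega))

end Main

end MaxwellWave

/-! ### Assembly: the two error estimates and convergence. -/

theorem mainTheorem10 (d n : ℕ) (hd : d = 2 ∨ d = 3) (T α β : ℝ) (hT : 0 < T) (hα : 0 < α)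
    (hβ : 0 < β) :
    ∃ c : ℝ, 0 < c ∧
      ∀ (D : Set (Sp d)), IsOpen D → IsConnected D → Bornology.IsBounded D →
      ∀ (a : (Fin (n + 1) → Sp d) → Matrix (Fin (curlDim d)) (Fin (curlDim d)) ℝ)
        (b : (Fin (n + 1) → Sp d) → Matrix (Fin d) (Fin d) ℝ),
      IsCoeff d D n (curlDim d) α β a → IsCoeff d D n d α β b →
      ∀ (S : FEHierarchy d D n)
        (f : ℝ → L2D d D d), ContinuousOn f (Icc 0 T) →
      ∀ u : ℝ → MSpace d D n, MemHTime T 2 u → IsSolution T a b f u →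
      ∀ w : ℕ → ℝ → MSpace d D n, (∀ L, IsEllipticProj T a b (S.VL L) u (w L)) →
        -- first order in time
        (MemHFields T 3 u →
          ∀ L M : ℕ, 0 < M →
          ∀ U : ℕ → MSpace d D n, IsDiscreteSolution T a b f (S.VL L) M U →
            MemHFields T 2 (fun t => w L t - u t) ∧
            energyNorm (T / M) M (fun m => U m - u (m * (T / M))) ≤
              c * ((T / M) * derivNorm T 3 u + derivNorm T 2 (fun t => w L t - u t)
                  + supNorm T (fun t => w L t - u t))
                + c * initialNorm (T / M) (fun m => U m - w L (m * (T / M)))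
                + energyNorm (T / M) M (fun m => w L (m * (T / M)) - u (m * (T / M)))) ∧
        -- second order in time
        (MemHFields T 4 u →
          ∀ L M : ℕ, 0 < M →
          ∀ U : ℕ → MSpace d D n, IsDiscreteSolution T a b f (S.VL L) M U →
            MemHFields T 2 (fun t => w L t - u t) ∧
            energyNorm (T / M) M (fun m => U m - u (m * (T / M))) ≤
              c * ((T / M) ^ 2 * derivNorm T 4 u + derivNorm T 2 (fun t => w L t - u t)
                  + supNorm T (fun t => w L t - u t))
                + c * initialNorm (T / M) (fun m => U m - w L (m * (T / M)))
                + energyNorm (T / M) M (fun m => w L (m * (T / M)) - u (m * (T / M)))) ∧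
        -- convergence
        (MemHFields T 3 u → S.IsDense →
          ∀ L M : ℕ → ℕ, (∀ k, 0 < M k) → Tendsto L atTop atTop → Tendsto M atTop atTop →
          ∀ U : ℕ → ℕ → MSpace d D n,
            (∀ k, IsDiscreteSolution T a b f (S.VL (L k)) (M k) (U k)) →
            Tendsto (fun k => initialNorm (T / M k)
              (fun m => U k m - w (L k) (m * (T / M k)))) atTop (𝓝 0) →
            Tendsto (fun k => energyNorm (T / M k) (M k)
              (fun m => U k m - u (m * (T / M k)))) atTop (𝓝 0)) := by
  refine ⟨errorConst n T α β, errorConst_pos n hT hα hβ, ?_⟩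
  intro D hD _ _ a b ha hb S f hf u hu hsol w hw
  have hfin := S.finiteDimensional_VL
  -- Kept as a separate fact because the convergence statement uses the first order estimate again.
  have first : MemHFields T 3 u → ∀ L M : ℕ, 0 < M → ∀ U : ℕ → MSpace d D n,
      IsDiscreteSolution T a b f (S.VL L) M U → _ := fun h3 L M hM U hU =>
    error_estimate hT hα hβ hD ha hb hf hu hsol (hw L) le_rfl h3 hM
      (by positivity : 0 ≤ T / (M : ℝ)) (fun F hF => hF.sum_consistency_le_one le_rfl hT hM) hU
  refine ⟨first, fun h4 L M hM U hU => ?_, fun h3 hS L M hM hL hMt U hU hI => ?_⟩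
  · exact error_estimate hT hα hβ hD ha hb hf hu hsol (hw L) (by norm_num) h4 hM
      (by positivity : 0 ≤ (T / (M : ℝ)) ^ 2)
      (fun F hF => hF.sum_consistency_le_two le_rfl hT hM) hU
  · obtain ⟨e, he, hle⟩ := projectionError_tendsto hT hα hβ hD ha hb hS hu hw
    have heL := he.comp hL
    have hτ : Tendsto (fun k => T / (M k : ℝ)) atTop (𝓝 0) :=
      (tendsto_natCast_atTop_atTop.comp hMt).const_div_atTop T
    -- The majorant tends to zero along any sequence of pairs: the constant is independent of k, and
    -- the projection errors are bounded by `e (L k)` whatever the step size.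
    have hlim : Tendsto (fun k => errorConst n T α β * (T / M k * derivNorm T 3 u + e (L k))
        + errorConst n T α β * initialNorm (T / M k) (fun m => U k m - w (L k) (m * (T / M k)))
        + e (L k)) atTop (𝓝 0) := by
      simpa using (((hτ.mul_const (derivNorm T 3 u)).add heL).const_mul (errorConst n T α β)).add
        (hI.const_mul (errorConst n T α β)) |>.add heL
    refine squeeze_zero (fun k => energyNorm_nonneg _ _ _) (fun k => ?_) hlim
    refine (first h3 (L k) (M k) (hM k) (U k) (hU k)).2.trans ?_
    have h1 := (hle (L k)).1
    have h2 := (hle (L k)).2 (M k) (hM k)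
    have hc := errorConst_pos (α := α) (β := β) n hT hα hβ
    refine add_le_add (add_le_add (mul_le_mul_of_nonneg_left ?_ hc.le) le_rfl) h2
    rw [add_assoc]
    exact add_le_add le_rfl h1
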